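/- Let $\mathbb N=\{1,2,\dots\}$, $\mathbb N_0=\mathbb N\cup\{0\}$, and let $\boldsymbol p=(p_k)_{k\in\mathbb N}$ be a probability distribution on $\mathbb N$ with $\sum_{k\ge1}k^{1+\varepsilon}p_k<\infty$ for some $\varepsilon>0$. Inequalities between sequences are coordinatewise, and $0\log 0=0$. **Notation.** For $\boldsymbol 0\le\boldsymbol q\le\boldsymbol p$ put $$H(\boldsymbol q)=\sum_{k\ge1}q_k\log q_k-\Big(\tfrac12\sum_{k\ge1}kq_k\Big)\log\Big(\tfrac12\sum_{k\ge1}kq_k\Big),\qquad K(\boldsymbol q)=\Big(\tfrac12\sum_{k\ge1}kq_k\Big)\log(1-\beta^2)-\sum_{k\ge1}q_k\log(1-\beta^k),$$ where $\beta=\beta(\boldsymbol q)$ is $0$ if $q_1=0$, and if $q_1>0$ (and $\sum_k kq_k>2\sum_k q_k$) is the unique solution in $(0,1)$ of $\sum_{k\ge1}kq_k=(1-\beta^2)\sum_{k\ge1}\frac{kq_k}{1-\beta^k}$. For $\boldsymbol x=(x_k)_{k\in\mathbb N_0}$ with $x_k\ge0$ for $k\ge1$ let $r(\boldsymbol x)=x_0^++\sum_{k\ge1}kx_k$,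 $r_0(\boldsymbol x)=x_0^+/r(\boldsymbol x)$ and $r_k(\boldsymbol x)=kx_k/r(\boldsymbol x)$ for $k\ge1$ (all $r_k(\boldsymbol x)=0$ if $r(\boldsymbol x)\notin(0,\infty)$), and let $\varsigma(\boldsymbol x^{(1)},\boldsymbol x^{(2)})=\frac12(r(\boldsymbol x^{(1)})-r(\boldsymbol x^{(2)}))$. For $T\ge0$ let $\mathcal C_T$ be the set of pairs $(\boldsymbol\zeta,\psi)$, $\boldsymbol\zeta=(\zeta_k)_{k\in\mathbb N_0}$, of functions on $[0,T]$ such that $\psi$ is absolutely continuous with $\psi(0)=0$; $\zeta_0(t)=\psi(t)-\big(\inf_{0\le s\le t}\psi(s)\big)\wedge 0$; and, for $k\ge1$, $\zeta_k$ is absolutely continuous, non-increasing and nonnegative with $\zeta_k(0)=p_k$. Let $\mathcal S_T(\boldsymbol\zeta,\psi)$ be the set of sequences $(\varphi_k)_{k\in\mathbb N_0}$ of measurable functions $\varphi_k:[0,T]\times[0,1]\to[0,\infty)$ such that for all $t\in[0,T]$ $$\psi(t)=\sum_{k\ge0}(k-2)\int_{[0,t]\times[0,1]}1_{[0,r_k(\boldsymbol\zeta(s)))}(y)\varphi_k(s,y)\,ds\,dy,\qquad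 \zeta_k(t)=p_k-\int_{[0,t]\times[0,1]}1_{[0,r_k(\boldsymbol\zeta(s)))}(y)\varphi_k(s,y)\,ds\,dy\quad(k\ge1),$$ all these integrals being finite. With $\ell(x)=x\log x-x+1$ and $0\le t_1\le t_2$, for $(\boldsymbol\zeta,\psi)\in\mathcal C_{t_2}$ let $$I_{t_1,t_2}(\boldsymbol\zeta,\psi)=\inf_{\boldsymbol\varphi\in\mathcal S_{t_2}(\boldsymbol\zeta,\psi)}\sum_{k\ge0}\int_{[t_1,t_2]\times[0,1]}\ell(\varphi_k(s,y))\,ds\,dy\in[0,\infty].$$ Let $\mathcal J^0_{t_1,t_2}(\boldsymbol x^{(1)},\boldsymbol x^{(2)})$ be the set of $(\boldsymbol\zeta,\psi)\in\mathcal C_{t_2}$ with $\boldsymbol\zeta(t_1)=\boldsymbol x^{(1)}$ and $\boldsymbol\zeta(t_2)=\boldsymbol x^{(2)}$; $\mathcal J^1_{t_1,t_2}$ the subset of those with $\psi(t)\ge\psi(t_1)-x^{(1)}_0$ for $t\in(t_1,t_2)$; and $\mathcal J^2_{t_1,t_2}$ the subset of $\mathcal J^1_{t_1,t_2}$ of those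 with $\frac{d}{dt}r(\boldsymbol\zeta(t))=-2$ for a.e. $t\in(t_1,t_2)$. Let $I^j_{t_1,t_2}(\boldsymbol x^{(1)},\boldsymbol x^{(2)})=\inf\{I_{t_1,t_2}(\boldsymbol\zeta,\psi):(\boldsymbol\zeta,\psi)\in\mathcal J^j_{t_1,t_2}(\boldsymbol x^{(1)},\boldsymbol x^{(2)})\}$ for $j=1,2$, with $\inf\emptyset=\infty$. **Proposition.** (a) Let $\boldsymbol 0\le\boldsymbol q\le\bar{\boldsymbol q}\le\boldsymbol p$, and suppose that either $\sum_k kq_k>2\sum_k q_k$, or $\sum_k kq_k=2\sum_k q_k$ and $p_1=0$. Let $t_1\ge0$, and suppose that there is some $(\boldsymbol\zeta^*,\psi^*)\in\mathcal J^0_{0,t_1}((0,\boldsymbol p),(0,\bar{\boldsymbol q}))$ with $I_{0,t_1}(\boldsymbol\zeta^*,\psi^*)<\infty$. Let $\tau=\varsigma((0,\bar{\boldsymbol q}),(0,\bar{\boldsymbol q}-\boldsymbol q))=\frac12\sum_k kq_k$. Then $$\inf_{t_2\ge t_1}I^1_{t_1,t_2}\big((0,\bar{\boldsymbol q}),(0,\bar{\boldsymbol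 q}-\boldsymbol q)\big)=I^2_{t_1,t_1+\tau}\big((0,\bar{\boldsymbol q}),(0,\bar{\boldsymbol q}-\boldsymbol q)\big)=H(\boldsymbol q)+H(\bar{\boldsymbol q}-\boldsymbol q)-H(\bar{\boldsymbol q})+K(\boldsymbol q).$$ (b) Suppose $p_1=0$, $\boldsymbol q\ge\boldsymbol 0$, $\bar{\boldsymbol q}\ge\boldsymbol 0$, $\boldsymbol q+\bar{\boldsymbol q}\le\boldsymbol p$, $\sum_k kq_k\ge2\sum_k q_k$ and $\sum_k k\bar q_k\ge2\sum_k\bar q_k$. Let $\tau=\varsigma((0,\boldsymbol p),(0,\boldsymbol p-\boldsymbol q))=\frac12\sum_k kq_k$ and $\bar\tau=\frac12\sum_k k\bar q_k$. Then $$I^2_{0,\bar\tau}\big((0,\boldsymbol p),(0,\boldsymbol p-\bar{\boldsymbol q})\big)+I^2_{\bar\tau,\bar\tau+\tau}\big((0,\boldsymbol p-\bar{\boldsymbol q}),(0,\boldsymbol p-\bar{\boldsymbol q}-\boldsymbol q)\big)=I^2_{0,\tau}\big((0,\boldsymbol p),(0,\boldsymbol p-\boldsymbol q)\big)+I^2_{\tau,\tau+\bar\tau}\big((0,\boldsymbol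 p-\boldsymbol q),(0,\boldsymbol p-\boldsymbol q-\bar{\boldsymbol q})\big).$$ -/

import Mathlib

open MeasureTheory Set
open scoped ENNReal NNReal

noncomputable section

namespace ConfigModel

/-- A degree configuration `(q_k)_{k ≥ 1}`. -/
abbrev DegSeq := ℕ+ → ℝ

/-- A state `(x_k)_{k ≥ 0}`; coordinate `0` stands for the active half-edges. -/
abbrev State := ℕ → ℝ

/-- The state `(x₀, q)`. -/
def state (x₀ : ℝ) (q : DegSeq) : State :=
  fun k => if h : 0 < k then q ⟨k, h⟩ else x₀

/-- `∑_{k ≥ 1} q_k`. -/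
def vertexMass (q : DegSeq) : ℝ := ∑' k : ℕ+, q k

/-- `∑_{k ≥ 1} k q_k`. -/
def degreeMass (q : DegSeq) : ℝ := ∑' k : ℕ+, (k : ℝ) * q k

/-- `H(q) = ∑ q_k log q_k - (½ ∑ k q_k) log (½ ∑ k q_k)`, with `0 log 0 = 0`. -/
def H (q : DegSeq) : ℝ :=
  ∑' k : ℕ+, q k * Real.log (q k)
    - (1 / 2 * degreeMass q) * Real.log (1 / 2 * degreeMass q)

/-- The property that determines `β(q)`: it is `0` if `q₁ = 0`, and if `q₁ > 0` it is the solution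
in `(0,1)` of `∑ k q_k = (1 - β²) ∑ k q_k / (1 - β^k)`. -/
def IsBeta (q : DegSeq) (b : ℝ) : Prop :=
  (q 1 = 0 ∧ b = 0) ∨
    (0 < q 1 ∧ 0 < b ∧ b < 1 ∧
      degreeMass q = (1 - b ^ 2) * ∑' k : ℕ+, (k : ℝ) * q k / (1 - b ^ (k : ℕ)))

/-- `β(q)`. -/
def betaOf (q : DegSeq) : ℝ := Classical.epsilon (IsBeta q)

/-- `K(q) = (½ ∑ k q_k) log (1 - β²) - ∑ q_k log (1 - β^k)`, with `β = β(q)`. -/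
def K (q : DegSeq) : ℝ :=
  (1 / 2 * degreeMass q) * Real.log (1 - betaOf q ^ 2)
    - ∑' k : ℕ+, q k * Real.log (1 - betaOf q ^ (k : ℕ))

/-- Half-edge mass carried by coordinate `k`: `x₀⁺` for `k = 0` and `k x_k` for `k ≥ 1`. -/
def mass (x : State) (k : ℕ) : ℝ := if k = 0 then max (x 0) 0 else (k : ℝ) * x k

/-- `r(x) = x₀⁺ + ∑_{k ≥ 1} k x_k`. (If the series diverges this is `0` by convention; together
with division by zero this gives `rate x k = 0` whenever `r(x)` is not in `(0,∞)`.) -/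
def r (x : State) : ℝ := ∑' k : ℕ, mass x k

/-- `r_k(x)`, `k ≥ 0`: the share of coordinate `k` in `r(x)`, and `0` if `r(x) ∉ (0,∞)`. -/
def rate (x : State) (k : ℕ) : ℝ := mass x k / r x

/-- `ς(x¹, x²) = ½ (r(x¹) - r(x²))`. -/
def varsigma (x₁ x₂ : State) : ℝ := 1 / 2 * (r x₁ - r x₂)

/-- One-dimensional Skorokhod map `Γ(ψ)(t) = ψ(t) - (inf_{0 ≤ s ≤ t} ψ(s)) ∧ 0`. -/
def skorokhod (ψ : ℝ → ℝ) (t : ℝ) : ℝ := ψ t - min (sInf (ψ '' Icc 0 t)) 0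

/-- The path class `𝒞_T`. Paths are functions on `ℝ`, of which only the values on `[0,T]`
matter. -/
structure IsPath (p : DegSeq) (T : ℝ) (ζ : ℝ → State) (ψ : ℝ → ℝ) : Prop where
  psi_zero : ψ 0 = 0
  psi_ac : AbsolutelyContinuousOnInterval ψ 0 T
  zeta_zero : ∀ t ∈ Icc 0 T, ζ t 0 = skorokhod ψ t
  zeta_init : ∀ k : ℕ+, ζ 0 k = p k
  zeta_anti : ∀ k : ℕ+, AntitoneOn (fun t => ζ t k) (Icc 0 T)
  zeta_ac : ∀ k : ℕ+, AbsolutelyContinuousOnInterval (fun t => ζ t k) 0 T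
  zeta_nonneg : ∀ k : ℕ+, ∀ t ∈ Icc 0 T, 0 ≤ ζ t k

/-- `ℓ(x) = x log x - x + 1`. -/
def ell (x : ℝ) : ℝ := x * Real.log x - x + 1

/-- The integrand `1_{[0, r_k(ζ(s)))}(y) φ_k(s,y)`, as a function of `(s,y)`. -/
def thinned (ζ : ℝ → State) (φ : ℕ → ℝ × ℝ → ℝ≥0) (k : ℕ) : ℝ × ℝ → ℝ :=
  indicator {z : ℝ × ℝ | z.2 < rate (ζ z.1) k} (fun z => (φ k z : ℝ))

/-- `φ ∈ 𝒮_T(ζ,ψ)`: nonnegative measurable controls that drive the path `(ζ,ψ)` on `[0,T]`. -/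
structure IsControl (p : DegSeq) (T : ℝ) (ζ : ℝ → State) (ψ : ℝ → ℝ)
    (φ : ℕ → ℝ × ℝ → ℝ≥0) : Prop where
  measurable : ∀ k, Measurable (φ k)
  integrable : ∀ k, IntegrableOn (thinned ζ φ k) (Icc 0 T ×ˢ Icc 0 1)
  psi_eq : ∀ t ∈ Icc 0 T,
    HasSum (fun k : ℕ => ((k : ℝ) - 2) * ∫ z in Icc 0 t ×ˢ Icc 0 1, thinned ζ φ k z) (ψ t)
  zeta_eq : ∀ k : ℕ+, ∀ t ∈ Icc 0 T,
    ζ t k = p k - ∫ z in Icc 0 t ×ˢ Icc 0 1, thinned ζ φ k z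

/-- `∑_{k ≥ 0} ∫_{[t₁,t₂] × [0,1]} ℓ(φ_k(s,y)) ds dy`, in `[0,∞]` (note `ℓ ≥ 0` on `[0,∞)`). -/
def controlCost (t₁ t₂ : ℝ) (φ : ℕ → ℝ × ℝ → ℝ≥0) : ℝ≥0∞ :=
  ∑' k : ℕ, ∫⁻ z in Icc t₁ t₂ ×ˢ Icc (0 : ℝ) 1, ENNReal.ofReal (ell (φ k z))

/-- `I_{t₁,t₂}(ζ,ψ)`, the infimum being over `𝒮_{t₂}(ζ,ψ)`. -/
def pathCost (p : DegSeq) (t₁ t₂ : ℝ) (ζ : ℝ → State) (ψ : ℝ → ℝ) : ℝ≥0∞ :=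
  ⨅ (φ : ℕ → ℝ × ℝ → ℝ≥0) (_ : IsControl p t₂ ζ ψ φ), controlCost t₁ t₂ φ

/-- `𝒥⁰_{t₁,t₂}(x¹,x²)`. -/
def J0 (p : DegSeq) (t₁ t₂ : ℝ) (x₁ x₂ : State) : Set ((ℝ → State) × (ℝ → ℝ)) :=
  {γ | IsPath p t₂ γ.1 γ.2 ∧ γ.1 t₁ = x₁ ∧ γ.1 t₂ = x₂}

/-- `𝒥¹_{t₁,t₂}(x¹,x²)`: no reflection takes place on `(t₁,t₂)`. -/
def J1 (p : DegSeq) (t₁ t₂ : ℝ) (x₁ x₂ : State) : Set ((ℝ → State) × (ℝ → ℝ)) :=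
  {γ | γ ∈ J0 p t₁ t₂ x₁ x₂ ∧ ∀ t ∈ Ioo t₁ t₂, γ.2 t₁ - x₁ 0 ≤ γ.2 t}

/-- `𝒥²_{t₁,t₂}(x¹,x²)`: moreover `d r(ζ(t))/dt = -2` for a.e. `t ∈ (t₁,t₂)`. -/
def J2 (p : DegSeq) (t₁ t₂ : ℝ) (x₁ x₂ : State) : Set ((ℝ → State) × (ℝ → ℝ)) :=
  {γ | γ ∈ J1 p t₁ t₂ x₁ x₂ ∧
    ∀ᵐ t ∂(volume.restrict (Ioo t₁ t₂)), HasDerivAt (fun s => r (γ.1 s)) (-2) t}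

/-- `I¹_{t₁,t₂}(x¹,x²)`; the infimum over the empty set is `∞`. -/
def I1 (p : DegSeq) (t₁ t₂ : ℝ) (x₁ x₂ : State) : ℝ≥0∞ :=
  ⨅ γ ∈ J1 p t₁ t₂ x₁ x₂, pathCost p t₁ t₂ γ.1 γ.2

/-- `I²_{t₁,t₂}(x¹,x²)`; the infimum over the empty set is `∞`. -/
def I2 (p : DegSeq) (t₁ t₂ : ℝ) (x₁ x₂ : State) : ℝ≥0∞ :=
  ⨅ γ ∈ J2 p t₁ t₂ x₁ x₂, pathCost p t₁ t₂ γ.1 γ.2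

/-- The standing assumption on the limiting degree distribution: a probability distribution on
`{1,2,…}` with a finite moment of some order `1 + ε`, `ε > 0`. -/
structure IsDegreeLaw (p : DegSeq) : Prop where
  nonneg : 0 ≤ p
  total : HasSum p 1
  moment : ∃ ε : ℝ, 0 < ε ∧ Summable (fun k : ℕ+ => p k * (k : ℝ) ^ (1 + ε))

end ConfigModel

end

open Filter Topology

noncomputable section

namespace ConfigModel

/-! ### Measure-theoretic and analytic preliminaries -/

/-! Between `t₁` and `t₂` a path without reflection is described by its intensities `u_k`, the
integrals of the controls over `[0, r_k)`. Each jump consumes two half-edges. Hence, with `U = ∑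
u_k` and `m₀ = ½∑kq_k`, the quantity `m = m₀ - ∫ U` decreases from `m₀` to `0` whatever `t₂` is, and
half the half-edge mass of the state equals `M = m + ½∑k(qbar - q)_k`. So `m` serves as a clock and
the problem has an explicit calibration.

The candidate optimal path has `x_k = (qbar - q)_k + c_k((m + C)^{k/2} - C^{k/2})`, with `c_k` fixed
by `x_k = qbar_k` at `m = m₀`. Its intensities are the derivatives in `m` for `k ≥ 1`, and `x_0/(2(m
+ C))` for `k = 0`. They sum to `1` exactly when `∑ k c_k C^{k/2} = 2C`, which for `C = m₀β²/(1 -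
β²)` is the equation of `β`. Then `m` decreases at unit speed and the duration is `τ = m₀`.

Lower bound. Convexity of `ell` gives, for any weights `E_k`, a cost rate of at least `∑ u_k log E_k
- U ∑ r_k E_k + U` (`le_tsum_lintegral_ell`). Taking for `E_k` the ratio of intensity to rate on the
candidate, at the same `m`, turns the right side into the time derivative of an explicit potential
along every competitor (`le_cost_rate`). Integration leaves boundary values, equal to `H q + H (qbar
- q) - H qbar + excess C q`. The argument works for every `C > 0`, on the regularized profile with
`(qbar - q) + εq` in place of `qbar - q` and up to the time when `m = δ`; then `δ`, then `ε`, and if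
`β = 0` also `C`, tend to `0` (`le_controlCost_of_regularization`, `le_I1_of_pos`, `le_I1_of_zero`).
At the `C` belonging to `β` the excess is `K q`.

Upper bound. Along the candidate the cost rate is the derivative in `m` of `costToGo`, whose
increment over `[0, m₀]` is the same value (`IsBeta.hasSum_costSlope`, `IsBeta.costToGo_sub`).
Admissibility requires `x_0 ≥ 0`, which follows from a chord inequality for powers summed against
the equation of `β` (`IsBeta.active_nonneg`). The candidate is appended to the given path of finite
cost (`IsAdmissible.I2_le`). Since both bounds use the same root, existence of `β` suffices and
uniqueness plays no role.

For (b), adding the formula of (a) for the two successive excursions gives an expression symmetric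
in the two sequences (`I2_add_I2`). -/

theorem ofReal_integral_le_lintegral {α : Type*} [MeasurableSpace α] {μ : Measure α} (f : α → ℝ) :
    ENNReal.ofReal (∫ a, f a ∂μ) ≤ ∫⁻ a, ENNReal.ofReal (f a) ∂μ := by
  by_cases hf : Integrable f μ
  · rw [integral_eq_lintegral_pos_part_sub_lintegral_neg_part hf]
    refine (ENNReal.ofReal_le_ofReal (sub_le_self _ ENNReal.toReal_nonneg)).trans ?_
    exact ENNReal.ofReal_toReal_le
  · simp [integral_undef hf]

theorem ae_summable_of_summable_integral_norm {α ι : Type*} [MeasurableSpace α] [Countable ι]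
    {μ : Measure α} {F : ι → α → ℝ} (hF : ∀ i, Integrable (F i) μ)
    (hs : Summable fun i => ∫ a, ‖F i a‖ ∂μ) : ∀ᵐ a ∂μ, Summable fun i => F i a := by
  have h1 : ∫⁻ a, ∑' i, ‖F i a‖ₑ ∂μ ≠ ∞ := by
    rw [lintegral_tsum fun i => (hF i).1.enorm]
    have h2 : ∀ i, ∫⁻ a, ‖F i a‖ₑ ∂μ = ENNReal.ofReal (∫ a, ‖F i a‖ ∂μ) := fun i =>
      (ofReal_integral_norm_eq_lintegral_enorm (hF i)).symm
    simp_rw [h2]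
    rw [← ENNReal.ofReal_tsum_of_nonneg (fun i => integral_nonneg fun a => norm_nonneg _) hs]
    exact ENNReal.ofReal_ne_top
  have h3 := ae_lt_top' (AEMeasurable.tsum fun i => (hF i).1.enorm) h1
  filter_upwards [h3] with a ha
  have h4 : Summable fun i => ‖F i a‖₊ := by
    rw [← ENNReal.tsum_coe_ne_top_iff_summable]
    exact ha.ne
  exact Summable.of_norm (by simpa using NNReal.summable_coe.2 h4)

theorem _root_.AbsolutelyContinuousOnInterval.lipschitz_comp {f g : ℝ → ℝ} {a b : ℝ} {K : ℝ≥0}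
    (hf : AbsolutelyContinuousOnInterval f a b) {s : Set ℝ} (hg : LipschitzOnWith K g s)
    (hs : MapsTo f (uIcc a b) s) : AbsolutelyContinuousOnInterval (fun x => g (f x)) a b := by
  rw [absolutelyContinuousOnInterval_iff] at hf ⊢
  intro ε hε
  -- `K + 1` rather than `K`, since the Lipschitz constant may be `0`.
  obtain ⟨δ, hδ, h⟩ := hf (ε / (K + 1)) (by positivity)
  refine ⟨δ, hδ, fun E hE hE' => ?_⟩
  have h1 := h E hE hE'
  have h2 : ∑ i ∈ Finset.range E.1, dist (g (f (E.2 i).1)) (g (f (E.2 i).2))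
      ≤ ∑ i ∈ Finset.range E.1, (K : ℝ) * dist (f (E.2 i).1) (f (E.2 i).2) :=
    Finset.sum_le_sum fun i hi =>
      hg.dist_le_mul _ (hs (hE.1 i hi).1) _ (hs (hE.1 i hi).2)
  rw [← Finset.mul_sum] at h2
  have h0 : 0 ≤ ∑ i ∈ Finset.range E.1, dist (f (E.2 i).1) (f (E.2 i).2) :=
    Finset.sum_nonneg fun i _ => dist_nonneg
  rw [lt_div_iff₀ (by positivity)] at h1
  have : (K : ℝ) * ∑ i ∈ Finset.range E.1, dist (f (E.2 i).1) (f (E.2 i).2)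
      ≤ (∑ i ∈ Finset.range E.1, dist (f (E.2 i).1) (f (E.2 i).2)) * (K + 1) := by
    nlinarith
  linarith

theorem _root_.AbsolutelyContinuousOnInterval.contDiffOn_comp {f g : ℝ → ℝ} {a b c d : ℝ}
    (hf : AbsolutelyContinuousOnInterval f a b) (hg : ContDiffOn ℝ 1 g (Icc c d))
    (hs : MapsTo f (uIcc a b) (Icc c d)) :
    AbsolutelyContinuousOnInterval (fun x => g (f x)) a b := by
  obtain ⟨K, hK⟩ := hg.exists_lipschitzOnWith (by decide) (convex_Icc _ _) isCompact_Icc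
  exact hf.lipschitz_comp hK hs

theorem _root_.AbsolutelyContinuousOnInterval.intervalIntegral_eq_sub {f f' : ℝ → ℝ} {a b : ℝ}
    (hf : AbsolutelyContinuousOnInterval f a b)
    (hd : ∀ᵐ x, x ∈ uIcc a b → HasDerivAt f (f' x) x) :
    IntervalIntegrable f' volume a b ∧ ∫ x in a..b, f' x = f b - f a := by
  have hae : deriv f =ᵐ[volume.restrict (uIoc a b)] f' := by
    rw [EventuallyEq, ae_restrict_iff' measurableSet_uIoc]
    filter_upwards [hd] with x hx hx'
    exact (hx (uIoc_subset_uIcc hx')).deriv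
  refine ⟨hf.intervalIntegrable_deriv.congr_ae hae, ?_⟩
  rw [← hf.integral_deriv_eq_sub]
  refine intervalIntegral.integral_congr_ae ?_
  filter_upwards [hd] with x hx hx'
  exact (hx (uIoc_subset_uIcc hx')).deriv.symm

theorem hasSum_nat_iff_pnat {f : ℕ → ℝ} {a : ℝ} :
    HasSum f a ↔ HasSum (fun k : ℕ+ => f k) (a - f 0) := by
  rw [← hasSum_nat_add_iff' (f := f) 1, ← Equiv.pnatEquivNat.symm.hasSum_iff]
  simp [Function.comp_def, Equiv.pnatEquivNat]

theorem summable_nat_iff_pnat {f : ℕ → ℝ} :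
    Summable f ↔ Summable fun k : ℕ+ => f k := by
  constructor
  · rintro ⟨a, ha⟩
    exact ⟨_, hasSum_nat_iff_pnat.1 ha⟩
  · rintro ⟨a, ha⟩
    exact ⟨a + f 0, hasSum_nat_iff_pnat.2 (by simpa using ha)⟩

/-! ### The cost function `ell` -/

/-- The left side is the tangent line of the convex function `ell` at `E`, with slope `log E`; the
inequality is `log t ≤ t - 1` at `t = E/x`. At `E = 0` the convention `log 0 = 0` would make it fail
for some `x > 0`, for instance `x = 1`, whence the alternative. -/
theorem le_ell {x E : ℝ} (hx : 0 ≤ x) (hE : 0 ≤ E) (h : 0 < E ∨ x = 0) :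
    x * Real.log E - E + 1 ≤ ell x := by
  unfold ell
  rcases hx.eq_or_lt with rfl | hx'
  · simp; linarith
  · have hE' : 0 < E := h.resolve_right hx'.ne'
    have h1 := Real.log_le_sub_one_of_pos (div_pos hE' hx')
    rw [Real.log_div hE'.ne' hx'.ne'] at h1
    have h2 : x * (Real.log E - Real.log x) ≤ x * (E / x - 1) :=
      mul_le_mul_of_nonneg_left h1 hx
    have h3 : x * (E / x - 1) = E - x := by field_simp
    linarith [mul_sub x (Real.log E) (Real.log x)]

theorem ell_nonneg {x : ℝ} (hx : 0 ≤ x) : 0 ≤ ell x := by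
  simpa using le_ell hx zero_le_one (Or.inl one_pos)

theorem measurable_ell : Measurable ell := by
  unfold ell; fun_prop

/-- The tangent at `exp (-k)`. Taking `k` to be the degree makes the bound summable against a first
moment, so all entropies converge without further assumptions. -/
theorem abs_mul_log_le {x : ℝ} (h0 : 0 ≤ x) (h1 : x ≤ 1) (k : ℝ) :
    |x * Real.log x| ≤ k * x + Real.exp (-k) := by
  have h2 := le_ell h0 (Real.exp_pos (-k)).le (Or.inl (Real.exp_pos (-k)))
  rw [Real.log_exp] at h2
  unfold ell at h2
  have h3 : x * Real.log x ≤ 0 := Real.mul_log_nonpos h0 h1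
  rw [abs_of_nonpos h3]
  linarith

/-- Fenchel–Young bound for one section of a control thinned at level `R`. -/
theorem le_lintegral_ell {φ : ℝ → ℝ≥0} {R E : ℝ} (hR0 : 0 ≤ R) (hR1 : R ≤ 1)
    (hint : IntegrableOn (indicator {y | y < R} fun y => (φ y : ℝ)) (Icc 0 1)) (hE : 0 ≤ E)
    (h : 0 < E ∨ ∫ y in Icc 0 1, indicator {y | y < R} (fun y => (φ y : ℝ)) y = 0) :
    ENNReal.ofReal ((∫ y in Icc 0 1, indicator {y | y < R} (fun y => (φ y : ℝ)) y) * Real.log E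
        - R * E + R) ≤ ∫⁻ y in Icc (0 : ℝ) 1, ENNReal.ofReal (ell (φ y)) := by
  have hset : Icc (0 : ℝ) 1 ∩ {y | y < R} = Ico 0 R := by
    ext y; simp only [mem_inter_iff, mem_Icc, mem_ofPred_eq, mem_Ico]
    constructor
    · rintro ⟨⟨a, b⟩, c⟩; exact ⟨a, c⟩
    · rintro ⟨a, b⟩; exact ⟨⟨a, by linarith⟩, b⟩
  have hmeas : MeasurableSet {y : ℝ | y < R} := measurableSet_Iio
  have hφ : IntegrableOn (fun y => (φ y : ℝ)) (Ico 0 R) := by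
    have := (integrable_indicator_iff hmeas).1 hint
    rwa [IntegrableOn, Measure.restrict_restrict hmeas, inter_comm, hset] at this
  have hu : ∫ y in Icc 0 1, indicator {y | y < R} (fun y => (φ y : ℝ)) y
      = ∫ y in Ico 0 R, (φ y : ℝ) := by
    rw [setIntegral_indicator hmeas, hset]
  rw [hu] at h ⊢
  have hpt : ∀ᵐ y ∂volume.restrict (Ico 0 R),
      (φ y : ℝ) * Real.log E - E + 1 ≤ ell (φ y) := by
    rcases h with h | h
    · exact ae_of_all _ fun y => le_ell (φ y).2 hE (Or.inl h)
    · have h := (integral_eq_zero_iff_of_nonneg (f := fun y => (φ y : ℝ)) (fun y => (φ y).2) hφ).1 h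
      filter_upwards [h] with y hy
      exact le_ell (φ y).2 hE (Or.inr hy)
  have hval : (∫ y in Ico 0 R, (φ y : ℝ)) * Real.log E - R * E + R
      = ∫ y in Ico 0 R, ((φ y : ℝ) * Real.log E - E + 1) := by
    rw [integral_add, integral_sub, integral_mul_const]
    · simp [hR0]
    · exact hφ.mul_const _
    · simp
    · exact (hφ.mul_const _).sub (by simp)
    · simp
  rw [hval]
  calc _ ≤ ∫⁻ y in Ico 0 R, ENNReal.ofReal ((φ y : ℝ) * Real.log E - E + 1) :=
        ofReal_integral_le_lintegral _
    _ ≤ ∫⁻ y in Ico 0 R, ENNReal.ofReal (ell (φ y)) :=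
        lintegral_mono_ae (hpt.mono fun y hy => ENNReal.ofReal_le_ofReal hy)
    _ ≤ _ := lintegral_mono_set (hset ▸ inter_subset_left)

/-- Calibration bound for the cost rate of a sequence of thinned sections. -/
theorem le_tsum_lintegral_ell {φ : ℕ → ℝ → ℝ≥0} {R E u : ℕ → ℝ} {U V : ℝ}
    (hR0 : ∀ k, 0 ≤ R k) (hR : HasSum R 1)
    (hint : ∀ k, IntegrableOn (indicator {y | y < R k} fun y => (φ k y : ℝ)) (Icc 0 1))
    (hu : ∀ k, u k = ∫ y in Icc 0 1, indicator {y | y < R k} (fun y => (φ k y : ℝ)) y)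
    (hU : HasSum u U) (hE : ∀ k, 0 ≤ E k) (h : ∀ k, 0 < E k ∨ u k = 0)
    (hV : HasSum (fun k => u k * Real.log (E k) - U * (R k * E k)) V) :
    ENNReal.ofReal (V + U) ≤ ∑' k, ∫⁻ y in Icc (0 : ℝ) 1, ENNReal.ofReal (ell (φ k y)) := by
  have hu0 : ∀ k, 0 ≤ u k := fun k => by
    rw [hu k]
    exact integral_nonneg fun y => indicator_nonneg (fun y _ => (φ k y).2) y
  have hU0 : 0 ≤ U := hU.nonneg hu0
  -- At total rate `0` every `u k` vanishes, the claimed bound is `0`, and the weights `U * E k`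
  -- used below would degenerate.
  rcases hU0.eq_or_lt with hU' | hU'
  · have hu' : ∀ k, u k = 0 := by
      have := (hasSum_zero_iff_of_nonneg hu0).1 (hU' ▸ hU)
      intro k; rw [this]; rfl
    have : V = 0 := by
      refine hV.unique ?_
      simp [hu', ← hU', hasSum_zero]
    simp [this, ← hU']
  · have hR1 : ∀ k, R k ≤ 1 := fun k => le_hasSum hR k fun j _ => hR0 j
    -- The tangent points are `U * E k`. The extra factor `U` makes the bound homogeneous in the
    -- speed, so that the clock may run at any rate.
    have key : ∀ k, ENNReal.ofReal (u k * Real.log (U * E k) - R k * (U * E k) + R k)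
        ≤ ∫⁻ y in Icc (0 : ℝ) 1, ENNReal.ofReal (ell (φ k y)) := fun k => by
      have h1 : 0 < U * E k ∨
          ∫ y in Icc 0 1, indicator {y | y < R k} (fun y => (φ k y : ℝ)) y = 0 := by
        rcases h k with h | h
        · exact Or.inl (mul_pos hU' h)
        · exact Or.inr ((hu k).symm.trans h)
      have := le_lintegral_ell (hR0 k) (hR1 k) (hint k) (mul_nonneg hU0 (hE k)) h1
      rwa [← hu k] at this
    have hsum : HasSum (fun k => u k * Real.log (U * E k) - R k * (U * E k) + R k)
        (V + U * Real.log U + 1) := by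
      have h2 := (hV.add (hU.mul_right (Real.log U))).add hR
      refine h2.congr_fun fun k => ?_
      rcases h k with h | h
      · rw [Real.log_mul hU'.ne' h.ne']; ring
      · rw [h]; ring
    -- The difference of the two sides is `ell U ≥ 0`, with equality at unit speed.
    have h3 : V + U ≤ V + U * Real.log U + 1 := by
      have := ell_nonneg hU0
      unfold ell at this
      linarith
    calc ENNReal.ofReal (V + U) ≤ ENNReal.ofReal (V + U * Real.log U + 1) :=
          ENNReal.ofReal_le_ofReal h3
      _ ≤ ∑' k, ENNReal.ofReal (u k * Real.log (U * E k) - R k * (U * E k) + R k) := by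
          -- The terms have no fixed sign, so only subadditivity of `ENNReal.ofReal` on finite
          -- partial sums is available.
          refine le_of_tendsto (ENNReal.tendsto_ofReal hsum) ?_
          filter_upwards with s
          calc _ ≤ ∑ k ∈ s, ENNReal.ofReal (u k * Real.log (U * E k) - R k * (U * E k) + R k) := by
                induction s using Finset.cons_induction with
                | empty => simp
                | cons a s ha ih =>
                  rw [Finset.sum_cons, Finset.sum_cons]
                  exact ENNReal.ofReal_add_le.trans (add_le_add_right ih _)
            _ ≤ _ := ENNReal.sum_le_tsum s
      _ ≤ _ := ENNReal.tsum_le_tsum key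

/-! ### Summability for sequences below a degree law -/

theorem pnat_one_le (k : ℕ+) : (1 : ℝ) ≤ k := by exact_mod_cast k.pos

theorem IsDegreeLaw.le_one {p : DegSeq} (hp : IsDegreeLaw p) (k : ℕ+) : p k ≤ 1 :=
  le_hasSum hp.total k fun j _ => hp.nonneg j

theorem IsDegreeLaw.summable_mul {p : DegSeq} (hp : IsDegreeLaw p) :
    Summable fun k : ℕ+ => (k : ℝ) * p k := by
  obtain ⟨ε, hε, h⟩ := hp.moment
  refine Summable.of_nonneg_of_le (fun k => mul_nonneg (by positivity) (hp.nonneg k))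
    (fun k => ?_) h
  rw [mul_comm]
  refine mul_le_mul_of_nonneg_left ?_ (hp.nonneg k)
  exact Real.self_le_rpow_of_one_le (pnat_one_le k) (by linarith)

theorem IsDegreeLaw.summable_mul_of_le {p x : DegSeq} (hp : IsDegreeLaw p) (h0 : 0 ≤ x)
    (hx : x ≤ p) : Summable fun k : ℕ+ => (k : ℝ) * x k :=
  Summable.of_nonneg_of_le (fun k => mul_nonneg (by positivity) (h0 k))
    (fun k => mul_le_mul_of_nonneg_left (hx k) (by positivity)) hp.summable_mul

theorem IsDegreeLaw.summable_of_le {p x : DegSeq} (hp : IsDegreeLaw p) (h0 : 0 ≤ x)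
    (hx : x ≤ p) : Summable x :=
  Summable.of_nonneg_of_le h0 hx hp.total.summable

theorem summable_exp_neg_pnat : Summable fun k : ℕ+ => Real.exp (-(k : ℝ)) :=
  summable_nat_iff_pnat.1 Real.summable_exp_neg_nat

theorem IsDegreeLaw.summable_bound {p : DegSeq} (hp : IsDegreeLaw p) :
    Summable fun k : ℕ+ => (k : ℝ) * p k + Real.exp (-(k : ℝ)) :=
  hp.summable_mul.add summable_exp_neg_pnat

theorem IsDegreeLaw.abs_mul_log_le {p : DegSeq} (hp : IsDegreeLaw p) {k : ℕ+} {x : ℝ}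
    (h0 : 0 ≤ x) (hx : x ≤ p k) : |x * Real.log x| ≤ (k : ℝ) * p k + Real.exp (-(k : ℝ)) :=
  (ConfigModel.abs_mul_log_le h0 (hx.trans (hp.le_one k)) k).trans
    (by gcongr)

theorem IsDegreeLaw.summable_abs_mul_log {p x : DegSeq} (hp : IsDegreeLaw p) (h0 : 0 ≤ x)
    (hx : x ≤ p) : Summable fun k : ℕ+ => |x k * Real.log (x k)| :=
  Summable.of_nonneg_of_le (fun _ => abs_nonneg _) (fun k => hp.abs_mul_log_le (h0 k) (hx k))
    hp.summable_bound

theorem IsDegreeLaw.summable_mul_log {p x : DegSeq} (hp : IsDegreeLaw p) (h0 : 0 ≤ x)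
    (hx : x ≤ p) : Summable fun k : ℕ+ => x k * Real.log (x k) :=
  (hp.summable_abs_mul_log h0 hx).of_abs

/-! ### Total masses -/

@[simp] theorem state_zero (x : ℝ) (q : DegSeq) : state x q 0 = x := by simp [state]

@[simp] theorem state_pnat (x : ℝ) (q : DegSeq) (k : ℕ+) : state x q k = q k := by
  simp only [state, k.pos, dite_true]; rfl

theorem state_ext {x y : State} (h0 : x 0 = y 0) (h : ∀ k : ℕ+, x k = y k) : x = y := by
  funext k
  rcases Nat.eq_zero_or_pos k with rfl | hk
  · exact h0
  · exact h ⟨k, hk⟩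

@[simp] theorem mass_zero (x : State) : mass x 0 = max (x 0) 0 := by simp [mass]

@[simp] theorem mass_pnat (x : State) (k : ℕ+) : mass x k = k * x k := by
  simp [mass]

theorem hasSum_mass {x : State} {a : ℝ} (h : HasSum (fun k : ℕ+ => (k : ℝ) * x k) a) :
    HasSum (mass x) (max (x 0) 0 + a) := by
  rw [hasSum_nat_iff_pnat]
  simpa using h

theorem r_state_zero {q : DegSeq} (h : Summable fun k : ℕ+ => (k : ℝ) * q k) :
    r (state 0 q) = degreeMass q := by
  have : HasSum (fun k : ℕ+ => (k : ℝ) * state 0 q k) (degreeMass q) := by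
    simpa [degreeMass] using h.hasSum
  simpa [r] using (hasSum_mass this).tsum_eq

theorem degreeMass_sub {q x : DegSeq} (hq : Summable fun k : ℕ+ => (k : ℝ) * q k)
    (hx : Summable fun k : ℕ+ => (k : ℝ) * x k) :
    degreeMass (q - x) = degreeMass q - degreeMass x := by
  simp only [degreeMass, Pi.sub_apply, mul_sub]
  exact hq.tsum_sub hx

/-! ### The profile functions -/

/-- `(m + C)^{k/2} - C^{k/2}`. -/
def gap (C m : ℝ) (k : ℕ) : ℝ := √(m + C) ^ k - √C ^ k

/-- `q_k / gap C m₀ k`. -/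
def coef (C m₀ : ℝ) (q : DegSeq) (k : ℕ+) : ℝ := q k / gap C m₀ k

@[simp] theorem gap_zero (C : ℝ) (k : ℕ) : gap C 0 k = 0 := by simp [gap]

theorem gap_mono {C a b : ℝ} (h : a ≤ b) (k : ℕ) : gap C a k ≤ gap C b k := by
  unfold gap; gcongr

theorem gap_nonneg {C m : ℝ} (h : 0 ≤ m) (k : ℕ) : 0 ≤ gap C m k := by
  simpa using gap_mono (C := C) h k

theorem sqrt_ratio_lt_one {C m : ℝ} (hC : 0 ≤ C) (hm : 0 < m) : √C / √(m + C) < 1 := by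
  rw [div_lt_one (Real.sqrt_pos.2 (by linarith))]
  exact Real.sqrt_lt_sqrt hC (by linarith)

theorem gap_eq {C m : ℝ} (hC : 0 ≤ C) (hm : 0 < m) (k : ℕ) :
    gap C m k = √(m + C) ^ k * (1 - (√C / √(m + C)) ^ k) := by
  have : √(m + C) ≠ 0 := (Real.sqrt_pos.2 (by linarith)).ne'
  unfold gap
  rw [div_pow]
  field_simp

theorem one_sub_pow_ge {θ : ℝ} (h0 : 0 ≤ θ) (h1 : θ ≤ 1) (k : ℕ+) : 1 - θ ≤ 1 - θ ^ (k : ℕ) := by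
  have := pow_le_of_le_one h0 h1 k.ne_zero
  linarith

/-- With `θ = √C/√(m + C) < 1` one has `1 - θ ≤ 1 - θ^k` uniformly in `k`. This makes `gap`
comparable to the pure power, so that `coef * power` is at most a constant times `q k` in
`coef_mul_pow_le`. -/
theorem mul_pow_le_gap {C m : ℝ} (hC : 0 ≤ C) (hm : 0 < m) (k : ℕ+) :
    (1 - √C / √(m + C)) * √(m + C) ^ (k : ℕ) ≤ gap C m k := by
  rw [gap_eq hC hm, mul_comm]
  exact mul_le_mul_of_nonneg_left
    (one_sub_pow_ge (by positivity) (sqrt_ratio_lt_one hC hm).le k) (by positivity)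

theorem gap_pos {C m : ℝ} (hC : 0 ≤ C) (hm : 0 < m) (k : ℕ+) : 0 < gap C m k := by
  refine lt_of_lt_of_le ?_ (mul_pow_le_gap hC hm k)
  have := sqrt_ratio_lt_one hC hm
  have : 0 < √(m + C) := Real.sqrt_pos.2 (by linarith)
  exact mul_pos (by linarith) (by positivity)

theorem abs_log_one_sub_pow_le {θ : ℝ} (h0 : 0 ≤ θ) (h1 : θ < 1) (k : ℕ+) :
    |Real.log (1 - θ ^ (k : ℕ))| ≤ |Real.log (1 - θ)| := by
  have h2 := one_sub_pow_ge h0 h1.le k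
  have h3 : 1 - θ ^ (k : ℕ) ≤ 1 := by linarith [pow_nonneg h0 (k : ℕ)]
  rw [abs_of_nonpos (Real.log_nonpos (by linarith) h3),
    abs_of_nonpos (Real.log_nonpos (by linarith) (by linarith))]
  exact neg_le_neg (Real.log_le_log (by linarith) h2)

theorem log_gap {C m : ℝ} (hC : 0 ≤ C) (hm : 0 < m) (k : ℕ+) :
    Real.log (gap C m k) = (k : ℝ) * (1 / 2 * Real.log (m + C))
      + Real.log (1 - (√C / √(m + C)) ^ (k : ℕ)) := by
  have h1 : 0 < √(m + C) := Real.sqrt_pos.2 (by linarith)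
  have h2 := one_sub_pow_ge (by positivity) (sqrt_ratio_lt_one hC hm).le k
  have h3 := sqrt_ratio_lt_one hC hm
  rw [gap_eq hC hm, Real.log_mul (by positivity) (by linarith), Real.log_pow,
    Real.log_sqrt (by linarith)]
  ring

/-- By `log_gap` the logarithm is linear in `k` up to a bounded term, so it is summable against any
sequence with a first moment. -/
theorem exists_abs_log_gap_le {C m : ℝ} (hC : 0 ≤ C) (hm : 0 < m) :
    ∃ κ : ℝ, 0 ≤ κ ∧ ∀ k : ℕ+, |Real.log (gap C m k)| ≤ κ * k := by
  refine ⟨|1 / 2 * Real.log (m + C)| + |Real.log (1 - √C / √(m + C))|, by positivity,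
    fun k => ?_⟩
  rw [log_gap hC hm]
  refine (abs_add_le _ _).trans ?_
  rw [abs_mul, Nat.abs_cast, add_mul, mul_comm (k : ℝ)]
  gcongr
  refine (abs_log_one_sub_pow_le (by positivity) (sqrt_ratio_lt_one hC hm) k).trans ?_
  exact le_mul_of_one_le_right (abs_nonneg _) (pnat_one_le k)

theorem hasDerivAt_gap {C m : ℝ} (h : 0 < m + C) (k : ℕ) :
    HasDerivAt (fun x => gap C x k) (k * √(m + C) ^ k / (2 * (m + C))) m := by
  have h1 : HasDerivAt (fun x : ℝ => x + C) 1 m := (hasDerivAt_id m).add_const C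
  have h2 := ((h1.sqrt h.ne').pow k).sub_const (√C ^ k)
  refine h2.congr_deriv ?_
  rcases Nat.eq_zero_or_pos k with rfl | hk
  · simp
  · obtain ⟨j, rfl⟩ : ∃ j, k = j + 1 := ⟨k - 1, by omega⟩
    have h3 : √(m + C) ≠ 0 := (Real.sqrt_pos.2 h).ne'
    have h4 : √(m + C) * √(m + C) = m + C := Real.mul_self_sqrt h.le
    simp only [Nat.add_sub_cancel, pow_succ]
    field_simp
    nlinarith [h4]

theorem contDiffOn_gap {C : ℝ} (hC : 0 < C) (b : ℝ) (k : ℕ) :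
    ContDiffOn ℝ 1 (fun x => gap C x k) (Icc 0 b) := by
  intro x hx
  have : x + C ≠ 0 := by linarith [hx.1]
  refine ContDiffAt.contDiffWithinAt ?_
  unfold gap
  exact (((contDiffAt_id.add contDiffAt_const).sqrt this).pow k).sub contDiffAt_const

theorem continuous_gap (C : ℝ) (k : ℕ) : Continuous fun x => gap C x k := by
  unfold gap; fun_prop

theorem coef_nonneg {C m₀ : ℝ} (hm : 0 ≤ m₀) {q : DegSeq} (hq : 0 ≤ q) (k : ℕ+) :
    0 ≤ coef C m₀ q k := div_nonneg (hq k) (gap_nonneg hm _)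

theorem coef_pos {C m₀ : ℝ} (hC : 0 ≤ C) (hm : 0 < m₀) {q : DegSeq} {k : ℕ+} (hq : 0 < q k) :
    0 < coef C m₀ q k := div_pos hq (gap_pos hC hm k)

theorem coef_mul_gap {C m₀ : ℝ} (hC : 0 ≤ C) (hm : 0 < m₀) (q : DegSeq) (k : ℕ+) :
    coef C m₀ q k * gap C m₀ k = q k :=
  div_mul_cancel₀ _ (gap_pos hC hm k).ne'

theorem log_coef {C m₀ : ℝ} (hC : 0 ≤ C) (hm : 0 < m₀) {q : DegSeq} {k : ℕ+} (hq : 0 < q k) :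
    Real.log (coef C m₀ q k) = Real.log (q k) - Real.log (gap C m₀ k) :=
  Real.log_div hq.ne' (gap_pos hC hm k).ne'

theorem coef_mul_gap_le {C m₀ m : ℝ} (hC : 0 ≤ C) (hm : 0 < m₀) {q : DegSeq} (hq : 0 ≤ q)
    (h : m ≤ m₀) (k : ℕ+) : coef C m₀ q k * gap C m k ≤ q k := by
  rw [← coef_mul_gap hC hm q k]
  exact mul_le_mul_of_nonneg_left (gap_mono h _) (coef_nonneg hm.le hq k)

theorem coef_mul_pow_le {C m₀ : ℝ} (hC : 0 ≤ C) (hm : 0 < m₀) {q : DegSeq} (hq : 0 ≤ q)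
    (k : ℕ+) :
    coef C m₀ q k * √(m₀ + C) ^ (k : ℕ) ≤ q k / (1 - √C / √(m₀ + C)) := by
  have h1 := sqrt_ratio_lt_one hC hm
  rw [le_div_iff₀ (by linarith)]
  calc _ = coef C m₀ q k * ((1 - √C / √(m₀ + C)) * √(m₀ + C) ^ (k : ℕ)) := by ring
    _ ≤ coef C m₀ q k * gap C m₀ k :=
      mul_le_mul_of_nonneg_left (mul_pow_le_gap hC hm k) (coef_nonneg hm.le hq k)
    _ = q k := coef_mul_gap hC hm q k

/-- The entropy terms `q_k log c_k`, `c_k = coef C m₀ q k`, are summable. -/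
theorem IsDegreeLaw.summable_mul_abs_log_coef {p q : DegSeq} (hp : IsDegreeLaw p) (h0 : 0 ≤ q)
    (hq : q ≤ p) {C m₀ : ℝ} (hC : 0 ≤ C) (hm : 0 < m₀) :
    Summable fun k : ℕ+ => q k * |Real.log (coef C m₀ q k)| := by
  obtain ⟨κ, hκ, hg⟩ := exists_abs_log_gap_le hC hm
  refine Summable.of_nonneg_of_le (fun k => mul_nonneg (h0 k) (abs_nonneg _)) (fun k => ?_)
    ((hp.summable_abs_mul_log h0 hq).add ((hp.summable_mul_of_le h0 hq).mul_left κ))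
  rcases (h0 k).eq_or_lt with h | h
  · simp only [Pi.zero_apply] at h
    simp [← h]
  · simp only [Pi.zero_apply] at h
    rw [log_coef hC hm h, abs_mul, abs_of_pos h]
    have := abs_sub (Real.log (q k)) (Real.log (gap C m₀ k))
    have h2 := hg k
    nlinarith

/-! ### Termwise integration of series -/

theorem integrable_tsum_of_summable_integral_norm {α ι : Type*} [MeasurableSpace α] [Countable ι]
    {μ : Measure α} {F : ι → α → ℝ} (hF : ∀ i, Integrable (F i) μ)
    (hs : Summable fun i => ∫ a, ‖F i a‖ ∂μ) : Integrable (fun a => ∑' i, F i a) μ := by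
  have hae := ae_summable_of_summable_integral_norm hF hs
  refine ⟨?_, ?_⟩
  · refine aestronglyMeasurable_of_tendsto_ae (u := (atTop : Filter (Finset ι)))
      (f := fun s a => ∑ i ∈ s, F i a) (fun s => ?_) ?_
    · exact Finset.aestronglyMeasurable_fun_sum s fun i _ => (hF i).1
    · filter_upwards [hae] with a ha
      exact ha.hasSum
  · have h1 : ∫⁻ a, ∑' i, ‖F i a‖ₑ ∂μ < ∞ := by
      rw [lintegral_tsum fun i => (hF i).1.enorm]
      have h2 : ∀ i, ∫⁻ a, ‖F i a‖ₑ ∂μ = ENNReal.ofReal (∫ a, ‖F i a‖ ∂μ) := fun i =>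
        (ofReal_integral_norm_eq_lintegral_enorm (hF i)).symm
      simp_rw [h2]
      rw [← ENNReal.ofReal_tsum_of_nonneg (fun i => integral_nonneg fun a => norm_nonneg _) hs]
      exact ENNReal.ofReal_lt_top
    refine lt_of_le_of_lt (lintegral_mono fun a => ?_) h1
    exact enorm_tsum_le_tsum_enorm

theorem intervalIntegral_tsum {ι : Type*} [Countable ι] {u : ι → ℝ → ℝ} {a b : ℝ} (hab : a ≤ b)
    (hu : ∀ i, IntervalIntegrable (u i) volume a b)
    (hs : Summable fun i => ∫ s in a..b, ‖u i s‖) :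
    IntervalIntegrable (fun s => ∑' i, u i s) volume a b ∧
      (∀ᵐ s, s ∈ Ioc a b → Summable fun i => u i s) ∧
      ∀ t ∈ Icc a b, HasSum (fun i => ∫ s in a..t, u i s) (∫ s in a..t, ∑' i, u i s) := by
  have hu' : ∀ i, IntegrableOn (u i) (Ioc a b) := fun i =>
    (intervalIntegrable_iff_integrableOn_Ioc_of_le hab).1 (hu i)
  simp_rw [intervalIntegral.integral_of_le hab] at hs
  refine ⟨?_, ?_, fun t ht => ?_⟩
  · rw [intervalIntegrable_iff_integrableOn_Ioc_of_le hab]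
    exact integrable_tsum_of_summable_integral_norm hu' hs
  · rw [← ae_restrict_iff' measurableSet_Ioc]
    exact ae_summable_of_summable_integral_norm hu' hs
  · simp_rw [intervalIntegral.integral_of_le ht.1]
    have hsub : Ioc a t ⊆ Ioc a b := Ioc_subset_Ioc_right ht.2
    refine hasSum_integral_of_summable_integral_norm (fun i => (hu' i).mono_set hsub) ?_
    refine Summable.of_nonneg_of_le (fun i => integral_nonneg fun _ => norm_nonneg _) (fun i => ?_) hs
    exact setIntegral_mono_set (hu' i).norm (ae_of_all _ fun _ => norm_nonneg _)
      hsub.eventuallyLE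

/-! ### Reflection -/

/-- As long as `ψ` stays above `ψ t₁`, the running infimum keeps its value from time `t₁`, and so
does the regulator. Since the reflected path vanishes at `t₁`, that regulator equals `ψ t₁`. -/
theorem skorokhod_eq_sub {ψ : ℝ → ℝ} {t₁ t : ℝ} (h0 : 0 ≤ t₁) (ht : t₁ ≤ t)
    (hb : BddBelow (ψ '' Icc 0 t)) (hz : skorokhod ψ t₁ = 0)
    (hge : ∀ s ∈ Icc t₁ t, ψ t₁ ≤ ψ s) : skorokhod ψ t = ψ t - ψ t₁ := by
  have hsub : Icc 0 t₁ ⊆ Icc 0 t := Icc_subset_Icc_right ht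
  have hb' : BddBelow (ψ '' Icc 0 t₁) := hb.mono (image_mono hsub)
  have hmem : ψ t₁ ∈ ψ '' Icc 0 t₁ := mem_image_of_mem _ ⟨h0, le_rfl⟩
  have heq : sInf (ψ '' Icc 0 t) = sInf (ψ '' Icc 0 t₁) := by
    refine le_antisymm (csInf_le_csInf hb ⟨_, hmem⟩ (image_mono hsub)) ?_
    refine le_csInf ⟨_, image_mono hsub hmem⟩ ?_
    rintro _ ⟨s, hs, rfl⟩
    rcases le_total s t₁ with h | h
    · exact csInf_le hb' (mem_image_of_mem _ ⟨hs.1, h⟩)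
    · exact (csInf_le hb' hmem).trans (hge s ⟨h, hs.2⟩)
  unfold skorokhod at hz ⊢
  rw [heq]
  linarith

/-! ### Intensities of a control -/

/-- `∫_{[0,1]} 1_{[0, r_k(ζ(s)))}(y) φ_k(s,y) dy`. -/
def intensity (ζ : ℝ → State) (φ : ℕ → ℝ × ℝ → ℝ≥0) (k : ℕ) (s : ℝ) : ℝ :=
  ∫ y in Icc (0 : ℝ) 1, thinned ζ φ k (s, y)

theorem thinned_nonneg (ζ : ℝ → State) (φ : ℕ → ℝ × ℝ → ℝ≥0) (k : ℕ) (z : ℝ × ℝ) :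
    0 ≤ thinned ζ φ k z :=
  indicator_nonneg (fun z _ => (φ k z).2) z

theorem intensity_nonneg (ζ : ℝ → State) (φ : ℕ → ℝ × ℝ → ℝ≥0) (k : ℕ) (s : ℝ) :
    0 ≤ intensity ζ φ k s :=
  integral_nonneg fun y => thinned_nonneg ζ φ k (s, y)

section Control

variable {p : DegSeq} {T : ℝ} {ζ : ℝ → State} {ψ : ℝ → ℝ} {φ : ℕ → ℝ × ℝ → ℝ≥0}

theorem IsControl.integrable_prod (h : IsControl p T ζ ψ φ) (k : ℕ) :
    Integrable (thinned ζ φ k)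
      ((volume.restrict (Icc 0 T)).prod (volume.restrict (Icc (0 : ℝ) 1))) := by
  rw [Measure.prod_restrict]
  exact h.integrable k

theorem IsControl.integrableOn_intensity (h : IsControl p T ζ ψ φ) (k : ℕ) :
    IntegrableOn (intensity ζ φ k) (Icc 0 T) :=
  (h.integrable_prod k).integral_prod_left

theorem IsControl.ae_integrableOn (h : IsControl p T ζ ψ φ) (k : ℕ) :
    ∀ᵐ s, s ∈ Icc 0 T → IntegrableOn (fun y => thinned ζ φ k (s, y)) (Icc 0 1) := by
  rw [← ae_restrict_iff' measurableSet_Icc]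
  exact (h.integrable_prod k).prod_right_ae

theorem IsControl.intervalIntegrable_intensity (h : IsControl p T ζ ψ φ) (k : ℕ) {a b : ℝ}
    (ha : a ∈ Icc 0 T) (hb : b ∈ Icc 0 T) : IntervalIntegrable (intensity ζ φ k) volume a b :=
  intervalIntegrable_iff.2 <| (h.integrableOn_intensity k).mono_set <|
    uIoc_subset_uIcc.trans (uIcc_subset_Icc ha hb)

theorem IsControl.setIntegral_thinned (h : IsControl p T ζ ψ φ) (k : ℕ) {t : ℝ}
    (ht : t ∈ Icc 0 T) :
    ∫ z in Icc 0 t ×ˢ Icc 0 1, thinned ζ φ k z = ∫ s in 0..t, intensity ζ φ k s := by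
  have hint : IntegrableOn (thinned ζ φ k) (Icc 0 t ×ˢ Icc 0 1) (volume.prod volume) :=
    (h.integrable k).mono_set (prod_mono_left (Icc_subset_Icc_right ht.2))
  rw [intervalIntegral.integral_of_le ht.1, ← integral_Icc_eq_integral_Ioc]
  exact setIntegral_prod _ hint

end Control

/-! ### Unreflected excursions -/

/-- A path from `(0, qbar)` to `(0, qbar - q)` on `[t₁, t₂]` driven without reflection by the
intensities `u`. -/
structure IsExcursion (qbar q : DegSeq) (t₁ t₂ : ℝ) (x : ℝ → State) (u : ℕ → ℝ → ℝ) : Prop where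
  le : t₁ ≤ t₂
  nonneg : ∀ k s, 0 ≤ u k s
  integrable : ∀ k, IntervalIntegrable (u k) volume t₁ t₂
  pnat_eq : ∀ k : ℕ+, ∀ t ∈ Icc t₁ t₂, x t k = qbar k - ∫ s in t₁..t, u k s
  zero_eq : ∀ t ∈ Icc t₁ t₂, HasSum (fun k : ℕ => ((k : ℝ) - 2) * ∫ s in t₁..t, u k s) (x t 0)
  zero_nonneg : ∀ t ∈ Icc t₁ t₂, 0 ≤ x t 0
  end_eq : x t₂ = state 0 (qbar - q)

/-- Without reflection the active mass is `ψ t - ψ t₁`, so after subtraction of the values at `t₁`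
the path depends on its past only through `qbar`. All of the lower bound uses only this reduced
description and the thinned controls. -/
theorem isExcursion_of_mem_J1 {p q qbar : DegSeq} {t₁ t₂ : ℝ} (h0 : 0 ≤ t₁) (h12 : t₁ ≤ t₂)
    {γ : (ℝ → State) × (ℝ → ℝ)}
    (hγ : γ ∈ J1 p t₁ t₂ (state 0 qbar) (state 0 (qbar - q))) {φ : ℕ → ℝ × ℝ → ℝ≥0}
    (hφ : IsControl p t₂ γ.1 γ.2 φ) :
    IsExcursion qbar q t₁ t₂ γ.1 (intensity γ.1 φ) := by
  obtain ⟨⟨hpath, h1, h2⟩, hge⟩ := hγ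
  have m1 : t₁ ∈ Icc 0 t₂ := ⟨h0, h12⟩
  have hadd : ∀ k, ∀ t ∈ Icc t₁ t₂, ∫ s in t₁..t, intensity γ.1 φ k s
      = (∫ s in 0..t, intensity γ.1 φ k s) - ∫ s in 0..t₁, intensity γ.1 φ k s := by
    intro k t ht
    have m0 : (0 : ℝ) ∈ Icc 0 t₂ := ⟨le_rfl, h0.trans h12⟩
    have mt : t ∈ Icc 0 t₂ := ⟨h0.trans ht.1, ht.2⟩
    rw [eq_comm, intervalIntegral.integral_interval_sub_left
      (hφ.intervalIntegrable_intensity k m0 mt) (hφ.intervalIntegrable_intensity k m0 m1)]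
  have hcont : ContinuousOn γ.2 (Icc 0 t₂) := by
    have := hpath.psi_ac.continuousOn
    rwa [uIcc_of_le (h0.trans h12)] at this
  have hsk : skorokhod γ.2 t₁ = 0 := by
    rw [← hpath.zeta_zero t₁ m1, h1, state_zero]
  have hge' : ∀ s ∈ Icc t₁ t₂, γ.2 t₁ ≤ γ.2 s := by
    -- The constraint is imposed on the open interval and extends to its closure by continuity; for
    -- `t₁ = t₂` that interval is empty and the claim is trivial.
    rcases h12.eq_or_lt with rfl | h12'
    · intro s hs
      rw [Icc_self] at hs
      rw [mem_singleton_iff.1 hs]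
    intro s hs
    have hcl : IsClosed {s ∈ Icc t₁ t₂ | γ.2 t₁ ≤ γ.2 s} :=
      isClosed_Icc.isClosed_le continuousOn_const
        (hcont.mono (Icc_subset_Icc_left h0))
    have hsub : Ioo t₁ t₂ ⊆ {s ∈ Icc t₁ t₂ | γ.2 t₁ ≤ γ.2 s} := fun s hs =>
      ⟨Ioo_subset_Icc_self hs, by simpa using hge s hs⟩
    have := closure_minimal hsub hcl
    rw [closure_Ioo h12'.ne] at this
    exact (this hs).2
  have hz : ∀ t ∈ Icc t₁ t₂, γ.1 t 0 = γ.2 t - γ.2 t₁ := fun t ht => by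
    rw [hpath.zeta_zero t ⟨h0.trans ht.1, ht.2⟩]
    refine skorokhod_eq_sub h0 ht.1 ?_ hsk fun s hs => hge' s ⟨hs.1, hs.2.trans ht.2⟩
    exact (isCompact_Icc.image_of_continuousOn
      (hcont.mono (Icc_subset_Icc_right ht.2))).bddBelow
  refine ⟨h12, intensity_nonneg _ _, fun k => hφ.intervalIntegrable_intensity k m1
    ⟨h0.trans h12, le_rfl⟩, fun k t ht => ?_, fun t ht => ?_, fun t ht => ?_, h2⟩
  · have mt : t ∈ Icc 0 t₂ := ⟨h0.trans ht.1, ht.2⟩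
    have e1 := hφ.zeta_eq k t mt
    have e2 := hφ.zeta_eq k t₁ m1
    rw [hφ.setIntegral_thinned k mt] at e1
    rw [hφ.setIntegral_thinned k m1, h1, state_pnat] at e2
    rw [hadd k t ht, e1, e2]
    ring
  · have mt : t ∈ Icc 0 t₂ := ⟨h0.trans ht.1, ht.2⟩
    have e := (hφ.psi_eq t mt).sub (hφ.psi_eq t₁ m1)
    rw [← hz t ht] at e
    refine e.congr_fun fun k => ?_
    rw [hφ.setIntegral_thinned k mt, hφ.setIntegral_thinned k m1, hadd k t ht]
    ring
  · rw [hz t ht]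
    linarith [hge' t ht]

/-- Total jump rate `∑_{k ≥ 0} u_k`. -/
def totalRate (u : ℕ → ℝ → ℝ) (s : ℝ) : ℝ := ∑' k, u k s

/-- Rate of discovery of half-edges `∑_{k ≥ 1} k u_k`. -/
def degreeRate (u : ℕ → ℝ → ℝ) (s : ℝ) : ℝ := ∑' k : ℕ, (k : ℝ) * u k s

/-- Half of the half-edge mass that remains to be explored at time `t`. -/
def residual (q : DegSeq) (t₁ : ℝ) (u : ℕ → ℝ → ℝ) (t : ℝ) : ℝ :=
  1 / 2 * degreeMass q - ∫ s in t₁..t, totalRate u s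

namespace IsExcursion

variable {p q qbar : DegSeq} {t₁ t₂ : ℝ} {x : ℝ → State} {u : ℕ → ℝ → ℝ}

theorem intervalIntegrable (h : IsExcursion qbar q t₁ t₂ x u) (k : ℕ) {a b : ℝ}
    (ha : a ∈ Icc t₁ t₂) (hb : b ∈ Icc t₁ t₂) : IntervalIntegrable (u k) volume a b :=
  (h.integrable k).mono_set (by rw [uIcc_of_le h.le]; exact uIcc_subset_Icc ha hb)

theorem integral_eq (h : IsExcursion qbar q t₁ t₂ x u) (k : ℕ+) :
    ∫ s in t₁..t₂, u k s = q k := by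
  have h1 := h.pnat_eq k t₂ ⟨h.le, le_rfl⟩
  rw [h.end_eq, state_pnat, Pi.sub_apply] at h1
  linarith

theorem le_left (h : IsExcursion qbar q t₁ t₂ x u) (k : ℕ+) {t : ℝ} (ht : t ∈ Icc t₁ t₂) :
    x t k ≤ qbar k := by
  rw [h.pnat_eq k t ht]
  linarith [intervalIntegral.integral_nonneg (μ := volume) ht.1 fun s _ => h.nonneg k s]

theorem right_le (h : IsExcursion qbar q t₁ t₂ x u) (k : ℕ+) {t : ℝ} (ht : t ∈ Icc t₁ t₂) :
    (qbar - q) k ≤ x t k := by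
  have hl : t₁ ∈ Icc t₁ t₂ := ⟨le_rfl, h.le⟩
  have hr : t₂ ∈ Icc t₁ t₂ := ⟨h.le, le_rfl⟩
  rw [h.pnat_eq k t ht, Pi.sub_apply, ← h.integral_eq k,
    ← intervalIntegral.integral_add_adjacent_intervals (h.intervalIntegrable k hl ht)
      (h.intervalIntegrable k ht hr)]
  linarith [intervalIntegral.integral_nonneg (μ := volume) ht.2 fun s _ => h.nonneg k s]

theorem summable_integral (h : IsExcursion qbar q t₁ t₂ x u) (hp : IsDegreeLaw p) (h0 : 0 ≤ q)
    (hq : q ≤ p) : Summable fun k : ℕ => ∫ s in t₁..t₂, ‖u k s‖ := by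
  rw [summable_nat_iff_pnat]
  refine (hp.summable_of_le h0 hq).congr fun k => ?_
  simp_rw [Real.norm_of_nonneg (h.nonneg _ _)]
  exact (h.integral_eq k).symm

theorem summable_integral_mul (h : IsExcursion qbar q t₁ t₂ x u) (hp : IsDegreeLaw p)
    (h0 : 0 ≤ q) (hq : q ≤ p) : Summable fun k : ℕ => ∫ s in t₁..t₂, ‖(k : ℝ) * u k s‖ := by
  rw [summable_nat_iff_pnat]
  refine (hp.summable_mul_of_le h0 hq).congr fun k => ?_
  simp_rw [Real.norm_of_nonneg (mul_nonneg (Nat.cast_nonneg _) (h.nonneg _ _))]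
  rw [intervalIntegral.integral_const_mul, h.integral_eq k]

theorem totalRate_nonneg (h : IsExcursion qbar q t₁ t₂ x u) (s : ℝ) : 0 ≤ totalRate u s :=
  tsum_nonneg fun k => h.nonneg k s

theorem integrable_totalRate (h : IsExcursion qbar q t₁ t₂ x u) (hp : IsDegreeLaw p)
    (h0 : 0 ≤ q) (hq : q ≤ p) : IntervalIntegrable (totalRate u) volume t₁ t₂ :=
  (intervalIntegral_tsum h.le h.integrable (h.summable_integral hp h0 hq)).1

theorem integrable_degreeRate (h : IsExcursion qbar q t₁ t₂ x u) (hp : IsDegreeLaw p)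
    (h0 : 0 ≤ q) (hq : q ≤ p) : IntervalIntegrable (degreeRate u) volume t₁ t₂ :=
  (intervalIntegral_tsum h.le (fun k => (h.integrable k).const_mul _)
    (h.summable_integral_mul hp h0 hq)).1

theorem ae_hasSum_totalRate (h : IsExcursion qbar q t₁ t₂ x u) (hp : IsDegreeLaw p)
    (h0 : 0 ≤ q) (hq : q ≤ p) :
    ∀ᵐ s, s ∈ Ioc t₁ t₂ → HasSum (fun k => u k s) (totalRate u s) := by
  filter_upwards [(intervalIntegral_tsum h.le h.integrable
    (h.summable_integral hp h0 hq)).2.1] with s hs hs'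
  exact (hs hs').hasSum

theorem ae_hasSum_degreeRate (h : IsExcursion qbar q t₁ t₂ x u) (hp : IsDegreeLaw p)
    (h0 : 0 ≤ q) (hq : q ≤ p) :
    ∀ᵐ s, s ∈ Ioc t₁ t₂ → HasSum (fun k : ℕ => (k : ℝ) * u k s) (degreeRate u s) := by
  filter_upwards [(intervalIntegral_tsum h.le (fun k => (h.integrable k).const_mul _)
    (h.summable_integral_mul hp h0 hq)).2.1] with s hs hs'
  exact (hs hs').hasSum

/-- Twice the total number of jumps is added to `∑ (k - 2)∫u_k`. The jumps of coordinate `0`, which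
carry weight `-2`, cancel. -/
theorem hasSum_mul (h : IsExcursion qbar q t₁ t₂ x u) (hp : IsDegreeLaw p)
    (h0 : 0 ≤ q) (hq : q ≤ p) {t : ℝ} (ht : t ∈ Icc t₁ t₂) :
    HasSum (fun k : ℕ+ => (k : ℝ) * ∫ s in t₁..t, u k s)
      (x t 0 + 2 * ∫ s in t₁..t, totalRate u s) := by
  have h1 := hasSum_nat_iff_pnat.1 (h.zero_eq t ht)
  have h2 := hasSum_nat_iff_pnat.1 ((intervalIntegral_tsum h.le h.integrable
    (h.summable_integral hp h0 hq)).2.2 t ht)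
  have h3 := h1.add (h2.mul_left 2)
  have e : x t 0 - ((0 : ℕ) - 2) * (∫ s in t₁..t, u 0 s)
      + 2 * ((∫ s in t₁..t, ∑' i, u i s) - ∫ s in t₁..t, u 0 s)
      = x t 0 + 2 * ∫ s in t₁..t, totalRate u s := by
    simp only [totalRate]; push_cast; ring
  rw [e] at h3
  refine h3.congr_fun fun k => ?_
  ring

theorem zero_eq_integral (h : IsExcursion qbar q t₁ t₂ x u) (hp : IsDegreeLaw p)
    (h0 : 0 ≤ q) (hq : q ≤ p) {t : ℝ} (ht : t ∈ Icc t₁ t₂) :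
    x t 0 = ∫ s in t₁..t, (degreeRate u s - 2 * totalRate u s) := by
  have h1 := hasSum_nat_iff_pnat.1 ((intervalIntegral_tsum h.le
    (fun k => (h.integrable k).const_mul _) (h.summable_integral_mul hp h0 hq)).2.2 t ht)
  simp only [intervalIntegral.integral_const_mul] at h1
  have h2 := h1.unique (h.hasSum_mul hp h0 hq ht)
  have hsub : uIcc t₁ t ⊆ uIcc t₁ t₂ := by
    rw [uIcc_of_le ht.1, uIcc_of_le h.le]; exact Icc_subset_Icc_right ht.2
  rw [intervalIntegral.integral_sub ((h.integrable_degreeRate hp h0 hq).mono_set hsub)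
    (((h.integrable_totalRate hp h0 hq).mono_set hsub).const_mul 2),
    intervalIntegral.integral_const_mul]
  simp only [Nat.cast_zero, zero_mul, sub_zero] at h2
  simp only [degreeRate]
  linarith

theorem hasSum_residual (h : IsExcursion qbar q t₁ t₂ x u) (hp : IsDegreeLaw p)
    (h0 : 0 ≤ q) (hq : q ≤ p) {t : ℝ} (ht : t ∈ Icc t₁ t₂) :
    HasSum (fun k : ℕ+ => (k : ℝ) * (x t k - (qbar - q) k)) (2 * residual q t₁ u t - x t 0) := by
  have h1 := (hp.summable_mul_of_le h0 hq).hasSum.sub (h.hasSum_mul hp h0 hq ht)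
  have e : ∑' k : ℕ+, (k : ℝ) * q k - (x t 0 + 2 * ∫ s in t₁..t, totalRate u s)
      = 2 * residual q t₁ u t - x t 0 := by
    simp only [residual, degreeMass]; ring
  rw [e] at h1
  refine h1.congr_fun fun k => ?_
  rw [h.pnat_eq k t ht, Pi.sub_apply]
  ring

theorem residual_left : residual q t₁ u t₁ = 1 / 2 * degreeMass q := by simp [residual]

/-- In the terminal state `x_k = (qbar - q)_k` and `x_0 = 0`, so the conservation law
`hasSum_residual` leaves nothing. The number of jumps is thus fixed by the endpoints, whatever the
duration. -/
theorem residual_right (h : IsExcursion qbar q t₁ t₂ x u) (hp : IsDegreeLaw p)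
    (h0 : 0 ≤ q) (hq : q ≤ p) : residual q t₁ u t₂ = 0 := by
  have h1 := h.hasSum_residual hp h0 hq ⟨h.le, le_rfl⟩
  rw [h.end_eq] at h1
  simp only [state_pnat, sub_self, mul_zero, state_zero, sub_zero] at h1
  linarith [h1.unique hasSum_zero]

theorem residual_antitoneOn (h : IsExcursion qbar q t₁ t₂ x u) (hp : IsDegreeLaw p)
    (h0 : 0 ≤ q) (hq : q ≤ p) : AntitoneOn (residual q t₁ u) (Icc t₁ t₂) := by
  intro a ha b hb hab
  have hI := h.integrable_totalRate hp h0 hq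
  have hsub : ∀ {c d}, c ∈ Icc t₁ t₂ → d ∈ Icc t₁ t₂ → uIcc c d ⊆ uIcc t₁ t₂ := fun hc hd => by
    rw [uIcc_of_le h.le]; exact uIcc_subset_Icc hc hd
  have hl : t₁ ∈ Icc t₁ t₂ := ⟨le_rfl, h.le⟩
  unfold residual
  rw [← intervalIntegral.integral_add_adjacent_intervals (hI.mono_set (hsub hl ha))
    (hI.mono_set (hsub ha hb))]
  linarith [intervalIntegral.integral_nonneg (μ := volume) hab fun s _ => h.totalRate_nonneg s]

theorem residual_nonneg (h : IsExcursion qbar q t₁ t₂ x u) (hp : IsDegreeLaw p)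
    (h0 : 0 ≤ q) (hq : q ≤ p) {t : ℝ} (ht : t ∈ Icc t₁ t₂) : 0 ≤ residual q t₁ u t := by
  rw [← h.residual_right hp h0 hq]
  exact h.residual_antitoneOn hp h0 hq ht ⟨h.le, le_rfl⟩ ht.2

theorem residual_le (h : IsExcursion qbar q t₁ t₂ x u) (hp : IsDegreeLaw p)
    (h0 : 0 ≤ q) (hq : q ≤ p) {t : ℝ} (ht : t ∈ Icc t₁ t₂) :
    residual q t₁ u t ≤ 1 / 2 * degreeMass q := by
  rw [← residual_left (u := u) (t₁ := t₁)]
  exact h.residual_antitoneOn hp h0 hq ⟨le_rfl, h.le⟩ ht ht.1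

theorem residual_ac (h : IsExcursion qbar q t₁ t₂ x u) (hp : IsDegreeLaw p)
    (h0 : 0 ≤ q) (hq : q ≤ p) : AbsolutelyContinuousOnInterval (residual q t₁ u) t₁ t₂ := by
  have h1 := (h.integrable_totalRate hp h0 hq).absolutelyContinuousOnInterval_intervalIntegral
    (c := t₁) left_mem_uIcc
  have h2 : AbsolutelyContinuousOnInterval (fun _ : ℝ => 1 / 2 * degreeMass q) t₁ t₂ :=
    (LipschitzWith.const _).lipschitzOnWith.absolutelyContinuousOnInterval
  exact h2.sub h1

/-- The half-edge mass of the state is `2 (residual + ½ ∑ k (qbar - q)_k)`. -/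
theorem hasSum_mass (h : IsExcursion qbar q t₁ t₂ x u) (hp : IsDegreeLaw p)
    (h0 : 0 ≤ q) (hqb : q ≤ qbar) (hb : qbar ≤ p) {t : ℝ} (ht : t ∈ Icc t₁ t₂) :
    HasSum (mass (x t)) (2 * (residual q t₁ u t + 1 / 2 * degreeMass (qbar - q))) := by
  have h1 := h.hasSum_residual hp h0 (hqb.trans hb) ht
  have hρ : Summable fun k : ℕ+ => (k : ℝ) * (qbar - q) k :=
    hp.summable_mul_of_le (sub_nonneg.2 hqb) ((sub_le_self _ h0).trans hb)
  have h2 := h1.add hρ.hasSum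
  have h3 : HasSum (fun k : ℕ+ => (k : ℝ) * x t k)
      (2 * residual q t₁ u t - x t 0 + degreeMass (qbar - q)) := by
    refine h2.congr_fun fun k => ?_
    ring
  have h4 := ConfigModel.hasSum_mass h3
  rw [max_eq_left (h.zero_nonneg t ht)] at h4
  convert h4 using 1
  ring

end IsExcursion

/-! ### Cost as a time integral, and slopes of the profile -/

theorem controlCost_eq {t₁ t₂ : ℝ} {φ : ℕ → ℝ × ℝ → ℝ≥0} (hφ : ∀ k, Measurable (φ k)) :
    controlCost t₁ t₂ φ =
      ∫⁻ s in Icc t₁ t₂, ∑' k, ∫⁻ y in Icc (0 : ℝ) 1, ENNReal.ofReal (ell (φ k (s, y))) := by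
  have hm : ∀ k, Measurable fun z => ENNReal.ofReal (ell (φ k z)) := fun k =>
    (measurable_ell.comp (hφ k).coe_nnreal_real).ennreal_ofReal
  rw [lintegral_tsum fun k => (Measurable.lintegral_prod_right (hm k)).aemeasurable]
  unfold controlCost
  congr 1
  funext k
  rw [Measure.volume_eq_prod, ← Measure.prod_restrict]
  exact lintegral_prod _ (hm k).aemeasurable

/-- The profile `a_k + c_k gap C m k`, with `c_k = coef C m₀ q k`. -/
def profile (a : DegSeq) (C m₀ : ℝ) (q : DegSeq) (k : ℕ+) (m : ℝ) : ℝ :=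
  a k + coef C m₀ q k * gap C m k

/-- The derivative of `profile` in `m`. -/
def slopeAt (C m₀ : ℝ) (q : DegSeq) (k : ℕ+) (m : ℝ) : ℝ :=
  coef C m₀ q k * ((k : ℝ) * √(m + C) ^ (k : ℕ) / (2 * (m + C)))

theorem hasDerivAt_profile (a : DegSeq) {C m : ℝ} (m₀ : ℝ) (q : DegSeq) (k : ℕ+)
    (h : 0 < m + C) : HasDerivAt (profile a C m₀ q k) (slopeAt C m₀ q k m) m :=
  ((hasDerivAt_gap h k).const_mul _).const_add _

theorem slopeAt_nonneg {C m₀ m : ℝ} (hm : 0 ≤ m₀) (h : 0 ≤ m + C) {q : DegSeq} (hq : 0 ≤ q)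
    (k : ℕ+) : 0 ≤ slopeAt C m₀ q k m :=
  mul_nonneg (coef_nonneg hm hq k) (by positivity)

/-- The power at `m` is at most the power at `m₀`, which `coef_mul_pow_le` controls by `q k`. The
derivative brings the factor `k`, still summable by the first moment. -/
theorem slopeAt_le {C m₀ m : ℝ} (hC : 0 ≤ C) (hm : 0 < m₀) {q : DegSeq} (hq : 0 ≤ q)
    (h0 : 0 < m + C) (h : m ≤ m₀) (k : ℕ+) :
    slopeAt C m₀ q k m ≤ 1 / ((1 - √C / √(m₀ + C)) * (2 * (m + C))) * (k * q k) := by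
  have h1 := coef_mul_pow_le hC hm hq k
  have h2 : √(m + C) ^ (k : ℕ) ≤ √(m₀ + C) ^ (k : ℕ) := by gcongr
  have h3 : coef C m₀ q k * √(m + C) ^ (k : ℕ) ≤ q k / (1 - √C / √(m₀ + C)) :=
    (mul_le_mul_of_nonneg_left h2 (coef_nonneg hm.le hq k)).trans h1
  have h4 : 0 < 1 - √C / √(m₀ + C) := by linarith [sqrt_ratio_lt_one hC hm]
  calc slopeAt C m₀ q k m
      = (coef C m₀ q k * √(m + C) ^ (k : ℕ)) * ((k : ℝ) / (2 * (m + C))) := by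
        unfold slopeAt; ring
    _ ≤ q k / (1 - √C / √(m₀ + C)) * ((k : ℝ) / (2 * (m + C))) :=
        mul_le_mul_of_nonneg_right h3 (by positivity)
    _ = _ := by field_simp

theorem slopeAt_le_of_le {C m₀ m δ : ℝ} (hC : 0 ≤ C) (hm : 0 < m₀) {q : DegSeq} (hq : 0 ≤ q)
    (hδ : 0 < δ) (h0 : δ ≤ m + C) (h : m ≤ m₀) (k : ℕ+) :
    slopeAt C m₀ q k m ≤ 1 / ((1 - √C / √(m₀ + C)) * (2 * δ)) * (k * q k) := by
  have h4 : 0 < 1 - √C / √(m₀ + C) := by linarith [sqrt_ratio_lt_one hC hm]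
  refine (slopeAt_le hC hm hq (hδ.trans_le h0) h k).trans ?_
  refine mul_le_mul_of_nonneg_right ?_ (mul_nonneg (by positivity) (hq k))
  gcongr

theorem coef_eq_zero {C m₀ : ℝ} {q : DegSeq} {k : ℕ+} (h : q k = 0) : coef C m₀ q k = 0 := by
  simp [coef, h]

/-! ### The calibrating potential -/

namespace IsExcursion

variable {p q qbar : DegSeq} {t₁ t₂ : ℝ} {x : ℝ → State} {u : ℕ → ℝ → ℝ}

/-- The part of the calibrating potential carried by degree `k`. -/
def potential (q qbar : DegSeq) (t₁ : ℝ) (x : ℝ → State) (u : ℕ → ℝ → ℝ) (C ε : ℝ) (k : ℕ+)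
    (t : ℝ) : ℝ :=
  x t k * Real.log (profile (qbar - q + ε • q) C (1 / 2 * degreeMass q) q k (residual q t₁ u t))
    - (x t k - (qbar - q) k) * Real.log (coef C (1 / 2 * degreeMass q) q k)

/-- The almost everywhere derivative of `potential`. -/
def potentialRate (q qbar : DegSeq) (t₁ : ℝ) (x : ℝ → State) (u : ℕ → ℝ → ℝ) (C ε : ℝ) (k : ℕ+)
    (s : ℝ) : ℝ :=
  u k s * (Real.log (coef C (1 / 2 * degreeMass q) q k)
      - Real.log (profile (qbar - q + ε • q) C (1 / 2 * degreeMass q) q k (residual q t₁ u s)))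
    - totalRate u s * (x s k * (slopeAt C (1 / 2 * degreeMass q) q k (residual q t₁ u s)
      / profile (qbar - q + ε • q) C (1 / 2 * degreeMass q) q k (residual q t₁ u s)))

theorem coord_ac (h : IsExcursion qbar q t₁ t₂ x u) (k : ℕ+) :
    AbsolutelyContinuousOnInterval (fun t => x t k) t₁ t₂ := by
  have h1 := (h.integrable k).absolutelyContinuousOnInterval_intervalIntegral
    (c := t₁) left_mem_uIcc
  have h2 : AbsolutelyContinuousOnInterval (fun _ : ℝ => qbar k) t₁ t₂ :=
    (LipschitzWith.const _).lipschitzOnWith.absolutelyContinuousOnInterval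
  rw [absolutelyContinuousOnInterval_iff]
  have h3 := (absolutelyContinuousOnInterval_iff _ _ _).1 (h2.sub h1)
  intro ε hε
  obtain ⟨δ, hδ, H⟩ := h3 ε hε
  refine ⟨δ, hδ, fun E hE hE' => ?_⟩
  have := H E hE hE'
  refine lt_of_eq_of_lt (Finset.sum_congr rfl fun i hi => ?_) this
  have hi' := hE.1 i hi
  rw [uIcc_of_le h.le] at hi'
  simp only [Pi.sub_apply]
  rw [h.pnat_eq k _ hi'.1, h.pnat_eq k _ hi'.2]

theorem ae_hasDerivAt_coord (h : IsExcursion qbar q t₁ t₂ x u) (k : ℕ+) :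
    ∀ᵐ s, s ∈ Ioo t₁ t₂ → HasDerivAt (fun t => x t k) (-u k s) s := by
  filter_upwards [(h.integrable k).ae_hasDerivAt_integral] with s hs hs'
  rw [uIcc_of_le h.le] at hs
  have h1 := (hs (Ioo_subset_Icc_self hs') t₁ ⟨le_rfl, h.le⟩).const_sub (qbar k)
  refine h1.congr_of_eventuallyEq ?_
  filter_upwards [Ioo_mem_nhds hs'.1 hs'.2] with t ht
  exact h.pnat_eq k t (Ioo_subset_Icc_self ht)

theorem ae_hasDerivAt_residual (h : IsExcursion qbar q t₁ t₂ x u) (hp : IsDegreeLaw p)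
    (h0 : 0 ≤ q) (hq : q ≤ p) :
    ∀ᵐ s, s ∈ Ioo t₁ t₂ → HasDerivAt (residual q t₁ u) (-totalRate u s) s := by
  filter_upwards [(h.integrable_totalRate hp h0 hq).ae_hasDerivAt_integral] with s hs hs'
  rw [uIcc_of_le h.le] at hs
  exact (hs (Ioo_subset_Icc_self hs') t₁ ⟨le_rfl, h.le⟩).const_sub _

theorem ae_hasDerivAt_zero (h : IsExcursion qbar q t₁ t₂ x u) (hp : IsDegreeLaw p)
    (h0 : 0 ≤ q) (hq : q ≤ p) :
    ∀ᵐ s, s ∈ Ioo t₁ t₂ →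
      HasDerivAt (fun t => x t 0) (degreeRate u s - 2 * totalRate u s) s := by
  have hI := (h.integrable_degreeRate hp h0 hq).sub ((h.integrable_totalRate hp h0 hq).const_mul 2)
  filter_upwards [hI.ae_hasDerivAt_integral] with s hs hs'
  rw [uIcc_of_le h.le] at hs
  refine (hs (Ioo_subset_Icc_self hs') t₁ ⟨le_rfl, h.le⟩).congr_of_eventuallyEq ?_
  filter_upwards [Ioo_mem_nhds hs'.1 hs'.2] with t ht
  exact h.zero_eq_integral hp h0 hq (Ioo_subset_Icc_self ht)

theorem zero_ac (h : IsExcursion qbar q t₁ t₂ x u) (hp : IsDegreeLaw p)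
    (h0 : 0 ≤ q) (hq : q ≤ p) : AbsolutelyContinuousOnInterval (fun t => x t 0) t₁ t₂ := by
  have hI := (h.integrable_degreeRate hp h0 hq).sub ((h.integrable_totalRate hp h0 hq).const_mul 2)
  have h3 := (absolutelyContinuousOnInterval_iff _ _ _).1
    (hI.absolutelyContinuousOnInterval_intervalIntegral (c := t₁) left_mem_uIcc)
  rw [absolutelyContinuousOnInterval_iff]
  intro ε hε
  obtain ⟨δ, hδ, H⟩ := h3 ε hε
  refine ⟨δ, hδ, fun E hE hE' => ?_⟩
  have := H E hE hE'
  refine lt_of_eq_of_lt (Finset.sum_congr rfl fun i hi => ?_) this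
  have hi' := hE.1 i hi
  rw [uIcc_of_le h.le] at hi'
  rw [h.zero_eq_integral hp h0 hq hi'.1, h.zero_eq_integral hp h0 hq hi'.2]

theorem profile_ge {C ε : ℝ} (h0 : 0 ≤ q) (hqb : q ≤ qbar)
    {m₀ m : ℝ} (hm₀ : 0 < m₀) (hm : 0 ≤ m) (k : ℕ+) :
    ε * q k ≤ profile (qbar - q + ε • q) C m₀ q k m := by
  have h1 : 0 ≤ coef C m₀ q k * gap C m k :=
    mul_nonneg (coef_nonneg hm₀.le h0 k) (gap_nonneg hm _)
  have h2 : q k ≤ qbar k := hqb k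
  simp only [profile, Pi.add_apply, Pi.sub_apply, Pi.smul_apply, smul_eq_mul]
  linarith

theorem profile_le {C ε : ℝ} (hC : 0 ≤ C) (h0 : 0 ≤ q)
    {m₀ m : ℝ} (hm₀ : 0 < m₀) (hm : m ≤ m₀) (k : ℕ+) :
    profile (qbar - q + ε • q) C m₀ q k m ≤ qbar k + ε * q k := by
  have h1 := coef_mul_gap_le hC hm₀ h0 hm k
  simp only [profile, Pi.add_apply, Pi.sub_apply, Pi.smul_apply, smul_eq_mul]
  linarith

/-- A chain rule for an absolutely continuous competitor. The two regularizations enter here: `C >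
0` makes `gap` continuously differentiable up to `m = 0`, and `ε > 0` keeps the profile above `ε * q
k`, so its logarithm is Lipschitz in `m`. If `q k = 0` the profile is constant. -/
theorem potential_integral (h : IsExcursion qbar q t₁ t₂ x u) (hp : IsDegreeLaw p)
    (h0 : 0 ≤ q) (hqb : q ≤ qbar) (hb : qbar ≤ p) (hm₀ : 0 < 1 / 2 * degreeMass q) {C ε : ℝ}
    (hC : 0 < C) (hε : 0 < ε) (k : ℕ+) {T : ℝ} (hT : T ∈ Icc t₁ t₂) :
    IntervalIntegrable (potentialRate q qbar t₁ x u C ε k) volume t₁ T ∧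
      ∫ s in t₁..T, potentialRate q qbar t₁ x u C ε k s
        = potential q qbar t₁ x u C ε k T - potential q qbar t₁ x u C ε k t₁ := by
  have hq := hqb.trans hb
  have hsub : uIcc t₁ T ⊆ uIcc t₁ t₂ := by
    rw [uIcc_of_le hT.1, uIcc_of_le h.le]; exact Icc_subset_Icc_right hT.2
  have hconst : ∀ c : ℝ, AbsolutelyContinuousOnInterval (fun _ : ℝ => c) t₁ t₂ := fun c =>
    (LipschitzWith.const _).lipschitzOnWith.absolutelyContinuousOnInterval
  have hmaps : MapsTo (residual q t₁ u) (uIcc t₁ t₂) (Icc 0 (1 / 2 * degreeMass q)) := by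
    intro t ht
    rw [uIcc_of_le h.le] at ht
    exact ⟨h.residual_nonneg hp h0 hq ht, h.residual_le hp h0 hq ht⟩
  set m₀ := 1 / 2 * degreeMass q with hm₀_def
  set σ := profile (qbar - q + ε • q) C m₀ q k with hσ
  have hlog : AbsolutelyContinuousOnInterval
      (fun t => Real.log (σ (residual q t₁ u t))) t₁ t₂ := by
    rcases (h0 k).eq_or_lt with hk | hk
    · simp only [hσ, profile, coef_eq_zero hk.symm, zero_mul]
      exact hconst _
    · refine (h.residual_ac hp h0 hq).contDiffOn_comp (g := fun m => Real.log (σ m)) ?_ hmaps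
      refine ContDiffOn.log ?_ fun m hm => ?_
      · exact contDiffOn_const.add (contDiffOn_const.mul (contDiffOn_gap hC _ _))
      · exact ((mul_pos hε hk).trans_le (profile_ge h0 hqb hm₀ hm.1 k)).ne'
  have hac : AbsolutelyContinuousOnInterval (potential q qbar t₁ x u C ε k) t₁ t₂ := by
    exact ((h.coord_ac k).mul hlog).sub (((h.coord_ac k).sub (hconst _)).mul (hconst _))
  refine (hac.mono hsub).intervalIntegral_eq_sub ?_
  have hne : ∀ᵐ s : ℝ, s ≠ t₁ ∧ s ≠ t₂ := by
    filter_upwards [Measure.ae_ne volume t₁, Measure.ae_ne volume t₂] with s a b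
    exact ⟨a, b⟩
  filter_upwards [h.ae_hasDerivAt_coord k, h.ae_hasDerivAt_residual hp h0 hq, hne]
    with s h1 h2 h3 hs
  have hs2 := hsub hs
  have hms := hmaps hs2
  rw [uIcc_of_le h.le] at hs2
  have hs' : s ∈ Ioo t₁ t₂ := ⟨lt_of_le_of_ne hs2.1 h3.1.symm, lt_of_le_of_ne hs2.2 h3.2⟩
  have d1 := h1 hs'
  have d2 := h2 hs'
  have dl : HasDerivAt (fun t => Real.log (σ (residual q t₁ u t)))
      (-totalRate u s * (slopeAt C m₀ q k (residual q t₁ u s) / σ (residual q t₁ u s))) s := by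
    rcases (h0 k).eq_or_lt with hk | hk
    · simp only [hσ, profile, slopeAt, coef_eq_zero hk.symm, zero_mul, zero_div, mul_zero]
      exact hasDerivAt_const _ _
    · have hpos : 0 < σ (residual q t₁ u s) :=
        (mul_pos hε hk).trans_le (profile_ge h0 hqb hm₀ hms.1 k)
      have d3 := (hasDerivAt_profile (qbar - q + ε • q) m₀ q k
        (by linarith [hms.1] : 0 < residual q t₁ u s + C)).comp s d2
      refine (d3.log hpos.ne').congr_deriv ?_
      simp only [Function.comp, hσ]
      ring
  have d4 := (d1.mul dl).sub ((d1.sub_const ((qbar - q) k)).mul_const (Real.log (coef C m₀ q k)))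
  refine d4.congr_deriv ?_
  simp only [potentialRate, ← hm₀_def, ← hσ]
  ring

end IsExcursion

theorem abs_log_le_of_mem_Icc {a b x : ℝ} (ha : 0 < a) (hb : 1 ≤ b) (h1 : a ≤ x) (h2 : x ≤ b) :
    |Real.log x| ≤ |Real.log a| + Real.log b := by
  have h3 := Real.log_le_log ha h1
  have h4 := Real.log_le_log (ha.trans_le h1) h2
  have h5 := Real.log_nonneg hb
  rw [abs_le]
  constructor
  · linarith [neg_abs_le (Real.log a)]
  · linarith [abs_nonneg (Real.log a)]

namespace IsExcursion

variable {p q qbar : DegSeq} {t₁ t₂ : ℝ} {x : ℝ → State} {u : ℕ → ℝ → ℝ}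

/-- For `q k > 0` the profile lies between `ε * q k` and `2`, uniformly in `m`, and `q k * |log (q
k)|` is summable. This dominates the part of the potential's derivative that is proportional to
`u_k`. -/
theorem exists_log_bound (hp : IsDegreeLaw p) (h0 : 0 ≤ q) (hqb : q ≤ qbar) (hb : qbar ≤ p)
    (hm₀ : 0 < 1 / 2 * degreeMass q) {C ε : ℝ} (hC : 0 < C) (hε : 0 < ε) (hε1 : ε ≤ 1) :
    ∃ l : ℕ+ → ℝ, Summable (fun k => l k * q k) ∧
      ∀ k, ∀ m ∈ Icc 0 (1 / 2 * degreeMass q),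
        |Real.log (coef C (1 / 2 * degreeMass q) q k)
          - Real.log (profile (qbar - q + ε • q) C (1 / 2 * degreeMass q) q k m)| ≤ l k := by
  set m₀ := 1 / 2 * degreeMass q
  have hq := hqb.trans hb
  -- The last summand covers `q k = 0`, where the profile is the constant `qbar k` while `log (ε * q
  -- k)` takes the default value `0`. It disappears from the sum, being multiplied by `q k`.
  refine ⟨fun k => |Real.log (coef C m₀ q k)| + (|Real.log (ε * q k)| + Real.log 2
    + if q k = 0 then |Real.log (qbar k)| else 0), ?_, fun k m hm => ?_⟩
  · refine Summable.of_nonneg_of_le (fun k => mul_nonneg ?_ (h0 k)) (fun k => ?_)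
      ((hp.summable_mul_abs_log_coef h0 hq hC.le hm₀).add
        (((hp.summable_of_le h0 hq).mul_left (|Real.log ε| + Real.log 2)).add
          (hp.summable_abs_mul_log h0 hq)))
    · have : 0 ≤ Real.log 2 := Real.log_nonneg (by norm_num)
      dsimp only
      split_ifs <;> positivity
    · rcases (h0 k).eq_or_lt with hk | hk
      · simp only [Pi.zero_apply] at hk
        simp [← hk]
      · simp only [Pi.zero_apply] at hk
        have h1 : |Real.log (ε * q k)| ≤ |Real.log ε| + |Real.log (q k)| := by
          rw [Real.log_mul hε.ne' hk.ne']; exact abs_add_le _ _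
        simp only [if_neg hk.ne', abs_mul, abs_of_pos hk]
        nlinarith
  · refine (abs_sub _ _).trans (add_le_add le_rfl ?_)
    rcases (h0 k).eq_or_lt with hk | hk
    · simp only [Pi.zero_apply] at hk
      have : 0 ≤ Real.log 2 := Real.log_nonneg (by norm_num)
      simp only [profile, coef_eq_zero hk.symm, Pi.add_apply, Pi.sub_apply, Pi.smul_apply, ← hk]
      simp [this]
    · simp only [Pi.zero_apply] at hk
      rw [if_neg hk.ne', add_zero]
      refine abs_log_le_of_mem_Icc (mul_pos hε hk) one_le_two (profile_ge h0 hqb hm₀ hm.1 k)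
        ((profile_le hC.le h0 hm₀ hm.2 k).trans ?_)
      have h1 : qbar k ≤ 1 := (hb k).trans (hp.le_one k)
      have h2 : q k ≤ qbar k := hqb k
      nlinarith

/-- The slope is at most a constant times `k * q k` and the profile is at least `ε * q k`. The
factor `q k` cancels, leaving a multiple of `k`, and `x s k ≤ p k` makes the product summable. -/
theorem slope_div_le (h : IsExcursion qbar q t₁ t₂ x u) (hp : IsDegreeLaw p)
    (h0 : 0 ≤ q) (hqb : q ≤ qbar) (hb : qbar ≤ p) (hm₀ : 0 < 1 / 2 * degreeMass q) {C ε : ℝ}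
    (hC : 0 < C) (hε : 0 < ε) (k : ℕ+) {s : ℝ} (hs : s ∈ Icc t₁ t₂) :
    0 ≤ x s k * (slopeAt C (1 / 2 * degreeMass q) q k (residual q t₁ u s)
      / profile (qbar - q + ε • q) C (1 / 2 * degreeMass q) q k (residual q t₁ u s)) ∧
    x s k * (slopeAt C (1 / 2 * degreeMass q) q k (residual q t₁ u s)
      / profile (qbar - q + ε • q) C (1 / 2 * degreeMass q) q k (residual q t₁ u s))
      ≤ 1 / ((1 - √C / √(1 / 2 * degreeMass q + C)) * (2 * C)) / ε * (k * p k) := by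
  have hq := hqb.trans hb
  have hr0 := h.residual_nonneg hp h0 hq hs
  have hr1 := h.residual_le hp h0 hq hs
  set m₀ := 1 / 2 * degreeMass q
  set m := residual q t₁ u s
  have h4 : 0 < 1 - √C / √(m₀ + C) := by linarith [sqrt_ratio_lt_one hC.le hm₀]
  have hx1 : x s k ≤ p k := (h.le_left k hs).trans (hb k)
  have hx0 : 0 ≤ x s k := le_trans (sub_nonneg.2 (hqb k)) (h.right_le k hs)
  have hp0 : 0 ≤ p k := hp.nonneg k
  rcases (h0 k).eq_or_lt with hk | hk
  · simp only [slopeAt, coef_eq_zero hk.symm, zero_mul, zero_div, mul_zero, le_refl, true_and]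
    positivity
  · simp only [Pi.zero_apply] at hk
    have h1 := slopeAt_le_of_le hC.le hm₀ h0 hC (by linarith : C ≤ m + C) hr1 k
    have h2 := profile_ge (C := C) (ε := ε) h0 hqb hm₀ hr0 k
    have h3 := slopeAt_nonneg (m := m) (C := C) hm₀.le (by linarith) h0 k
    have h5 : 0 < ε * q k := mul_pos hε hk
    refine ⟨mul_nonneg hx0 (div_nonneg h3 (h5.le.trans h2)), ?_⟩
    have h6 : slopeAt C m₀ q k m / profile (qbar - q + ε • q) C m₀ q k m
        ≤ 1 / ((1 - √C / √(m₀ + C)) * (2 * C)) * (k * q k) / (ε * q k) := by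
      gcongr
    have h7 : 1 / ((1 - √C / √(m₀ + C)) * (2 * C)) * (k * q k) / (ε * q k)
        = 1 / ((1 - √C / √(m₀ + C)) * (2 * C)) / ε * k := by
      field_simp
    rw [h7] at h6
    calc _ ≤ p k * (1 / ((1 - √C / √(m₀ + C)) * (2 * C)) / ε * k) := by
          gcongr
          exact div_nonneg h3 (h5.le.trans h2)
      _ = _ := by ring

/-- Both dominating terms integrate explicitly, the first because `∫ u_k = q k`. This justifies
interchanging sum and time integral. -/
theorem summable_potentialRate (h : IsExcursion qbar q t₁ t₂ x u) (hp : IsDegreeLaw p)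
    (h0 : 0 ≤ q) (hqb : q ≤ qbar) (hb : qbar ≤ p) (hm₀ : 0 < 1 / 2 * degreeMass q) {C ε : ℝ}
    (hC : 0 < C) (hε : 0 < ε) (hε1 : ε ≤ 1) :
    Summable fun k : ℕ+ => ∫ s in t₁..t₂, ‖potentialRate q qbar t₁ x u C ε k s‖ := by
  have hq := hqb.trans hb
  obtain ⟨l, hl, hl'⟩ := exists_log_bound hp h0 hqb hb hm₀ hC hε hε1
  set κ := 1 / ((1 - √C / √(1 / 2 * degreeMass q + C)) * (2 * C)) / ε
  have hU := h.integrable_totalRate hp h0 hq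
  refine Summable.of_nonneg_of_le (fun k => ?_) (fun k => ?_)
    (hl.add ((hp.summable_mul.mul_left κ).mul_right (∫ s in t₁..t₂, totalRate u s)))
  · exact intervalIntegral.integral_nonneg h.le fun s _ => norm_nonneg _
  · have hI := (h.potential_integral hp h0 hqb hb hm₀ hC hε k ⟨h.le, le_rfl⟩).1
    have e : l k * q k + κ * (k * p k) * ∫ s in t₁..t₂, totalRate u s
        = ∫ s in t₁..t₂, (l k * u k s + κ * (k * p k) * totalRate u s) := by
      rw [intervalIntegral.integral_add ((h.integrable k).const_mul _) (hU.const_mul _),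
        intervalIntegral.integral_const_mul, intervalIntegral.integral_const_mul, h.integral_eq k]
    rw [e]
    refine intervalIntegral.integral_mono_on h.le hI.norm
      (((h.integrable k).const_mul _).add (hU.const_mul _)) fun s hs => ?_
    have h1 := hl' k _ ⟨h.residual_nonneg hp h0 hq hs, h.residual_le hp h0 hq hs⟩
    obtain ⟨h2, h3⟩ := h.slope_div_le hp h0 hqb hb hm₀ hC hε k hs
    have hu := h.nonneg k s
    have hU0 := h.totalRate_nonneg s
    unfold potentialRate
    refine (abs_sub _ _).trans (add_le_add ?_ ?_)
    · rw [abs_mul, abs_of_nonneg hu, mul_comm (l k)]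
      gcongr
    · rw [abs_mul, abs_of_nonneg hU0, abs_of_nonneg h2, mul_comm]
      gcongr

/-- The remaining part of the calibrating potential. -/
def corePotential (q qbar : DegSeq) (t₁ : ℝ) (x : ℝ → State) (u : ℕ → ℝ → ℝ) (C t : ℝ) : ℝ :=
  1 / 2 * (x t 0 * Real.log (residual q t₁ u t + C))
    - (residual q t₁ u t + 1 / 2 * degreeMass (qbar - q))
      * Real.log (residual q t₁ u t + 1 / 2 * degreeMass (qbar - q))

/-- The almost everywhere derivative of `corePotential`. -/
def corePotentialRate (q qbar : DegSeq) (t₁ : ℝ) (x : ℝ → State) (u : ℕ → ℝ → ℝ) (C s : ℝ) : ℝ :=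
  1 / 2 * ((degreeRate u s - 2 * totalRate u s) * Real.log (residual q t₁ u s + C)
      - x s 0 * (totalRate u s / (residual q t₁ u s + C)))
    + totalRate u s * (Real.log (residual q t₁ u s + 1 / 2 * degreeMass (qbar - q)) + 1)

theorem degreeMass_nonneg {q : DegSeq} (h : 0 ≤ q) : 0 ≤ degreeMass q :=
  tsum_nonneg fun k => mul_nonneg (by positivity) (h k)

/-- The time is stopped while `m` is still positive: if `qbar = q` the function `M log M` is not
Lipschitz at `m = 0`. -/
theorem corePotential_integral (h : IsExcursion qbar q t₁ t₂ x u) (hp : IsDegreeLaw p)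
    (h0 : 0 ≤ q) (hqb : q ≤ qbar) (hb : qbar ≤ p) {C : ℝ} (hC : 0 < C)
    {T : ℝ} (hT : T ∈ Icc t₁ t₂) (hT' : 0 < residual q t₁ u T) :
    IntervalIntegrable (corePotentialRate q qbar t₁ x u C) volume t₁ T ∧
      ∫ s in t₁..T, corePotentialRate q qbar t₁ x u C s
        = corePotential q qbar t₁ x u C T - corePotential q qbar t₁ x u C t₁ := by
  have hq := hqb.trans hb
  have hρ : 0 ≤ degreeMass (qbar - q) := degreeMass_nonneg (sub_nonneg.2 hqb)
  have hsub : uIcc t₁ T ⊆ uIcc t₁ t₂ := by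
    rw [uIcc_of_le hT.1, uIcc_of_le h.le]; exact Icc_subset_Icc_right hT.2
  have hmaps : MapsTo (residual q t₁ u) (uIcc t₁ T)
      (Icc (residual q t₁ u T) (1 / 2 * degreeMass q)) := by
    intro t ht
    have ht2 := hsub ht
    rw [uIcc_of_le h.le] at ht2
    rw [uIcc_of_le hT.1] at ht
    exact ⟨h.residual_antitoneOn hp h0 hq ht2 hT ht.2, h.residual_le hp h0 hq ht2⟩
  have hres := (h.residual_ac hp h0 hq).mono hsub
  have hconst : ∀ c : ℝ, AbsolutelyContinuousOnInterval (fun _ : ℝ => c) t₁ T := fun c =>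
    (LipschitzWith.const _).lipschitzOnWith.absolutelyContinuousOnInterval
  have hlog : ∀ c : ℝ, 0 ≤ c → AbsolutelyContinuousOnInterval
      (fun t => Real.log (residual q t₁ u t + c)) t₁ T := fun c hc => by
    refine hres.contDiffOn_comp (g := fun m => Real.log (m + c)) ?_ hmaps
    refine ContDiffOn.log (contDiffOn_id.add contDiffOn_const) fun m hm => ?_
    have : 0 < m + c := by linarith [hm.1]
    exact this.ne'
  have hac : AbsolutelyContinuousOnInterval (corePotential q qbar t₁ x u C) t₁ T :=
    ((((h.zero_ac hp h0 hq).mono hsub).mul (hlog C hC.le)).const_mul (1 / 2)).sub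
      ((hres.add (hconst _)).mul (hlog _ (by linarith)))
  refine hac.intervalIntegral_eq_sub ?_
  have hne : ∀ᵐ s : ℝ, s ≠ t₁ ∧ s ≠ t₂ := by
    filter_upwards [Measure.ae_ne volume t₁, Measure.ae_ne volume t₂] with s a b
    exact ⟨a, b⟩
  filter_upwards [h.ae_hasDerivAt_zero hp h0 hq, h.ae_hasDerivAt_residual hp h0 hq, hne]
    with s h1 h2 h3 hs
  have hs2 := hsub hs
  have hms := (hmaps hs).1
  rw [uIcc_of_le h.le] at hs2
  have hs' : s ∈ Ioo t₁ t₂ := ⟨lt_of_le_of_ne hs2.1 h3.1.symm, lt_of_le_of_ne hs2.2 h3.2⟩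
  have d1 := h1 hs'
  have d2 := h2 hs'
  have p1 : 0 < residual q t₁ u s + C := by linarith
  have p2 : 0 < residual q t₁ u s + 1 / 2 * degreeMass (qbar - q) := by linarith
  have d3 := ((d1.mul ((d2.add_const C).log p1.ne')).const_mul (1 / 2)).sub
    ((d2.add_const (1 / 2 * degreeMass (qbar - q))).mul ((d2.add_const _).log p2.ne'))
  refine d3.congr_deriv ?_
  unfold corePotentialRate
  rw [mul_div_cancel₀ _ p2.ne']
  ring

/-- The calibration itself: with the weights `E` below, the bound of `le_tsum_lintegral_ell` is
exactly the derivative of the potential, for an arbitrary competitor with residual `m`. -/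
theorem le_cost_rate (h : IsExcursion qbar q t₁ t₂ x u) (hp : IsDegreeLaw p)
    (h0 : 0 ≤ q) (hqb : q ≤ qbar) (hb : qbar ≤ p) (hm₀ : 0 < 1 / 2 * degreeMass q) {C ε : ℝ}
    (hC : 0 < C) (hε : 0 < ε) {s : ℝ} (hs : s ∈ Icc t₁ t₂) (hr : 0 < residual q t₁ u s)
    (hU : HasSum (fun k => u k s) (totalRate u s))
    (hX : HasSum (fun k : ℕ => (k : ℝ) * u k s) (degreeRate u s))
    (hG : Summable fun k => potentialRate q qbar t₁ x u C ε k s)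
    (hu0 : ∀ k : ℕ+, q k = 0 → u k s = 0) {φ : ℕ → ℝ → ℝ≥0}
    (hint : ∀ k, IntegrableOn (indicator {y | y < rate (x s) k} fun y => (φ k y : ℝ)) (Icc 0 1))
    (hu : ∀ k, u k s = ∫ y in Icc 0 1, indicator {y | y < rate (x s) k} (fun y => (φ k y : ℝ)) y) :
    ENNReal.ofReal (∑' k, potentialRate q qbar t₁ x u C ε k s + corePotentialRate q qbar t₁ x u C s)
      ≤ ∑' k, ∫⁻ y in Icc (0 : ℝ) 1, ENNReal.ofReal (ell (φ k y)) := by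
  have hq := hqb.trans hb
  have hρ : 0 ≤ degreeMass (qbar - q) := degreeMass_nonneg (sub_nonneg.2 hqb)
  have hmass := h.hasSum_mass hp h0 hqb hb hs
  set m := residual q t₁ u s with hm
  set m₀ := 1 / 2 * degreeMass q with hm₀'
  set M := m + 1 / 2 * degreeMass (qbar - q) with hM
  have hM0 : 0 < M := by linarith
  have hmC : 0 < m + C := by linarith
  have hrx : r (x s) = 2 * M := hmass.tsum_eq
  have hmass0 : ∀ k, 0 ≤ mass (x s) k := fun k => by
    rcases Nat.eq_zero_or_pos k with rfl | hk
    · simp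
    · have := h.right_le ⟨k, hk⟩ hs
      have h2 : 0 ≤ (qbar - q) ⟨k, hk⟩ := sub_nonneg.2 (hqb _)
      have h3 := mass_pnat (x s) ⟨k, hk⟩
      simp only [PNat.mk_coe] at h3 this
      rw [h3]
      exact mul_nonneg (by positivity) (h2.trans this)
  have hR : HasSum (rate (x s)) 1 := by
    have := hmass.div_const (2 * M)
    rw [div_self (by positivity), ← hrx] at this
    exact this
  -- This is intensity divided by rate on the regularized candidate: `(x_0/(2(m + C))) / (x_0/(2M))`
  -- at `0`, and `slopeAt / (k * profile/(2M))` at `k ≥ 1`.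
  set E : State := state (M / (m + C)) fun k =>
    M / (m + C) * (coef C m₀ q k * √(m + C) ^ (k : ℕ)
      / profile (qbar - q + ε • q) C m₀ q k m) with hE
  have hprof : ∀ k, 0 < q k → 0 < profile (qbar - q + ε • q) C m₀ q k m := fun k hk =>
    (mul_pos hε hk).trans_le (profile_ge h0 hqb hm₀ hr.le k)
  have hEpos : ∀ k : ℕ+, 0 < q k → 0 < E k := fun k hk => by
    rw [hE, state_pnat]
    have := coef_pos hC.le hm₀ hk
    have := hprof k hk
    have : 0 < √(m + C) := Real.sqrt_pos.2 hmC
    positivity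
  have hE0 : ∀ k : ℕ+, q k = 0 → E k = 0 := fun k hk => by
    rw [hE, state_pnat, coef_eq_zero hk]
    simp
  have hEz : E 0 = M / (m + C) := state_zero _ _
  have key : HasSum (fun k => u k s * Real.log (E k) - totalRate u s * (rate (x s) k * E k))
      (∑' k, potentialRate q qbar t₁ x u C ε k s + (totalRate u s * Real.log (M / (m + C))
        + 1 / 2 * Real.log (m + C) * degreeRate u s
        - totalRate u s * (x s 0 / (2 * (m + C))))) := by
    rw [hasSum_nat_iff_pnat]
    have a1 := (hasSum_nat_iff_pnat.1 hU).mul_right (Real.log (M / (m + C)))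
    have a2 := (hasSum_nat_iff_pnat.1 hX).mul_left (1 / 2 * Real.log (m + C))
    have a3 := (hG.hasSum.add a1).add a2
    have e : ∑' k, potentialRate q qbar t₁ x u C ε k s
        + (totalRate u s - u 0 s) * Real.log (M / (m + C))
        + 1 / 2 * Real.log (m + C) * (degreeRate u s - (0 : ℕ) * u 0 s)
        = ∑' k, potentialRate q qbar t₁ x u C ε k s + (totalRate u s * Real.log (M / (m + C))
        + 1 / 2 * Real.log (m + C) * degreeRate u s
        - totalRate u s * (x s 0 / (2 * (m + C))))
        - (u 0 s * Real.log (E 0) - totalRate u s * (rate (x s) 0 * E 0)) := by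
      rw [hEz, rate, mass_zero, max_eq_left (h.zero_nonneg s hs), hrx]
      have : x s 0 / (2 * M) * (M / (m + C)) = x s 0 / (2 * (m + C)) := by field_simp
      rw [this]
      push_cast
      ring
    rw [e] at a3
    refine a3.congr_fun fun k => ?_
    rcases (h0 k).eq_or_lt with hk | hk
    · simp only [Pi.zero_apply] at hk
      rw [hu0 k hk.symm, hE0 k hk.symm]
      simp [potentialRate, hu0 k hk.symm, slopeAt, coef_eq_zero hk.symm]
    · simp only [Pi.zero_apply] at hk
      have b1 := coef_pos hC.le hm₀ hk
      have b2 := hprof k hk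
      have b3 : 0 < √(m + C) := Real.sqrt_pos.2 hmC
      have e1 : Real.log (E k) = Real.log (M / (m + C)) + (Real.log (coef C m₀ q k)
          + k * (1 / 2 * Real.log (m + C)) - Real.log (profile (qbar - q + ε • q) C m₀ q k m)) := by
        rw [hE, state_pnat, Real.log_mul (by positivity) (by positivity),
          Real.log_div (x := coef C m₀ q k * √(m + C) ^ (k : ℕ)) (by positivity) b2.ne',
          Real.log_mul b1.ne' (by positivity), Real.log_pow, Real.log_sqrt hmC.le]
        ring
      -- The mass `2 * M` in the rate cancels against the factor `M` in `E`, which leaves the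
      -- logarithmic derivative of the profile.
      have e2 : rate (x s) k * E k
          = x s k * (slopeAt C m₀ q k m / profile (qbar - q + ε • q) C m₀ q k m) := by
        rw [rate, mass_pnat, hrx, hE, state_pnat, slopeAt]
        field_simp
      rw [e1, e2]
      simp only [potentialRate, ← hm, ← hm₀']
      ring
  have hfin := le_tsum_lintegral_ell (φ := φ) (E := E)
    (fun k => div_nonneg (hmass0 k) (by rw [hrx]; positivity)) hR hint hu hU
    (fun k => ?_) (fun k => ?_) key
  · convert hfin using 2
    unfold corePotentialRate
    rw [← hm, ← hM, Real.log_div hM0.ne' hmC.ne']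
    field_simp
    ring
  · rcases Nat.eq_zero_or_pos k with rfl | hk
    · rw [hEz]; positivity
    · rcases (h0 ⟨k, hk⟩).eq_or_lt with hk' | hk'
      · exact (hE0 ⟨k, hk⟩ hk'.symm).ge
      · exact (hEpos ⟨k, hk⟩ hk').le
  · rcases Nat.eq_zero_or_pos k with rfl | hk
    · left; rw [hEz]; positivity
    · rcases (h0 ⟨k, hk⟩).eq_or_lt with hk' | hk'
      · exact Or.inr (hu0 ⟨k, hk⟩ hk'.symm)
      · exact Or.inl (hEpos ⟨k, hk⟩ hk')

end IsExcursion

/-! ### Boundary values of the potential -/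

theorem le_of_eventually_ofReal_le {f : ℝ → ℝ} {a : ℝ} {c : ℝ≥0∞}
    (hf : ContinuousWithinAt f (Ioi 0) 0) (ha : f 0 = a)
    (h : ∀ᶠ δ in 𝓝[>] (0 : ℝ), ENNReal.ofReal (f δ) ≤ c) : ENNReal.ofReal a ≤ c := by
  have h1 : Tendsto (fun δ => ENNReal.ofReal (f δ)) (𝓝[>] 0) (𝓝 (ENNReal.ofReal a)) :=
    ENNReal.tendsto_ofReal (ha ▸ hf.tendsto)
  exact le_of_tendsto h1 h

/-- The defect `½∑kq_k · (log m₀ - log (m₀ + C)) - ∑ q_k log (1 - θ^k)`, where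
`m₀ = ½∑kq_k` and `θ = (C / (m₀ + C))^{1/2}`. -/
def excess (C : ℝ) (q : DegSeq) : ℝ :=
  (1 / 2 * degreeMass q) * (Real.log (1 / 2 * degreeMass q) - Real.log (1 / 2 * degreeMass q + C))
    - ∑' k : ℕ+, q k * Real.log (1 - (√C / √(1 / 2 * degreeMass q + C)) ^ (k : ℕ))

/-- Here `log c_k = log q_k - log gap`, and `log_gap` splits the gap. The part linear in `k` sums to
a multiple of `degreeMass q`; compared with the second term of `H`, it leaves the first term of
`excess`, and the part `log (1 - θ^k)` gives the second. -/
theorem tsum_mul_log_coef {p q : DegSeq} (hp : IsDegreeLaw p) (h0 : 0 ≤ q) (hq : q ≤ p)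
    (hm₀ : 0 < 1 / 2 * degreeMass q) {C : ℝ} (hC : 0 ≤ C) :
    HasSum (fun k : ℕ+ => q k * Real.log (coef C (1 / 2 * degreeMass q) q k))
      (H q + excess C q) := by
  set m₀ := 1 / 2 * degreeMass q with hm
  set θ := √C / √(m₀ + C) with hθ
  have hθ1 : θ < 1 := sqrt_ratio_lt_one hC hm₀
  have hθ0 : 0 ≤ θ := by positivity
  have s1 := (hp.summable_mul_log h0 hq).hasSum
  have s2 := (hp.summable_mul_of_le h0 hq).hasSum.mul_left (1 / 2 * Real.log (m₀ + C))
  have s3 : Summable fun k : ℕ+ => q k * Real.log (1 - θ ^ (k : ℕ)) := by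
    refine Summable.of_norm_bounded
      ((hp.summable_of_le h0 hq).mul_right |Real.log (1 - θ)|) fun k => ?_
    rw [norm_mul, Real.norm_of_nonneg (h0 k)]
    exact mul_le_mul_of_nonneg_left (abs_log_one_sub_pow_le hθ0 hθ1 k) (h0 k)
  have s4 := (s1.sub s2).sub s3.hasSum
  have e : ∑' k, q k * Real.log (q k) - 1 / 2 * Real.log (m₀ + C) * ∑' k : ℕ+, (k : ℝ) * q k
      - ∑' k : ℕ+, q k * Real.log (1 - θ ^ (k : ℕ)) = H q + excess C q := by
    rw [H, excess, ← hm, ← hθ]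
    have : ∑' k : ℕ+, (k : ℝ) * q k = 2 * m₀ := by rw [hm, degreeMass]; ring
    rw [this]
    ring
  rw [e] at s4
  refine s4.congr_fun fun k => ?_
  rcases (h0 k).eq_or_lt with hk | hk
  · simp only [Pi.zero_apply] at hk
    simp [← hk]
  · rw [log_coef hC hm₀ hk, log_gap hC hm₀]
    ring

namespace IsExcursion

variable {p q qbar : DegSeq} {t₁ t₂ : ℝ} {x : ℝ → State} {u : ℕ → ℝ → ℝ}

theorem zero_left (h : IsExcursion qbar q t₁ t₂ x u) : x t₁ 0 = 0 := by
  have := h.zero_eq t₁ ⟨le_rfl, h.le⟩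
  simp only [intervalIntegral.integral_same, mul_zero] at this
  exact this.unique hasSum_zero

theorem left_eq (h : IsExcursion qbar q t₁ t₂ x u) (k : ℕ+) : x t₁ k = qbar k := by
  rw [h.pnat_eq k t₁ ⟨le_rfl, h.le⟩]
  simp

theorem zero_le_residual (h : IsExcursion qbar q t₁ t₂ x u) (hp : IsDegreeLaw p)
    (h0 : 0 ≤ q) (hq : q ≤ p) {t : ℝ} (ht : t ∈ Icc t₁ t₂) :
    x t 0 ≤ 2 * residual q t₁ u t := by
  have := (h.hasSum_residual hp h0 hq ht).nonneg fun k =>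
    mul_nonneg (by positivity) (sub_nonneg.2 (h.right_le k ht))
  linarith

/-- At `t₁` the profile is `qbar k + ε * q k`, and `log (1 + y) ≤ y` bounds the loss by `ε * q k`.
At `T` the coordinate is split as `(qbar - q) k` plus an excess: the profile is at least `(qbar - q)
k` for the former and at least `ε * q k` for the latter. The error is proportional to the
degree-weighted excess, which is controlled by the residual. -/
theorem potential_sub_ge (h : IsExcursion qbar q t₁ t₂ x u) (hp : IsDegreeLaw p)
    (h0 : 0 ≤ q) (hqb : q ≤ qbar) (hb : qbar ≤ p) (hm₀ : 0 < 1 / 2 * degreeMass q) {C ε κ : ℝ}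
    (hC : 0 < C) (hε : 0 < ε)
    (hκ : ∀ k : ℕ+, |Real.log (gap C (1 / 2 * degreeMass q) k)| ≤ κ * k) (k : ℕ+) {T : ℝ}
    (hT : T ∈ Icc t₁ t₂) :
    (qbar - q) k * Real.log ((qbar - q) k) - qbar k * Real.log (qbar k)
        + q k * Real.log (coef C (1 / 2 * degreeMass q) q k) - ε * q k
        - (|Real.log ε| + κ) * (k * (x T k - (qbar - q) k))
      ≤ potential q qbar t₁ x u C ε k T - potential q qbar t₁ x u C ε k t₁ := by
  have hq := hqb.trans hb
  have hr0 := h.residual_nonneg hp h0 hq hT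
  have hz := h.right_le k hT
  have hlk := h.le_left k hT
  have hprof := profile_ge (C := C) (ε := ε) h0 hqb hm₀ hr0 k
  have hmul := coef_mul_gap hC.le hm₀ q k
  have hgk := hκ k
  simp only [potential, residual_left, h.left_eq]
  set m₀ := 1 / 2 * degreeMass q with hm₀'
  set m := residual q t₁ u T
  have hend : profile (qbar - q + ε • q) C m₀ q k m₀ = qbar k + ε * q k := by
    simp only [profile, hmul, Pi.add_apply, Pi.sub_apply, Pi.smul_apply, smul_eq_mul]
    ring
  rw [hend]
  have hρ0 : 0 ≤ (qbar - q) k := sub_nonneg.2 (hqb k)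
  -- A degree with `q k = 0` is never explored, so its coordinate stays at `qbar k` and both sides
  -- agree.
  rcases (h0 k).eq_or_lt with hk | hk
  · simp only [Pi.zero_apply] at hk
    have h1 : (qbar - q) k = qbar k := by simp [← hk]
    have h2 : x T k = qbar k := le_antisymm hlk (h1 ▸ hz)
    have h3 : profile (qbar - q + ε • q) C m₀ q k m = qbar k := by
      simp [profile, coef_eq_zero hk.symm, ← hk]
    rw [h3, h2, h1, ← hk]
    simp
  · simp only [Pi.zero_apply] at hk
    have hqk : 0 < qbar k := hk.trans_le (hqb k)
    have hlogε : Real.log (ε * q k) = Real.log ε + Real.log (q k) :=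
      Real.log_mul hε.ne' hk.ne'
    have hcoef := log_coef hC.le hm₀ hk
    have i1 : qbar k * Real.log (qbar k + ε * q k) ≤ qbar k * Real.log (qbar k) + ε * q k := by
      have h1 : qbar k + ε * q k = qbar k * (1 + ε * q k / qbar k) := by field_simp
      have hpos : 0 < ε * q k / qbar k := by positivity
      rw [h1, Real.log_mul hqk.ne' (by linarith), mul_add]
      have h2 : Real.log (1 + ε * q k / qbar k) ≤ ε * q k / qbar k := by
        have := Real.log_le_sub_one_of_pos (by linarith : 0 < 1 + ε * q k / qbar k)
        linarith
      have h3 := mul_le_mul_of_nonneg_left h2 hqk.le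
      rw [mul_div_cancel₀ _ hqk.ne'] at h3
      linarith
    have i2 : (qbar - q) k * Real.log ((qbar - q) k)
        ≤ (qbar - q) k * Real.log (profile (qbar - q + ε • q) C m₀ q k m) := by
      rcases hρ0.eq_or_lt with h1 | h1
      · rw [← h1]; simp
      · refine mul_le_mul_of_nonneg_left (Real.log_le_log h1 ?_) hρ0
        have h2 : 0 ≤ coef C m₀ q k * gap C m k :=
          mul_nonneg (coef_nonneg hm₀.le h0 k) (gap_nonneg hr0 _)
        have h3 : 0 < ε * q k := mul_pos hε hk
        simp only [profile, Pi.add_apply, Pi.smul_apply, smul_eq_mul]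
        linarith
    have i3 : Real.log (ε * q k) ≤ Real.log (profile (qbar - q + ε • q) C m₀ q k m) :=
      Real.log_le_log (mul_pos hε hk) hprof
    have i4 : -((|Real.log ε| + κ) * k) ≤ Real.log (profile (qbar - q + ε • q) C m₀ q k m)
        - Real.log (coef C m₀ q k) := by
      have h1 := neg_abs_le (Real.log ε)
      have h2 := neg_abs_le (Real.log (gap C m₀ k))
      have h3 : |Real.log ε| ≤ |Real.log ε| * k :=
        le_mul_of_one_le_right (abs_nonneg _) (pnat_one_le k)
      rw [hcoef]
      linarith
    have i5 := mul_le_mul_of_nonneg_left i4 (sub_nonneg.2 hz)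
    have i6 : x T k * Real.log (profile (qbar - q + ε • q) C m₀ q k m)
        = (qbar - q) k * Real.log (profile (qbar - q + ε • q) C m₀ q k m)
          + (x T k - (qbar - q) k) * Real.log (profile (qbar - q + ε • q) C m₀ q k m) := by ring
    have i7 : qbar k - (qbar - q) k = q k := by simp
    rw [i7, i6]
    linarith

end IsExcursion

/-! ### The lower bound on the cost -/

theorem le_controlCost {p q qbar : DegSeq} (hp : IsDegreeLaw p)
    (h0 : 0 ≤ q) (hqb : q ≤ qbar) (hb : qbar ≤ p) (hm₀ : 0 < 1 / 2 * degreeMass q)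
    {t₁ t₂ : ℝ} (ht1 : 0 ≤ t₁) (h12 : t₁ ≤ t₂) {γ : (ℝ → State) × (ℝ → ℝ)}
    (hγ : γ ∈ J1 p t₁ t₂ (state 0 qbar) (state 0 (qbar - q))) {φ : ℕ → ℝ × ℝ → ℝ≥0}
    (hφ : IsControl p t₂ γ.1 γ.2 φ) {C ε : ℝ} (hC : 0 < C) (hε : 0 < ε) (hε1 : ε ≤ 1)
    {T : ℝ} (hT : T ∈ Icc t₁ t₂) (hT' : 0 < residual q t₁ (intensity γ.1 φ) T) :
    ∃ S : ℝ, HasSum (fun k => IsExcursion.potential q qbar t₁ γ.1 (intensity γ.1 φ) C ε k T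
        - IsExcursion.potential q qbar t₁ γ.1 (intensity γ.1 φ) C ε k t₁) S ∧
      ENNReal.ofReal (S + (IsExcursion.corePotential q qbar t₁ γ.1 (intensity γ.1 φ) C T
        - IsExcursion.corePotential q qbar t₁ γ.1 (intensity γ.1 φ) C t₁))
        ≤ controlCost t₁ t₂ φ := by
  have h := isExcursion_of_mem_J1 ht1 h12 hγ hφ
  have hq := hqb.trans hb
  set u := intensity γ.1 φ with hu
  have hI := fun k => (h.potential_integral hp h0 hqb hb hm₀ hC hε k ⟨h.le, le_rfl⟩).1
  obtain ⟨j1, j2, j3⟩ := intervalIntegral_tsum h.le hI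
    (h.summable_potentialRate hp h0 hqb hb hm₀ hC hε hε1)
  obtain ⟨c1, c2⟩ := h.corePotential_integral hp h0 hqb hb hC hT hT'
  have j4 := j3 T hT
  simp_rw [(h.potential_integral hp h0 hqb hb hm₀ hC hε _ hT).2] at j4
  refine ⟨_, j4, ?_⟩
  have hsub : uIcc t₁ T ⊆ uIcc t₁ t₂ := by
    rw [uIcc_of_le hT.1, uIcc_of_le h.le]; exact Icc_subset_Icc_right hT.2
  rw [← c2, ← intervalIntegral.integral_add (j1.mono_set hsub) c1,
    intervalIntegral.integral_of_le hT.1, controlCost_eq hφ.measurable]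
  refine (ofReal_integral_le_lintegral _).trans ?_
  refine le_trans ?_ (lintegral_mono_set
    (Ioc_subset_Icc_self.trans (Icc_subset_Icc_right hT.2) : Ioc t₁ T ⊆ Icc t₁ t₂))
  refine lintegral_mono_ae ?_
  rw [ae_restrict_iff' measurableSet_Ioc]
  -- Degrees with `q k = 0` have weight `E k = 0`. The calibration tolerates this only if `u k`
  -- vanishes, which holds almost everywhere because `∫ u_k = q k = 0`.
  have hz : ∀ᵐ s, ∀ k : ℕ+, s ∈ Ioc t₁ t₂ → q k = 0 → u k s = 0 := by
    rw [ae_all_iff]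
    intro k
    by_cases hk : q k = 0
    · have h1 := h.integral_eq k
      rw [hk, intervalIntegral.integral_of_le h.le] at h1
      have h2 := (integral_eq_zero_iff_of_nonneg (f := u k) (fun s => h.nonneg k s)
        ((intervalIntegrable_iff_integrableOn_Ioc_of_le h.le).1 (h.integrable k))).1 h1
      have h3 := (ae_restrict_iff' measurableSet_Ioc).1 h2
      filter_upwards [h3] with s hs hs' _
      exact hs hs'
    · exact ae_of_all _ fun s _ hk' => absurd hk' hk
  have hint := ae_all_iff.2 hφ.ae_integrableOn
  filter_upwards [h.ae_hasSum_totalRate hp h0 hq, h.ae_hasSum_degreeRate hp h0 hq, j2, hz, hint]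
    with s a1 a2 a3 a4 a5 hs
  have hs2 : s ∈ Ioc t₁ t₂ := ⟨hs.1, hs.2.trans hT.2⟩
  have hs3 := Ioc_subset_Icc_self hs2
  refine h.le_cost_rate hp h0 hqb hb hm₀ hC hε hs3
    (hT'.trans_le (h.residual_antitoneOn hp h0 hq hs3 hT hs.2)) (a1 hs2) (a2 hs2) (a3 hs2)
    (fun k => a4 k hs2) (φ := fun k y => φ k (s, y)) (fun k => ?_) (fun k => ?_)
  · exact a5 k ⟨ht1.trans hs3.1, hs3.2⟩
  · rfl

/-- The residual is continuous and runs from `½∑kq_k` to `0`, so it takes each small value `δ` at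
some time `T`. The calibration is integrated up to `T`, and the boundary terms there converge as `δ
→ 0`. -/
theorem le_controlCost_of_regularization {p q qbar : DegSeq} (hp : IsDegreeLaw p)
    (h0 : 0 ≤ q) (hqb : q ≤ qbar) (hb : qbar ≤ p) (hm₀ : 0 < 1 / 2 * degreeMass q)
    {t₁ t₂ : ℝ} (ht1 : 0 ≤ t₁) (h12 : t₁ ≤ t₂) {γ : (ℝ → State) × (ℝ → ℝ)}
    (hγ : γ ∈ J1 p t₁ t₂ (state 0 qbar) (state 0 (qbar - q))) {φ : ℕ → ℝ × ℝ → ℝ≥0}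
    (hφ : IsControl p t₂ γ.1 γ.2 φ) {C ε : ℝ} (hC : 0 < C) (hε : 0 < ε) (hε1 : ε ≤ 1) :
    ENNReal.ofReal (H q + H (qbar - q) - H qbar + excess C q - ε * vertexMass q)
      ≤ controlCost t₁ t₂ φ := by
  have h := isExcursion_of_mem_J1 ht1 h12 hγ hφ
  have hq := hqb.trans hb
  have hρ0 : 0 ≤ qbar - q := sub_nonneg.2 hqb
  have hρp : qbar - q ≤ p := (sub_le_self _ h0).trans hb
  have hqb0 : 0 ≤ qbar := h0.trans hqb
  obtain ⟨κ, hκ0, hκ⟩ := exists_abs_log_gap_le hC.le hm₀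
  set u := intensity γ.1 φ with hu
  set Mρ := 1 / 2 * degreeMass (qbar - q) with hMρ
  set lam := |Real.log ε| + κ with hlam
  have hlam0 : 0 ≤ lam := by positivity
  have hsumm := ((((hp.summable_mul_log hρ0 hρp).hasSum.sub
    (hp.summable_mul_log hqb0 hb).hasSum).add (tsum_mul_log_coef hp h0 hq hm₀ hC.le)).sub
    ((hp.summable_of_le h0 hq).hasSum.mul_left ε))
  set B := ∑' k, (qbar - q) k * Real.log ((qbar - q) k) - ∑' k, qbar k * Real.log (qbar k)
    + (H q + excess C q) - ε * ∑' k, q k with hB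
  have hM1 : 1 / 2 * degreeMass q + Mρ = 1 / 2 * degreeMass qbar := by
    rw [hMρ, degreeMass_sub (hp.summable_mul_of_le hqb0 hb) (hp.summable_mul_of_le h0 hq)]
    ring
  set M₁ := 1 / 2 * degreeMass qbar with hM₁
  -- `lam * (2 * δ)` bounds the unexplored excess at `T`. The term `δ * |log (δ + C)|` bounds `½ x_0
  -- log (m + C)`, because the active mass is at most twice the residual.
  refine le_of_eventually_ofReal_le (f := fun δ => B - lam * (2 * δ)
    + (-(δ * |Real.log (δ + C)|) - (δ + Mρ) * Real.log (δ + Mρ) + M₁ * Real.log M₁)) ?_ ?_ ?_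
  · have hne : (0 : ℝ) + C ≠ 0 := by simpa using hC.ne'
    have c1 : ContinuousAt (fun δ : ℝ => δ * |Real.log (δ + C)|) 0 :=
      continuousAt_id.mul ((continuousAt_id.add continuousAt_const).log hne).abs
    have c2 : ContinuousAt (fun δ : ℝ => (δ + Mρ) * Real.log (δ + Mρ)) 0 :=
      (Real.continuous_mul_log.comp (continuous_id.add continuous_const)).continuousAt
    have c3 : ContinuousAt (fun δ : ℝ => B - lam * (2 * δ)) 0 := by fun_prop
    exact (c3.add ((c1.neg.sub c2).add continuousAt_const)).continuousWithinAt
  · simp only [mul_zero, zero_mul, neg_zero, zero_sub, zero_add, sub_zero]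
    rw [hB, H, H, H, vertexMass, ← hM₁, ← hMρ]
    ring
  · have hev : ∀ᶠ δ in 𝓝[>] (0 : ℝ), δ ∈ Ioo 0 (1 / 2 * degreeMass q) :=
      Ioo_mem_nhdsGT hm₀
    filter_upwards [hev] with δ hδ
    have hcont : ContinuousOn (residual q t₁ u) (Icc t₁ t₂) := by
      have := (h.residual_ac hp h0 hq).continuousOn
      rwa [uIcc_of_le h.le] at this
    obtain ⟨T, hT, hTδ⟩ := intermediate_value_Icc' h.le hcont
      (show δ ∈ Icc (residual q t₁ u t₂) (residual q t₁ u t₁) by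
        rw [h.residual_right hp h0 hq, IsExcursion.residual_left]
        exact Ioo_subset_Icc_self hδ)
    obtain ⟨S, hS, hcost⟩ := le_controlCost hp h0 hqb hb hm₀ ht1 h12 hγ hφ hC hε hε1 hT
      (by rw [← hu, hTδ]; exact hδ.1)
    refine le_trans (ENNReal.ofReal_le_ofReal (add_le_add ?_ ?_)) hcost
    · have hres := h.hasSum_residual hp h0 hq hT
      rw [hTδ] at hres
      have hle := hasSum_le (fun k => h.potential_sub_ge hp h0 hqb hb hm₀ hC hε hκ k hT)
        (hsumm.sub (hres.mul_left lam)) hS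
      have := h.zero_nonneg T hT
      nlinarith
    · have hx0 := h.zero_nonneg T hT
      have hx1 := h.zero_le_residual hp h0 hq hT
      simp only [IsExcursion.corePotential, ← hu, hTδ, IsExcursion.residual_left, h.zero_left,
        ← hMρ, hM1]
      rw [hTδ] at hx1
      have h1 := neg_abs_le (Real.log (δ + C))
      have h2 : γ.1 T 0 * |Real.log (δ + C)| ≤ 2 * δ * |Real.log (δ + C)| :=
        mul_le_mul_of_nonneg_right hx1 (abs_nonneg _)
      have h3 := mul_le_mul_of_nonneg_left h1 hx0
      linarith

theorem le_I1_of_pos {p q qbar : DegSeq} (hp : IsDegreeLaw p)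
    (h0 : 0 ≤ q) (hqb : q ≤ qbar) (hb : qbar ≤ p) (hm₀ : 0 < 1 / 2 * degreeMass q)
    {t₁ t₂ : ℝ} (ht1 : 0 ≤ t₁) (h12 : t₁ ≤ t₂) {C : ℝ} (hC : 0 < C) :
    ENNReal.ofReal (H q + H (qbar - q) - H qbar + excess C q)
      ≤ I1 p t₁ t₂ (state 0 qbar) (state 0 (qbar - q)) := by
  refine le_iInf₂ fun γ hγ => le_iInf₂ fun φ hφ => ?_
  refine le_of_eventually_ofReal_le (f := fun ε => H q + H (qbar - q) - H qbar + excess C q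
    - ε * vertexMass q) (by fun_prop) (by simp) ?_
  filter_upwards [Ioo_mem_nhdsGT one_pos] with ε hε
  exact le_controlCost_of_regularization hp h0 hqb hb hm₀ ht1 h12 hγ hφ hC hε.1 hε.2.le

/-- The case `β = 0`, where the shift vanishes and the calibration is not available directly. As `C
→ 0`, the first term of `excess` tends to `0` and the remaining one is nonnegative, so its limit is
not needed. -/
theorem le_I1_of_zero {p q qbar : DegSeq} (hp : IsDegreeLaw p)
    (h0 : 0 ≤ q) (hqb : q ≤ qbar) (hb : qbar ≤ p) (hm₀ : 0 < 1 / 2 * degreeMass q)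
    {t₁ t₂ : ℝ} (ht1 : 0 ≤ t₁) (h12 : t₁ ≤ t₂) :
    ENNReal.ofReal (H q + H (qbar - q) - H qbar)
      ≤ I1 p t₁ t₂ (state 0 qbar) (state 0 (qbar - q)) := by
  set m₀ := 1 / 2 * degreeMass q with hm
  refine le_of_eventually_ofReal_le (f := fun C => H q + H (qbar - q) - H qbar
    + m₀ * (Real.log m₀ - Real.log (m₀ + C))) ?_ (by simp) ?_
  · have : m₀ + 0 ≠ 0 := by simpa using hm₀.ne'
    refine ContinuousAt.continuousWithinAt ?_
    exact continuousAt_const.add (continuousAt_const.mul (continuousAt_const.sub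
      ((continuousAt_const.add continuousAt_id).log this)))
  · filter_upwards [self_mem_nhdsWithin] with C hC
    refine le_trans (ENNReal.ofReal_le_ofReal ?_) (le_I1_of_pos hp h0 hqb hb hm₀ ht1 h12 hC)
    have hθ1 : √C / √(m₀ + C) < 1 := sqrt_ratio_lt_one (le_of_lt hC) hm₀
    have hθ0 : 0 ≤ √C / √(m₀ + C) := by positivity
    have hsum : ∑' k : ℕ+, q k * Real.log (1 - (√C / √(m₀ + C)) ^ (k : ℕ)) ≤ 0 := by
      refine tsum_nonpos fun k => mul_nonpos_of_nonneg_of_nonpos (h0 k) ?_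
      have h1 := one_sub_pow_ge hθ0 hθ1.le k
      exact Real.log_nonpos (by linarith) (by linarith [pow_nonneg hθ0 (k : ℕ)])
    unfold excess
    rw [← hm]
    linarith

/-! ### The parameter `β` -/

/-- The right side of the equation equals `∑ k q_k (1 + b)/(1 + b + ⋯ + b^{k-1})`, which is
continuous on `[0,1]`. At `b = 1` it is twice the vertex mass, below `degreeMass q`; for small `b >
0` it exceeds `degreeMass q`, because the `k = 1` term grows linearly and the others lose only order
`b²`. The intermediate value theorem gives a root. -/
theorem exists_isBeta {p q : DegSeq} (hp : IsDegreeLaw p) (h0 : 0 ≤ q) (hq : q ≤ p)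
    (h1 : 0 < q 1) (h : 2 * vertexMass q < degreeMass q) : ∃ b, IsBeta q b := by
  have hsum := hp.summable_mul_of_le h0 hq
  set d := degreeMass q with hd
  have hq1d : q 1 ≤ d := by
    have := hsum.le_tsum 1 fun k _ => mul_nonneg (by positivity) (h0 k)
    simpa [hd, degreeMass] using this
  set F : ℝ → ℝ := fun b => ∑' k : ℕ+, (k : ℝ) * q k * ((1 + b) / ∑ j ∈ Finset.range k, b ^ j)
  have hgeom : ∀ (k : ℕ+) (b : ℝ), 0 ≤ b → 1 ≤ ∑ j ∈ Finset.range k, b ^ j := fun k b hb => by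
    have := Finset.single_le_sum (f := fun j => b ^ j) (fun j _ => pow_nonneg hb j)
      (Finset.mem_range.2 k.pos)
    simpa using this
  have hbound : ∀ (k : ℕ+), ∀ b ∈ Icc (0 : ℝ) 1,
      ‖(k : ℝ) * q k * ((1 + b) / ∑ j ∈ Finset.range k, b ^ j)‖ ≤ (k : ℝ) * q k * 2 := by
    intro k b hb
    have h2 := hgeom k b hb.1
    have h3 : (0 : ℝ) ≤ (k : ℝ) * q k := mul_nonneg (by positivity) (h0 k)
    have h4 : 0 ≤ (1 + b) / ∑ j ∈ Finset.range k, b ^ j :=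
      div_nonneg (by linarith [hb.1]) (by linarith)
    rw [Real.norm_of_nonneg (mul_nonneg h3 h4)]
    refine mul_le_mul_of_nonneg_left ?_ h3
    rw [div_le_iff₀ (by linarith)]
    linarith [hb.2]
  have hcont : ContinuousOn F (Icc 0 1) := by
    refine continuousOn_tsum (fun k => ?_) (hsum.mul_right 2) hbound
    refine continuousOn_const.mul (ContinuousOn.div (by fun_prop) (by fun_prop) fun b hb => ?_)
    linarith [hgeom k b hb.1]
  have hF1 : F 1 = 2 * vertexMass q := by
    simp only [F, vertexMass]
    rw [← tsum_mul_left]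
    congr 1; funext k
    have : (k : ℝ) ≠ 0 := by positivity
    simp
    field_simp
    norm_num
  -- The gain `q 1 * b₀` must beat the loss `d * b₀ ^ 2`; this choice gives `d * b₀ = q 1 / 2`.
  set b₀ := q 1 / (2 * d) with hb₀
  have hd0 : 0 < d := h1.trans_le hq1d
  have hb0 : 0 < b₀ := by positivity
  have hb1 : b₀ < 1 := by
    rw [hb₀, div_lt_one (by positivity)]; linarith
  have hFb : d < F b₀ := by
    have hle : ∀ k : ℕ+, (k : ℝ) * q k * (1 - b₀ ^ 2)
        + (if k = 1 then q 1 * (b₀ * (1 + b₀)) else 0)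
        ≤ (k : ℝ) * q k * ((1 + b₀) / ∑ j ∈ Finset.range k, b₀ ^ j) := by
      intro k
      by_cases hk : k = 1
      · subst hk
        simp
        nlinarith
      · rw [if_neg hk, add_zero]
        have h3 : (0 : ℝ) ≤ (k : ℝ) * q k := mul_nonneg (by positivity) (h0 k)
        refine mul_le_mul_of_nonneg_left ?_ h3
        rw [le_div_iff₀ (by linarith [hgeom k b₀ hb0.le])]
        have h5 : (∑ j ∈ Finset.range (k : ℕ), b₀ ^ j) * (1 - b₀) = 1 - b₀ ^ (k : ℕ) :=
          geom_sum_mul_neg b₀ k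
        have h6 := pow_nonneg hb0.le (k : ℕ)
        have h7 : (1 - b₀ ^ 2) * ∑ j ∈ Finset.range (k : ℕ), b₀ ^ j
            = (1 + b₀) * (1 - b₀ ^ (k : ℕ)) := by rw [← h5]; ring
        rw [h7]
        nlinarith
    have hs1 : HasSum (fun k : ℕ+ => (k : ℝ) * q k * (1 - b₀ ^ 2)
        + (if k = 1 then q 1 * (b₀ * (1 + b₀)) else 0))
        (d * (1 - b₀ ^ 2) + q 1 * (b₀ * (1 + b₀))) :=
      (hsum.hasSum.mul_right _).add (hasSum_ite_eq 1 _)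
    have hs2 : Summable fun k : ℕ+ => (k : ℝ) * q k * ((1 + b₀) / ∑ j ∈ Finset.range k, b₀ ^ j) :=
      Summable.of_norm_bounded (hsum.mul_right 2) fun k => hbound k b₀ ⟨hb0.le, hb1.le⟩
    have hle2 := hasSum_le hle hs1 hs2.hasSum
    have h8 : d * b₀ = q 1 / 2 := by rw [hb₀]; field_simp
    have h9 : d < d * (1 - b₀ ^ 2) + q 1 * (b₀ * (1 + b₀)) := by
      have : d * (1 - b₀ ^ 2) + q 1 * (b₀ * (1 + b₀)) = d + b₀ * (q 1 + q 1 * b₀ - d * b₀) := by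
        ring
      rw [this, h8]
      have : 0 < b₀ * (q 1 + q 1 * b₀ - q 1 / 2) := by
        apply mul_pos hb0
        nlinarith [mul_pos h1 hb0]
      linarith
    exact h9.trans_le hle2
  obtain ⟨b, hb, hbF⟩ := intermediate_value_Icc' hb1.le
    (hcont.mono (Icc_subset_Icc_left hb0.le))
    (show d ∈ Icc (F 1) (F b₀) from ⟨by rw [hF1]; exact h.le, hFb.le⟩)
  have hbne : b ≠ 1 := by
    rintro rfl
    rw [hF1] at hbF
    linarith
  have hblt : b < 1 := lt_of_le_of_ne hb.2 hbne
  refine ⟨b, Or.inr ⟨h1, hb0.trans_le hb.1, hblt, ?_⟩⟩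
  rw [← hd, ← hbF, ← tsum_mul_left]
  simp only [F]
  congr 1; funext k
  have h5 : (∑ j ∈ Finset.range (k : ℕ), b ^ j) * (1 - b) = 1 - b ^ (k : ℕ) := geom_sum_mul_neg b k
  have h6 := hgeom k b (hb0.le.trans hb.1)
  have h7 : (1 - b) ≠ 0 := by linarith
  have h8 : ∑ j ∈ Finset.range (k : ℕ), b ^ j ≠ 0 := by linarith
  rw [← h5]
  field_simp
  ring

theorem isBeta_betaOf {q : DegSeq} (h : ∃ b, IsBeta q b) : IsBeta q (betaOf q) :=
  Classical.epsilon_spec h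

theorem IsBeta.nonneg {q : DegSeq} {b : ℝ} (h : IsBeta q b) : 0 ≤ b := by
  rcases h with ⟨_, rfl⟩ | ⟨_, h, _⟩
  · exact le_rfl
  · exact h.le

theorem IsBeta.lt_one {q : DegSeq} {b : ℝ} (h : IsBeta q b) : b < 1 := by
  rcases h with ⟨_, rfl⟩ | ⟨_, _, h, _⟩
  · exact one_pos
  · exact h

/-- The shift `m₀ β² / (1 - β²)` attached to `β`. -/
def shift (q : DegSeq) (b : ℝ) : ℝ := 1 / 2 * degreeMass q * (b ^ 2 / (1 - b ^ 2))

section Shift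

variable {p q : DegSeq} {b : ℝ}

theorem IsBeta.one_sub_sq_pos (h : IsBeta q b) : 0 < 1 - b ^ 2 := by
  have := h.nonneg
  have := h.lt_one
  nlinarith

theorem IsBeta.shift_nonneg (h : IsBeta q b) (hm : 0 < 1 / 2 * degreeMass q) :
    0 ≤ shift q b :=
  mul_nonneg hm.le (div_nonneg (sq_nonneg _) h.one_sub_sq_pos.le)

theorem IsBeta.add_shift (h : IsBeta q b) :
    1 / 2 * degreeMass q + shift q b = 1 / 2 * degreeMass q / (1 - b ^ 2) := by
  have := h.one_sub_sq_pos.ne'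
  unfold shift
  field_simp
  ring

theorem IsBeta.ratio (h : IsBeta q b) (hm : 0 < 1 / 2 * degreeMass q) :
    √(shift q b) / √(1 / 2 * degreeMass q + shift q b) = b := by
  have h1 := h.one_sub_sq_pos
  rw [← Real.sqrt_div (h.shift_nonneg hm), h.add_shift, shift]
  have : 1 / 2 * degreeMass q * (b ^ 2 / (1 - b ^ 2)) / (1 / 2 * degreeMass q / (1 - b ^ 2))
      = b ^ 2 := by
    generalize 1 / 2 * degreeMass q = m at *
    field_simp
  rw [this, Real.sqrt_sq h.nonneg]

theorem IsBeta.excess_eq (h : IsBeta q b) (hm : 0 < 1 / 2 * degreeMass q) :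
    excess (shift q b) q = 1 / 2 * degreeMass q * Real.log (1 - b ^ 2)
      - ∑' k : ℕ+, q k * Real.log (1 - b ^ (k : ℕ)) := by
  have h1 := h.one_sub_sq_pos
  unfold excess
  rw [h.ratio hm, h.add_shift, Real.log_div hm.ne' h1.ne']
  ring

theorem excess_shift_betaOf (h : ∃ b, IsBeta q b) (hm : 0 < 1 / 2 * degreeMass q) :
    excess (shift q (betaOf q)) q = K q :=
  (isBeta_betaOf h).excess_eq hm

/-- Since `c_k C^{k/2} = q_k β^k/(1 - β^k) = q_k/(1 - β^k) - q_k` for `C > 0`, the equation of `β`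
says `∑ k c_k C^{k/2} = 2C`, here divided by `√C`. The divided form retains information at `C = 0`:
only the `k = 1` term survives there, and it vanishes because `q 1 = 0`. -/
theorem IsBeta.hasSum_coef_mul_pow_pred (h : IsBeta q b) (hp : IsDegreeLaw p) (h0 : 0 ≤ q)
    (hq : q ≤ p) (hm : 0 < 1 / 2 * degreeMass q) :
    HasSum (fun k : ℕ+ => (k : ℝ) * (coef (shift q b) (1 / 2 * degreeMass q) q k
      * √(shift q b) ^ ((k : ℕ) - 1))) (2 * √(shift q b)) := by
  have hC := h.shift_nonneg hm
  have hratio := h.ratio hm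
  have hadd := h.add_shift
  set m₀ := 1 / 2 * degreeMass q with hm₀
  set C := shift q b with hCdef
  have h1 := h.one_sub_sq_pos
  rcases h with ⟨hq1, rfl⟩ | ⟨hq1, hb0, hb1, heq⟩
  · have hC0 : C = 0 := by simp [hCdef, shift]
    rw [hC0, Real.sqrt_zero, mul_zero]
    convert hasSum_zero using 1
    funext k
    by_cases hk : k = 1
    · subst hk
      simp [coef_eq_zero hq1]
    · have : (k : ℕ) - 1 ≠ 0 := by
        have : (k : ℕ) ≠ 1 := fun h => hk (PNat.coe_eq_one_iff.1 h)
        have := k.pos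
        omega
      simp [zero_pow this]
  · have hCpos : 0 < C := by
      rw [hCdef, shift]; positivity
    have hY : 0 < √(m₀ + C) := Real.sqrt_pos.2 (by linarith)
    have hsC : 0 < √C := Real.sqrt_pos.2 hCpos
    have hone : ∀ k : ℕ+, 0 < 1 - b ^ (k : ℕ) := fun k => by
      linarith [one_sub_pow_ge hb0.le hb1.le k]
    have hsum := hp.summable_mul_of_le h0 hq
    have hs1 : Summable fun k : ℕ+ => (k : ℝ) * q k / (1 - b ^ (k : ℕ)) := by
      refine Summable.of_nonneg_of_le
        (fun k => div_nonneg (mul_nonneg (by positivity) (h0 k)) (hone k).le) (fun k => ?_)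
        (hsum.div_const (1 - b))
      exact div_le_div_of_nonneg_left (mul_nonneg (by positivity) (h0 k)) (by linarith)
        (one_sub_pow_ge hb0.le hb1.le k)
    have hs2 := (hs1.hasSum.sub hsum.hasSum).div_const √C
    have hval : (∑' k : ℕ+, (k : ℝ) * q k / (1 - b ^ (k : ℕ)) - ∑' k : ℕ+, (k : ℝ) * q k) / √C
        = 2 * √C := by
      have e1 : ∑' k : ℕ+, (k : ℝ) * q k / (1 - b ^ (k : ℕ)) = 2 * m₀ / (1 - b ^ 2) := by
        rw [eq_div_iff h1.ne', mul_comm, ← heq, hm₀]; ring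
      have e2 : ∑' k : ℕ+, (k : ℝ) * q k = 2 * m₀ := by rw [hm₀, degreeMass]; ring
      have e3 : 2 * m₀ / (1 - b ^ 2) = 2 * (m₀ + C) := by rw [hadd]; ring
      rw [e1, e2, e3, div_eq_iff hsC.ne', mul_assoc, Real.mul_self_sqrt hC]
      ring
    rw [hval] at hs2
    refine hs2.congr_fun fun k => ?_
    obtain ⟨j, hj⟩ : ∃ j, (k : ℕ) = j + 1 := ⟨k - 1, by have := k.pos; omega⟩
    have e4 : √C = b * √(m₀ + C) := by rw [← hratio]; field_simp
    have e5 : coef C m₀ q k = q k / (√(m₀ + C) ^ (k : ℕ) * (1 - b ^ (k : ℕ))) := by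
      rw [coef, gap_eq hC hm, hratio]
    have e6 := (hone k).ne'
    have e7 : √C ^ ((k : ℕ) - 1) = √C ^ (k : ℕ) / √C := by
      rw [hj, Nat.add_sub_cancel, pow_succ]; field_simp
    have e8 : √C ^ (k : ℕ) = b ^ (k : ℕ) * √(m₀ + C) ^ (k : ℕ) := by rw [e4, mul_pow]
    rw [e5, e7, e8]
    field_simp
    ring

theorem IsBeta.hasSum_coef_mul_pow (h : IsBeta q b) (hp : IsDegreeLaw p) (h0 : 0 ≤ q)
    (hq : q ≤ p) (hm : 0 < 1 / 2 * degreeMass q) :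
    HasSum (fun k : ℕ+ => (k : ℝ) * (coef (shift q b) (1 / 2 * degreeMass q) q k
      * √(shift q b) ^ (k : ℕ))) (2 * shift q b) := by
  have h1 := (h.hasSum_coef_mul_pow_pred hp h0 hq hm).mul_right √(shift q b)
  rw [mul_assoc, Real.mul_self_sqrt (h.shift_nonneg hm)] at h1
  refine h1.congr_fun fun k => ?_
  obtain ⟨j, hj⟩ : ∃ j, (k : ℕ) = j + 1 := ⟨k - 1, by have := k.pos; omega⟩
  rw [hj, Nat.add_sub_cancel, pow_succ]
  ring

/-- The polynomial `g(y) = ∑ y^i a^{k-1-i}` is convex on `[0, Y]`, hence below its chord, with `g(0)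
= a^{k-1}`. Multiplying by `Y(y - a)(Y - a)` and using `(y - a)g(y) = y^k - a^k` gives the claim. -/
theorem pow_sub_pow_le {a y Y : ℝ} (ha : 0 ≤ a) (hay : a ≤ y) (hyY : y ≤ Y) (k : ℕ+) :
    Y * (Y - a) * (y ^ (k : ℕ) - a ^ (k : ℕ))
      ≤ (y - a) * ((Y - y) * (Y - a) * a ^ ((k : ℕ) - 1) + y * (Y ^ (k : ℕ) - a ^ (k : ℕ))) := by
  rw [← geom_sum₂_mul y a, ← geom_sum₂_mul Y a]
  obtain ⟨n, hn⟩ : ∃ n, (k : ℕ) = n + 1 := ⟨k - 1, by have := k.pos; omega⟩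
  have hy : 0 ≤ y := ha.trans hay
  have key : Y * ∑ i ∈ Finset.range (k : ℕ), y ^ i * a ^ ((k : ℕ) - 1 - i)
      ≤ (Y - y) * a ^ ((k : ℕ) - 1)
        + y * ∑ i ∈ Finset.range (k : ℕ), Y ^ i * a ^ ((k : ℕ) - 1 - i) := by
    rw [hn, Finset.sum_range_succ', Finset.sum_range_succ', mul_add, mul_add, Finset.mul_sum,
      Finset.mul_sum]
    simp only [Nat.add_sub_cancel, pow_zero, one_mul, Nat.sub_zero]
    have : ∑ i ∈ Finset.range n, Y * (y ^ (i + 1) * a ^ (n - (i + 1)))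
        ≤ ∑ i ∈ Finset.range n, y * (Y ^ (i + 1) * a ^ (n - (i + 1))) := by
      refine Finset.sum_le_sum fun i _ => ?_
      have h1 : y ^ i ≤ Y ^ i := pow_le_pow_left₀ hy hyY i
      have h2 : 0 ≤ y * Y * a ^ (n - (i + 1)) :=
        mul_nonneg (mul_nonneg hy (hy.trans hyY)) (pow_nonneg ha _)
      have := mul_le_mul_of_nonneg_left h1 h2
      rw [pow_succ, pow_succ]
      linarith
    linarith
  have h2 : 0 ≤ (y - a) * (Y - a) := mul_nonneg (by linarith) (by linarith)
  have := mul_le_mul_of_nonneg_left key h2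
  linarith

theorem summable_mul_coef_gap (hp : IsDegreeLaw p) (h0 : 0 ≤ q)
    (hq : q ≤ p) {C m₀ m : ℝ} (hC : 0 ≤ C) (hm₀ : 0 < m₀) (hm : m ∈ Icc 0 m₀) :
    Summable fun k : ℕ+ => (k : ℝ) * (coef C m₀ q k * gap C m k) :=
  Summable.of_nonneg_of_le
    (fun k => mul_nonneg (by positivity) (mul_nonneg (coef_nonneg hm₀.le h0 k) (gap_nonneg hm.1 _)))
    (fun k => mul_le_mul_of_nonneg_left (coef_mul_gap_le hC hm₀ h0 hm.2 k) (by positivity))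
    (hp.summable_mul_of_le h0 hq)

/-- The active half-edge mass along the optimal path when `m` remains. -/
def active (C m₀ : ℝ) (q : DegSeq) (m : ℝ) : ℝ :=
  2 * m - ∑' k : ℕ+, (k : ℝ) * (coef C m₀ q k * gap C m k)

theorem active_zero (C m₀ : ℝ) (q : DegSeq) : active C m₀ q 0 = 0 := by simp [active]

theorem active_end {C : ℝ} (hC : 0 ≤ C) (hm : 0 < 1 / 2 * degreeMass q) :
    active C (1 / 2 * degreeMass q) q (1 / 2 * degreeMass q) = 0 := by
  simp only [active, coef_mul_gap hC hm]
  rw [degreeMass]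
  ring

/-- With `a`, `y`, `Y` the square roots of `C`, `m + C`, `m₀ + C`, the chord inequality is summed
with weights `k c_k`. The chord's values at `0` sum to `2a` by the equation of `β`, and its values
at `Y` are known from `degreeMass q`. The upper bound then collapses to `2m`. -/
theorem IsBeta.active_nonneg (h : IsBeta q b) (hp : IsDegreeLaw p) (h0 : 0 ≤ q)
    (hq : q ≤ p) (hm₀ : 0 < 1 / 2 * degreeMass q) {m : ℝ} (hm : m ∈ Icc 0 (1 / 2 * degreeMass q)) :
    0 ≤ active (shift q b) (1 / 2 * degreeMass q) q m := by
  have hC := h.shift_nonneg hm₀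
  have hs1 := h.hasSum_coef_mul_pow_pred hp h0 hq hm₀
  set m₀ := 1 / 2 * degreeMass q with hm₀'
  set C := shift q b
  have hs := (summable_mul_coef_gap hp h0 hq hC hm₀ hm).hasSum
  have hsq := (hp.summable_mul_of_le h0 hq).hasSum
  have e2 : ∑' k : ℕ+, (k : ℝ) * q k = 2 * m₀ := by rw [hm₀', degreeMass]; ring
  rw [e2] at hsq
  set a := √C with ha
  set y := √(m + C) with hy
  set Y := √(m₀ + C) with hY
  have ha0 : 0 ≤ a := Real.sqrt_nonneg _
  have hay : a ≤ y := Real.sqrt_le_sqrt (by linarith [hm.1])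
  have hyY : y ≤ Y := Real.sqrt_le_sqrt (by linarith [hm.2])
  have haY : a < Y := Real.sqrt_lt_sqrt hC (by linarith)
  have ea : a ^ 2 = C := Real.sq_sqrt hC
  have ey : y ^ 2 = m + C := Real.sq_sqrt (by linarith [hm.1])
  have eY : Y ^ 2 = m₀ + C := Real.sq_sqrt (by linarith)
  have hle := hasSum_le (fun k : ℕ+ => ?_) (hs.mul_left (Y * (Y - a)))
    (((hs1.mul_left ((Y - y) * (Y - a))).add (hsq.mul_left y)).mul_left (y - a))
  · have e : (y - a) * ((Y - y) * (Y - a) * (2 * a) + y * (2 * m₀)) = Y * (Y - a) * (2 * m) := by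
      have e1 : m₀ = Y ^ 2 - a ^ 2 := by rw [eY, ea]; ring
      have e2 : m = y ^ 2 - a ^ 2 := by rw [ey, ea]; ring
      rw [e1, e2]
      ring
    rw [e] at hle
    have := le_of_mul_le_mul_left hle (mul_pos (ha0.trans_lt haY) (by linarith))
    unfold active
    linarith
  · have h1 := pow_sub_pow_le ha0 hay hyY k
    have h2 : 0 ≤ (k : ℝ) * coef C m₀ q k := mul_nonneg (by positivity) (coef_nonneg hm₀.le h0 k)
    have h3 := mul_le_mul_of_nonneg_left h1 h2
    have h4 := coef_mul_gap hC hm₀ q k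
    rw [← h4]
    simp only [gap, ← ha, ← hy, ← hY] at h3 ⊢
    linarith

end Shift

/-! ### Calculus along the optimal path -/

theorem mul_pow_le_one_div {θ : ℝ} (h0 : 0 ≤ θ) (h1 : θ < 1) (k : ℕ) :
    (k : ℝ) * θ ^ k ≤ 1 / (1 - θ) := by
  have h2 : ∑ j ∈ Finset.range k, θ ^ k ≤ ∑ j ∈ Finset.range k, θ ^ j :=
    Finset.sum_le_sum fun j hj =>
      pow_le_pow_of_le_one h0 h1.le (Finset.mem_range.1 hj).le
  have h3 := geom_sum_mul_neg θ k
  rw [Finset.sum_const, Finset.card_range, nsmul_eq_mul] at h2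
  refine h2.trans ?_
  rw [le_div_iff₀ (by linarith), h3]
  linarith [pow_nonneg h0 k]

section Optimal

variable {p q qbar : DegSeq} {C m₀ : ℝ}

/-- For `m` bounded away from `m₀` the powers lose a geometric factor `θ^k`, which absorbs the
factor `k` of the derivative. Hence even the series with an additional `k` converges under a first
moment only, locally uniformly in `m`. -/
theorem exists_slopeAt_le (hC : 0 ≤ C) (hm₀ : 0 < m₀) (h0 : 0 ≤ q) {a b : ℝ} (ha : 0 < a)
    (hb : b < m₀) : ∃ A : ℝ, 0 ≤ A ∧ ∀ k, ∀ m ∈ Ioo a b, slopeAt C m₀ q k m ≤ A * q k := by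
  rcases le_or_gt b a with hab | hab
  · exact ⟨0, le_rfl, fun k m hm => absurd (hm.1.trans hm.2) (not_lt.2 hab)⟩
  have hY : 0 < √(m₀ + C) := Real.sqrt_pos.2 (by linarith)
  set θ := √(b + C) / √(m₀ + C) with hθ
  have hθ0 : 0 ≤ θ := by positivity
  have hθ1 : θ < 1 := by
    rw [hθ, div_lt_one hY]; exact Real.sqrt_lt_sqrt (by linarith) (by linarith)
  have h4 : 0 < 1 - √C / √(m₀ + C) := by linarith [sqrt_ratio_lt_one hC hm₀]
  refine ⟨1 / (1 - √C / √(m₀ + C)) * (1 / (1 - θ)) * (1 / (2 * (a + C))), ?_, fun k m hm => ?_⟩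
  · have : 0 < 1 - θ := by linarith
    positivity
  · have h1 := coef_mul_pow_le hC hm₀ h0 k
    have h2 : √(m + C) ^ (k : ℕ) ≤ θ ^ (k : ℕ) * √(m₀ + C) ^ (k : ℕ) := by
      rw [← mul_pow, hθ, div_mul_cancel₀ _ hY.ne']
      have := hm.2.le
      gcongr
    have h3 := mul_pow_le_one_div hθ0 hθ1 k
    have hc := coef_nonneg (C := C) hm₀.le h0 k
    have ham : 1 / (2 * (m + C)) ≤ 1 / (2 * (a + C)) := by
      have := hm.1.le
      gcongr
    have hmC : 0 < m + C := by linarith [hm.1]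
    have hqk : 0 ≤ q k := h0 k
    calc slopeAt C m₀ q k m
        = coef C m₀ q k * √(m + C) ^ (k : ℕ) * k * (1 / (2 * (m + C))) := by
          unfold slopeAt; ring
      _ ≤ coef C m₀ q k * (θ ^ (k : ℕ) * √(m₀ + C) ^ (k : ℕ)) * k * (1 / (2 * (a + C))) := by
          gcongr
      _ = (coef C m₀ q k * √(m₀ + C) ^ (k : ℕ)) * (k * θ ^ (k : ℕ)) * (1 / (2 * (a + C))) := by ring
      _ ≤ (q k / (1 - √C / √(m₀ + C))) * (1 / (1 - θ)) * (1 / (2 * (a + C))) := by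
          gcongr
      _ = _ := by ring

theorem exists_Ioo_mem {m : ℝ} (hm : m ∈ Ioo 0 m₀) : ∃ a b, 0 < a ∧ b < m₀ ∧ m ∈ Ioo a b :=
  ⟨m / 2, (m + m₀) / 2, by linarith [hm.1], by linarith [hm.2], by linarith [hm.1],
    by linarith [hm.2]⟩

theorem summable_coef_gap (hp : IsDegreeLaw p) (h0 : 0 ≤ q) (hq : q ≤ p) (hC : 0 ≤ C)
    (hm₀ : 0 < m₀) {m : ℝ} (hm : m ∈ Icc 0 m₀) :
    Summable fun k : ℕ+ => coef C m₀ q k * gap C m k :=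
  Summable.of_nonneg_of_le
    (fun k => mul_nonneg (coef_nonneg hm₀.le h0 k) (gap_nonneg hm.1 _))
    (fun k => coef_mul_gap_le hC hm₀ h0 hm.2 k) (hp.summable_of_le h0 hq)

/-- `∑_k c_k gap C m k`, the vertex mass that remains to be explored. -/
def remaining (C m₀ : ℝ) (q : DegSeq) (m : ℝ) : ℝ := ∑' k : ℕ+, coef C m₀ q k * gap C m k

theorem continuousOn_remaining (hp : IsDegreeLaw p) (h0 : 0 ≤ q) (hq : q ≤ p) (hC : 0 ≤ C)
    (hm₀ : 0 < m₀) : ContinuousOn (remaining C m₀ q) (Icc 0 m₀) := by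
  refine continuousOn_tsum (fun k => ((continuous_gap C k).const_mul _).continuousOn)
    (hp.summable_of_le h0 hq) fun k m hm => ?_
  rw [Real.norm_of_nonneg (mul_nonneg (coef_nonneg hm₀.le h0 k) (gap_nonneg hm.1 _))]
  exact coef_mul_gap_le hC hm₀ h0 hm.2 k

theorem continuousOn_active (hp : IsDegreeLaw p) (h0 : 0 ≤ q) (hq : q ≤ p) (hC : 0 ≤ C)
    (hm₀ : 0 < m₀) : ContinuousOn (active C m₀ q) (Icc 0 m₀) := by
  refine (by fun_prop : ContinuousOn (fun m : ℝ => 2 * m) (Icc 0 m₀)).sub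
    (continuousOn_tsum (fun k => (((continuous_gap C k).const_mul _).const_mul _).continuousOn)
    (hp.summable_mul_of_le h0 hq) fun k m hm => ?_)
  rw [Real.norm_of_nonneg (mul_nonneg (by positivity)
    (mul_nonneg (coef_nonneg hm₀.le h0 k) (gap_nonneg hm.1 _)))]
  exact mul_le_mul_of_nonneg_left (coef_mul_gap_le hC hm₀ h0 hm.2 k) (by positivity)

theorem hasDerivAt_coef_gap {m : ℝ} (h : 0 < m + C) (k : ℕ+) :
    HasDerivAt (fun m => coef C m₀ q k * gap C m k) (slopeAt C m₀ q k m) m :=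
  (hasDerivAt_gap h k).const_mul _

theorem hasDerivAt_remaining (hp : IsDegreeLaw p) (h0 : 0 ≤ q) (hq : q ≤ p) (hC : 0 ≤ C)
    (hm₀ : 0 < m₀) {m : ℝ} (hm : m ∈ Ioo 0 m₀) :
    HasDerivAt (remaining C m₀ q) (∑' k, slopeAt C m₀ q k m) m := by
  obtain ⟨a, b, ha, hb, hab⟩ := exists_Ioo_mem hm
  obtain ⟨A, hA, hle⟩ := exists_slopeAt_le hC hm₀ h0 ha hb
  refine hasDerivAt_tsum_of_isPreconnected ((hp.summable_of_le h0 hq).mul_left A) isOpen_Ioo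
    isPreconnected_Ioo (fun k y hy => hasDerivAt_coef_gap (by linarith [hy.1]) k)
    (fun k y hy => ?_) hab (summable_coef_gap hp h0 hq hC hm₀ (Ioo_subset_Icc_self hm)) hab
  rw [Real.norm_of_nonneg (slopeAt_nonneg hm₀.le (by linarith [hy.1]) h0 k)]
  exact hle k y hy

theorem summable_mul_slopeAt (hp : IsDegreeLaw p) (h0 : 0 ≤ q) (hq : q ≤ p) (hC : 0 ≤ C)
    (hm₀ : 0 < m₀) {m : ℝ} (hm : m ∈ Ioo 0 m₀) :
    Summable fun k : ℕ+ => (k : ℝ) * slopeAt C m₀ q k m := by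
  obtain ⟨a, b, ha, hb, hab⟩ := exists_Ioo_mem hm
  obtain ⟨A, hA, hle⟩ := exists_slopeAt_le hC hm₀ h0 ha hb
  refine Summable.of_nonneg_of_le (fun k => mul_nonneg (by positivity)
    (slopeAt_nonneg hm₀.le (by linarith [hm.1]) h0 k)) (fun k => ?_)
    ((hp.summable_mul_of_le h0 hq).mul_left A)
  calc (k : ℝ) * slopeAt C m₀ q k m ≤ k * (A * q k) :=
        mul_le_mul_of_nonneg_left (hle k m hab) (by positivity)
    _ = _ := by ring

theorem hasDerivAt_active (hp : IsDegreeLaw p) (h0 : 0 ≤ q) (hq : q ≤ p) (hC : 0 ≤ C)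
    (hm₀ : 0 < m₀) {m : ℝ} (hm : m ∈ Ioo 0 m₀) :
    HasDerivAt (active C m₀ q) (2 - ∑' k : ℕ+, (k : ℝ) * slopeAt C m₀ q k m) m := by
  obtain ⟨a, b, ha, hb, hab⟩ := exists_Ioo_mem hm
  obtain ⟨A, hA, hle⟩ := exists_slopeAt_le hC hm₀ h0 ha hb
  have h2 : HasDerivAt (fun m : ℝ => 2 * m) 2 m := by
    simpa using (hasDerivAt_id m).const_mul (2 : ℝ)
  refine h2.sub (hasDerivAt_tsum_of_isPreconnected
    ((hp.summable_mul_of_le h0 hq).mul_left A) isOpen_Ioo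
    isPreconnected_Ioo (fun k y hy => (hasDerivAt_coef_gap (by linarith [hy.1]) k).const_mul _)
    (fun k y hy => ?_) hab (summable_mul_coef_gap hp h0 hq hC hm₀ (Ioo_subset_Icc_self hm)) hab)
  rw [Real.norm_of_nonneg (mul_nonneg (by positivity)
    (slopeAt_nonneg hm₀.le (by linarith [hy.1]) h0 k))]
  calc (k : ℝ) * slopeAt C m₀ q k y ≤ k * (A * q k) :=
        mul_le_mul_of_nonneg_left (hle k y hy) (by positivity)
    _ = _ := by ring

/-- The entropy part of the cost-to-go. -/
def entropyPart (q qbar : DegSeq) (C m₀ : ℝ) (k : ℕ+) (m : ℝ) : ℝ :=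
  coef C m₀ q k * gap C m k * Real.log (coef C m₀ q k)
    - profile (qbar - q) C m₀ q k m * Real.log (profile (qbar - q) C m₀ q k m)

theorem profile_nonneg (hm₀ : 0 < m₀) (h0 : 0 ≤ q) (hqb : q ≤ qbar) {m : ℝ} (hm : 0 ≤ m)
    (k : ℕ+) : 0 ≤ profile (qbar - q) C m₀ q k m :=
  add_nonneg (sub_nonneg.2 (hqb k)) (mul_nonneg (coef_nonneg hm₀.le h0 k) (gap_nonneg hm _))

theorem profile_le_right (hC : 0 ≤ C) (hm₀ : 0 < m₀) (h0 : 0 ≤ q) {m : ℝ}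
    (hm : m ≤ m₀) (k : ℕ+) : profile (qbar - q) C m₀ q k m ≤ qbar k := by
  have := coef_mul_gap_le hC hm₀ h0 hm k
  simp only [profile, Pi.sub_apply]
  linarith

theorem entropyPart_bound (hp : IsDegreeLaw p) (h0 : 0 ≤ q) (hqb : q ≤ qbar) (hb : qbar ≤ p)
    (hC : 0 ≤ C) (hm₀ : 0 < m₀) {m : ℝ} (hm : m ∈ Icc 0 m₀) (k : ℕ+) :
    ‖entropyPart q qbar C m₀ k m‖ ≤ q k * |Real.log (coef C m₀ q k)|
      + ((k : ℝ) * p k + Real.exp (-(k : ℝ))) := by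
  refine (abs_sub _ _).trans (add_le_add ?_ ?_)
  · rw [abs_mul, abs_of_nonneg (mul_nonneg (coef_nonneg hm₀.le h0 k) (gap_nonneg hm.1 _))]
    exact mul_le_mul_of_nonneg_right (coef_mul_gap_le hC hm₀ h0 hm.2 k) (abs_nonneg _)
  · exact hp.abs_mul_log_le (profile_nonneg hm₀ h0 hqb hm.1 k)
      ((profile_le_right hC hm₀ h0 hm.2 k).trans (hb k))

theorem summable_entropy_bound (hp : IsDegreeLaw p) (h0 : 0 ≤ q) (hq : q ≤ p)
    (hC : 0 ≤ C) (hm₀ : 0 < m₀) :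
    Summable fun k : ℕ+ => q k * |Real.log (coef C m₀ q k)|
      + ((k : ℝ) * p k + Real.exp (-(k : ℝ))) :=
  (hp.summable_mul_abs_log_coef h0 hq hC hm₀).add hp.summable_bound

theorem continuousOn_entropy (hp : IsDegreeLaw p) (h0 : 0 ≤ q) (hqb : q ≤ qbar) (hb : qbar ≤ p)
    (hC : 0 ≤ C) (hm₀ : 0 < m₀) :
    ContinuousOn (fun m => ∑' k, entropyPart q qbar C m₀ k m) (Icc 0 m₀) := by
  refine continuousOn_tsum (fun k => Continuous.continuousOn ?_)
    (summable_entropy_bound hp h0 (hqb.trans hb) hC hm₀)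
    fun k m hm => entropyPart_bound hp h0 hqb hb hC hm₀ hm k
  have h1 : Continuous fun m => profile (qbar - q) C m₀ q k m :=
    continuous_const.add ((continuous_gap C k).const_mul _)
  exact (((continuous_gap C k).const_mul _).mul continuous_const).sub
    (Real.continuous_mul_log.comp h1)

/-- The derivative of `entropyPart`. -/
def entropySlope (q qbar : DegSeq) (C m₀ : ℝ) (k : ℕ+) (m : ℝ) : ℝ :=
  slopeAt C m₀ q k m * (Real.log (coef C m₀ q k)
    - Real.log (profile (qbar - q) C m₀ q k m) - 1)

theorem profile_pos (hC : 0 ≤ C) (hm₀ : 0 < m₀) (hqb : q ≤ qbar) {m : ℝ} (hm : 0 < m)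
    {k : ℕ+} (hk : 0 < q k) : 0 < profile (qbar - q) C m₀ q k m :=
  add_pos_of_nonneg_of_pos (sub_nonneg.2 (hqb k)) (mul_pos (coef_pos hC hm₀ hk) (gap_pos hC hm k))

theorem hasDerivAt_entropyPart (hC : 0 ≤ C) (hm₀ : 0 < m₀) (h0 : 0 ≤ q) (hqb : q ≤ qbar) {m : ℝ}
    (hm : 0 < m) (k : ℕ+) :
    HasDerivAt (entropyPart q qbar C m₀ k) (entropySlope q qbar C m₀ k m) m := by
  rcases (h0 k).eq_or_lt with hk | hk
  · have h1 : entropyPart q qbar C m₀ k = fun _ => -((qbar - q) k * Real.log ((qbar - q) k)) := by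
      funext m
      simp [entropyPart, profile, coef_eq_zero hk.symm]
    rw [h1, entropySlope, slopeAt, coef_eq_zero hk.symm, zero_mul, zero_mul]
    exact hasDerivAt_const _ _
  · have hpos := profile_pos hC hm₀ hqb hm hk
    have hmC : 0 < m + C := by linarith
    have d1 := hasDerivAt_coef_gap (q := q) (m₀ := m₀) hmC k
    have d2 := hasDerivAt_profile (qbar - q) m₀ q k hmC
    refine ((d1.mul_const (Real.log (coef C m₀ q k))).sub
      (d2.mul (d2.log hpos.ne'))).congr_deriv ?_
    rw [entropySlope, mul_div_cancel₀ _ hpos.ne']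
    ring

/-- On `(a, b)` the profile lies between `c_k * gap C a k` and `1`, so its logarithm is at most
`|log c_k|` plus a multiple of `k`. The slope supplies a factor `q k`, which makes the product
summable. -/
theorem exists_entropySlope_bound (hp : IsDegreeLaw p) (h0 : 0 ≤ q) (hqb : q ≤ qbar) (hb : qbar ≤ p)
    (hC : 0 ≤ C) (hm₀ : 0 < m₀) {a b : ℝ} (ha : 0 < a) (hbm : b < m₀) :
    ∃ B : ℕ+ → ℝ, Summable B ∧ ∀ k, ∀ m ∈ Ioo a b, ‖entropySlope q qbar C m₀ k m‖ ≤ B k := by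
  have hq := hqb.trans hb
  obtain ⟨A, hA, hle⟩ := exists_slopeAt_le hC hm₀ h0 ha hbm
  obtain ⟨κ, hκ, hg⟩ := exists_abs_log_gap_le hC ha
  refine ⟨fun k => A * (2 * (q k * |Real.log (coef C m₀ q k)|) + κ * (k * q k) + q k),
    ((((hp.summable_mul_abs_log_coef h0 hq hC hm₀).mul_left 2).add
      ((hp.summable_mul_of_le h0 hq).mul_left κ)).add (hp.summable_of_le h0 hq)).mul_left A,
    fun k m hm => ?_⟩
  have hqk : 0 ≤ q k := h0 k
  rcases (h0 k).eq_or_lt with hk | hk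
  · simp only [Pi.zero_apply] at hk
    simp [entropySlope, slopeAt, coef_eq_zero hk.symm, ← hk]
  · simp only [Pi.zero_apply] at hk
    have hm0 : 0 < m := ha.trans hm.1
    have hpos := profile_pos hC hm₀ hqb hm0 hk
    have hc := coef_pos hC hm₀ hk
    have h1 : profile (qbar - q) C m₀ q k m ≤ 1 :=
      (profile_le_right hC hm₀ h0 (hm.2.trans hbm).le k).trans ((hb k).trans (hp.le_one k))
    have h2 : coef C m₀ q k * gap C a k ≤ profile (qbar - q) C m₀ q k m := by
      have h3 : coef C m₀ q k * gap C a k ≤ coef C m₀ q k * gap C m k :=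
        mul_le_mul_of_nonneg_left (gap_mono hm.1.le _) hc.le
      have h4 : 0 ≤ (qbar - q) k := sub_nonneg.2 (hqb k)
      unfold profile
      linarith
    have h3 : |Real.log (profile (qbar - q) C m₀ q k m)|
        ≤ |Real.log (coef C m₀ q k)| + κ * k := by
      have h4 := abs_log_le_of_mem_Icc (mul_pos hc (gap_pos hC ha k)) le_rfl h2 h1
      rw [Real.log_one, add_zero, Real.log_mul hc.ne' (gap_pos hC ha k).ne'] at h4
      exact h4.trans ((abs_add_le _ _).trans (add_le_add le_rfl (hg k)))
    have h5 : |Real.log (coef C m₀ q k) - Real.log (profile (qbar - q) C m₀ q k m) - 1|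
        ≤ 2 * |Real.log (coef C m₀ q k)| + κ * k + 1 := by
      have e1 := abs_sub (Real.log (coef C m₀ q k) - Real.log (profile (qbar - q) C m₀ q k m)) 1
      have e2 := abs_sub (Real.log (coef C m₀ q k)) (Real.log (profile (qbar - q) C m₀ q k m))
      rw [abs_one] at e1
      linarith
    have h6 := slopeAt_nonneg (C := C) hm₀.le (by linarith : 0 ≤ m + C) h0 k
    rw [entropySlope, norm_mul, Real.norm_of_nonneg h6]
    calc slopeAt C m₀ q k m * ‖Real.log (coef C m₀ q k)
          - Real.log (profile (qbar - q) C m₀ q k m) - 1‖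
        ≤ A * q k * (2 * |Real.log (coef C m₀ q k)| + κ * k + 1) :=
          mul_le_mul (hle k m hm) h5 (norm_nonneg _) (by positivity)
      _ = _ := by ring

theorem summable_entropySlope (hp : IsDegreeLaw p) (h0 : 0 ≤ q) (hqb : q ≤ qbar) (hb : qbar ≤ p)
    (hC : 0 ≤ C) (hm₀ : 0 < m₀) {m : ℝ} (hm : m ∈ Ioo 0 m₀) :
    Summable fun k => entropySlope q qbar C m₀ k m := by
  obtain ⟨a, b, ha, hbm, hab⟩ := exists_Ioo_mem hm
  obtain ⟨B, hB, hle⟩ := exists_entropySlope_bound hp h0 hqb hb hC hm₀ ha hbm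
  exact Summable.of_norm_bounded hB fun k => hle k m hab

theorem hasDerivAt_entropy (hp : IsDegreeLaw p) (h0 : 0 ≤ q) (hqb : q ≤ qbar) (hb : qbar ≤ p)
    (hC : 0 ≤ C) (hm₀ : 0 < m₀) {m : ℝ} (hm : m ∈ Ioo 0 m₀) :
    HasDerivAt (fun m => ∑' k, entropyPart q qbar C m₀ k m)
      (∑' k, entropySlope q qbar C m₀ k m) m := by
  obtain ⟨a, b, ha, hbm, hab⟩ := exists_Ioo_mem hm
  obtain ⟨B, hB, hle⟩ := exists_entropySlope_bound hp h0 hqb hb hC hm₀ ha hbm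
  refine hasDerivAt_tsum_of_isPreconnected hB isOpen_Ioo isPreconnected_Ioo
    (fun k y hy => hasDerivAt_entropyPart hC hm₀ h0 hqb (ha.trans hy.1) k) hle hab ?_ hab
  exact Summable.of_norm_bounded (summable_entropy_bound hp h0 (hqb.trans hb) hC hm₀)
    fun k => entropyPart_bound hp h0 hqb hb hC hm₀ (Ioo_subset_Icc_self hm) k

end Optimal

/-! ### The cost along the optimal path -/

section Optimal

variable {p q qbar : DegSeq} {b : ℝ}

/-- The state of the optimal path when `m` remains. -/
def optState (q qbar : DegSeq) (C m₀ m : ℝ) : State :=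
  state (active C m₀ q m) fun k => profile (qbar - q) C m₀ q k m

/-- The intensities of the optimal path when `m` remains. -/
def optIntensity (q : DegSeq) (C m₀ m : ℝ) : State :=
  state (active C m₀ q m / (2 * (m + C))) fun k => slopeAt C m₀ q k m

/-- The power in the slope is `gap + C^{k/2}`. The first part sums to `2m - active` by definition,
the second to `2C` by the equation of `β`. Adding the intensity of coordinate `0` gives total rate
`1`, so the clock `m` has unit speed. -/
theorem IsBeta.hasSum_slopeAt (h : IsBeta q b) (hp : IsDegreeLaw p) (h0 : 0 ≤ q)
    (hq : q ≤ p) (hm₀ : 0 < 1 / 2 * degreeMass q) {m : ℝ}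
    (hm : m ∈ Ioc 0 (1 / 2 * degreeMass q)) :
    HasSum (fun k => slopeAt (shift q b) (1 / 2 * degreeMass q) q k m)
      (1 - active (shift q b) (1 / 2 * degreeMass q) q m / (2 * (m + shift q b))) := by
  have hC := h.shift_nonneg hm₀
  have h1 := h.hasSum_coef_mul_pow hp h0 hq hm₀
  set m₀ := 1 / 2 * degreeMass q
  set C := shift q b
  have h2 := (summable_mul_coef_gap hp h0 hq hC hm₀ (Ioc_subset_Icc_self hm)).hasSum
  have hmC : 0 < m + C := by linarith [hm.1]
  have h3 := (h2.add h1).div_const (2 * (m + C))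
  have e : (∑' k : ℕ+, (k : ℝ) * (coef C m₀ q k * gap C m k) + 2 * C) / (2 * (m + C))
      = 1 - active C m₀ q m / (2 * (m + C)) := by
    rw [active]
    field_simp
    ring
  rw [e] at h3
  refine h3.congr_fun fun k => ?_
  rw [slopeAt, gap]
  ring

theorem IsBeta.hasSum_optIntensity (h : IsBeta q b) (hp : IsDegreeLaw p) (h0 : 0 ≤ q)
    (hq : q ≤ p) (hm₀ : 0 < 1 / 2 * degreeMass q) {m : ℝ}
    (hm : m ∈ Ioc 0 (1 / 2 * degreeMass q)) :
    HasSum (optIntensity q (shift q b) (1 / 2 * degreeMass q) m) 1 := by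
  rw [hasSum_nat_iff_pnat]
  simpa [optIntensity] using h.hasSum_slopeAt hp h0 hq hm₀ hm

theorem IsBeta.hasSum_mass_optState (h : IsBeta q b) (hp : IsDegreeLaw p) (h0 : 0 ≤ q)
    (hqb : q ≤ qbar) (hb : qbar ≤ p) (hm₀ : 0 < 1 / 2 * degreeMass q) {m : ℝ}
    (hm : m ∈ Icc 0 (1 / 2 * degreeMass q)) :
    HasSum (mass (optState q qbar (shift q b) (1 / 2 * degreeMass q) m))
      (2 * (m + 1 / 2 * degreeMass (qbar - q))) := by
  have hq := hqb.trans hb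
  have hC := h.shift_nonneg hm₀
  have ha := h.active_nonneg hp h0 hq hm₀ hm
  set m₀ := 1 / 2 * degreeMass q
  set C := shift q b
  have h2 := (summable_mul_coef_gap hp h0 hq hC hm₀ hm).hasSum
  have hρ := (hp.summable_mul_of_le (sub_nonneg.2 hqb) ((sub_le_self _ h0).trans hb)).hasSum
  have h3 : HasSum (fun k : ℕ+ => (k : ℝ) * optState q qbar C m₀ m k)
      (degreeMass (qbar - q) + ∑' k : ℕ+, (k : ℝ) * (coef C m₀ q k * gap C m k)) := by
    refine (hρ.add h2).congr_fun fun k => ?_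
    simp only [optState, state_pnat, profile]
    ring
  have h4 := hasSum_mass h3
  have e : max (optState q qbar C m₀ m 0) 0
      + (degreeMass (qbar - q) + ∑' k : ℕ+, (k : ℝ) * (coef C m₀ q k * gap C m k))
      = 2 * (m + 1 / 2 * degreeMass (qbar - q)) := by
    simp only [optState, state_zero, max_eq_left ha]
    rw [active]
    ring
  rwa [e] at h4

theorem IsBeta.r_optState (h : IsBeta q b) (hp : IsDegreeLaw p) (h0 : 0 ≤ q)
    (hqb : q ≤ qbar) (hb : qbar ≤ p) (hm₀ : 0 < 1 / 2 * degreeMass q) {m : ℝ}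
    (hm : m ∈ Icc 0 (1 / 2 * degreeMass q)) :
    r (optState q qbar (shift q b) (1 / 2 * degreeMass q) m)
      = 2 * (m + 1 / 2 * degreeMass (qbar - q)) :=
  (h.hasSum_mass_optState hp h0 hqb hb hm₀ hm).tsum_eq

/-- The cost still to be paid along the optimal path, up to a constant. -/
def costToGo (q qbar : DegSeq) (C m₀ m : ℝ) : ℝ :=
  (m + 1 / 2 * degreeMass (qbar - q)) * Real.log (m + 1 / 2 * degreeMass (qbar - q))
    - active C m₀ q m * (1 / 2 * Real.log (m + C)) + ∑' k, entropyPart q qbar C m₀ k m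

/-- The derivative of `costToGo`. -/
def costSlope (q qbar : DegSeq) (C m₀ m : ℝ) : ℝ :=
  Real.log (m + 1 / 2 * degreeMass (qbar - q)) - Real.log (m + C)
    + (∑' k : ℕ+, (k : ℝ) * slopeAt C m₀ q k m) * (1 / 2 * Real.log (m + C))
    + (∑' k, entropySlope q qbar C m₀ k m + ∑' k, slopeAt C m₀ q k m)

theorem IsBeta.hasDerivAt_costToGo (h : IsBeta q b) (hp : IsDegreeLaw p) (h0 : 0 ≤ q)
    (hqb : q ≤ qbar) (hb : qbar ≤ p) (hm₀ : 0 < 1 / 2 * degreeMass q) {m : ℝ}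
    (hm : m ∈ Ioo 0 (1 / 2 * degreeMass q)) :
    HasDerivAt (costToGo q qbar (shift q b) (1 / 2 * degreeMass q))
      (costSlope q qbar (shift q b) (1 / 2 * degreeMass q) m) m := by
  have hq := hqb.trans hb
  have hC := h.shift_nonneg hm₀
  have hs := (h.hasSum_slopeAt hp h0 hq hm₀ (Ioo_subset_Ioc_self hm)).tsum_eq
  have hρ : 0 ≤ degreeMass (qbar - q) := IsExcursion.degreeMass_nonneg (sub_nonneg.2 hqb)
  set m₀ := 1 / 2 * degreeMass q
  set C := shift q b
  have hmC : 0 < m + C := by linarith [hm.1]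
  have hM : 0 < m + 1 / 2 * degreeMass (qbar - q) := by linarith [hm.1]
  have d0 := hasDerivAt_id m
  have d1 := (d0.add_const (1 / 2 * degreeMass (qbar - q)))
  have d2 := d1.log hM.ne'
  have d3 := (((d0.add_const C).log hmC.ne').const_mul (1 / 2))
  have d4 := hasDerivAt_active hp h0 hq hC hm₀ hm
  have d5 := hasDerivAt_entropy hp h0 hqb hb hC hm₀ hm
  refine (((d1.mul d2).sub (d4.mul d3)).add d5).congr_deriv ?_
  simp only [id]
  -- The leftover terms `1 - active/(2(m + C))` are the total slope by `hs`; it compensates the `-1`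
  -- inside `entropySlope`.
  rw [costSlope, hs, mul_one_div_cancel hM.ne']
  field_simp
  ring

theorem active_le {C m₀ m : ℝ} (h0 : 0 ≤ q) (hm₀ : 0 ≤ m₀) (hm : 0 ≤ m) :
    active C m₀ q m ≤ 2 * m := by
  have : 0 ≤ ∑' k : ℕ+, (k : ℝ) * (coef C m₀ q k * gap C m k) :=
    tsum_nonneg fun k => mul_nonneg (by positivity)
      (mul_nonneg (coef_nonneg hm₀ h0 k) (gap_nonneg hm _))
  unfold active
  linarith

theorem IsBeta.continuousOn_costToGo (h : IsBeta q b) (hp : IsDegreeLaw p) (h0 : 0 ≤ q)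
    (hqb : q ≤ qbar) (hb : qbar ≤ p) (hm₀ : 0 < 1 / 2 * degreeMass q) :
    ContinuousOn (costToGo q qbar (shift q b) (1 / 2 * degreeMass q))
      (Icc 0 (1 / 2 * degreeMass q)) := by
  have hq := hqb.trans hb
  have hC := h.shift_nonneg hm₀
  have hact := continuousOn_active hp h0 hq hC hm₀
  have c1 : Continuous fun m : ℝ => (m + 1 / 2 * degreeMass (qbar - q))
      * Real.log (m + 1 / 2 * degreeMass (qbar - q)) :=
    Real.continuous_mul_log.comp (continuous_id.add continuous_const)
  refine (c1.continuousOn.sub ?_).add (continuousOn_entropy hp h0 hqb hb hC hm₀)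
  intro m hm
  -- The only delicate point is `m = 0` with zero shift. There `0 ≤ active ≤ 2m`, so the product
  -- with the logarithm is squeezed by `|m log m|`.
  by_cases hne : m + shift q b = 0
  · have hm0 : m = 0 := by linarith [hm.1]
    have hC0 : shift q b = 0 := by linarith [hm.1]
    have hz : active (shift q b) (1 / 2 * degreeMass q) q 0 = 0 := active_zero _ _ _
    rw [ContinuousWithinAt, hm0, hz, zero_mul]
    have hlim : Tendsto (fun m : ℝ => |m * Real.log m|)
        (𝓝[Icc 0 (1 / 2 * degreeMass q)] 0) (𝓝 0) := by
      have : Tendsto (fun m : ℝ => |m * Real.log m|) (𝓝 0) (𝓝 |0 * Real.log 0|) :=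
        Real.continuous_mul_log.abs.tendsto 0
      simp only [zero_mul, abs_zero] at this
      exact this.mono_left nhdsWithin_le_nhds
    refine squeeze_zero_norm' ?_ hlim
    filter_upwards [self_mem_nhdsWithin] with y hy
    have a1 := h.active_nonneg hp h0 hq hm₀ hy
    have a2 := active_le (C := shift q b) h0 hm₀.le hy.1
    rw [hC0] at a1 a2 ⊢
    rw [add_zero, norm_mul, norm_mul, Real.norm_of_nonneg a1, abs_mul, abs_of_nonneg hy.1]
    have e : ‖(1 / 2 : ℝ)‖ = 1 / 2 := by norm_num
    rw [e, Real.norm_eq_abs]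
    have := mul_le_mul_of_nonneg_right a2 (abs_nonneg (Real.log y))
    linarith
  · refine (hact m hm).mul (ContinuousAt.continuousWithinAt ?_)
    exact continuousAt_const.mul ((continuousAt_id.add continuousAt_const).log hne)

theorem costToGo_zero {C m₀ : ℝ} : costToGo q qbar C m₀ 0 =
    1 / 2 * degreeMass (qbar - q) * Real.log (1 / 2 * degreeMass (qbar - q))
      - ∑' k, (qbar - q) k * Real.log ((qbar - q) k) := by
  simp only [costToGo, active_zero, entropyPart, profile, gap_zero, mul_zero, zero_mul, zero_add,
    add_zero, sub_zero, zero_sub, tsum_neg]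
  ring

/-- The active mass vanishes at both ends, which removes the term with `log (m + C)`. The entropy
series then gives the value through `tsum_mul_log_coef`. -/
theorem IsBeta.costToGo_sub (h : IsBeta q b) (hp : IsDegreeLaw p) (h0 : 0 ≤ q)
    (hqb : q ≤ qbar) (hb : qbar ≤ p) (hm₀ : 0 < 1 / 2 * degreeMass q) :
    costToGo q qbar (shift q b) (1 / 2 * degreeMass q) (1 / 2 * degreeMass q)
      - costToGo q qbar (shift q b) (1 / 2 * degreeMass q) 0
      = H q + H (qbar - q) - H qbar + excess (shift q b) q := by
  have hq := hqb.trans hb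
  have hqb0 : 0 ≤ qbar := h0.trans hqb
  have hC := h.shift_nonneg hm₀
  have hM1 : 1 / 2 * degreeMass q + 1 / 2 * degreeMass (qbar - q) = 1 / 2 * degreeMass qbar := by
    rw [degreeMass_sub (hp.summable_mul_of_le hqb0 hb) (hp.summable_mul_of_le h0 hq)]
    ring
  have hs := (tsum_mul_log_coef hp h0 hq hm₀ hC).sub (hp.summable_mul_log hqb0 hb).hasSum
  have e : ∑' k, entropyPart q qbar (shift q b) (1 / 2 * degreeMass q) k (1 / 2 * degreeMass q)
      = H q + excess (shift q b) q - ∑' k, qbar k * Real.log (qbar k) := by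
    rw [← hs.tsum_eq]
    congr 1; funext k
    simp only [entropyPart, profile, coef_mul_gap hC hm₀, Pi.sub_apply, sub_add_cancel]
  rw [costToGo_zero, costToGo, active_end hC hm₀, e, hM1, H, H, H]
  ring

theorem mul_ell_div {R u : ℝ} (h : R ≠ 0 ∨ u = 0) :
    R * ell (u / R) = u * Real.log (u / R) - u + R := by
  rcases eq_or_ne R 0 with rfl | hR
  · have : u = 0 := by simpa using h
    simp [this]
  · unfold ell
    field_simp

/-- In `∑ (u log (u/R) - u + R)` the last two series both sum to `1` and cancel. The logarithm of
intensity over rate splits into the terms of `costSlope`, so this is the cost rate of the candidate.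
-/
theorem IsBeta.hasSum_costSlope (h : IsBeta q b) (hp : IsDegreeLaw p) (h0 : 0 ≤ q)
    (hqb : q ≤ qbar) (hb : qbar ≤ p) (hm₀ : 0 < 1 / 2 * degreeMass q) {m : ℝ}
    (hm : m ∈ Ioo 0 (1 / 2 * degreeMass q)) :
    HasSum (fun k => rate (optState q qbar (shift q b) (1 / 2 * degreeMass q) m) k
        * ell (optIntensity q (shift q b) (1 / 2 * degreeMass q) m k
          / rate (optState q qbar (shift q b) (1 / 2 * degreeMass q) m) k))
      (costSlope q qbar (shift q b) (1 / 2 * degreeMass q) m) := by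
  have hq := hqb.trans hb
  have hC := h.shift_nonneg hm₀
  have hmI := Ioo_subset_Icc_self hm
  have hmass := h.hasSum_mass_optState hp h0 hqb hb hm₀ hmI
  have hr := h.r_optState hp h0 hqb hb hm₀ hmI
  have hsl := h.hasSum_slopeAt hp h0 hq hm₀ (Ioo_subset_Ioc_self hm)
  have hint := h.hasSum_optIntensity hp h0 hq hm₀ (Ioo_subset_Ioc_self hm)
  have ha := h.active_nonneg hp h0 hq hm₀ hmI
  have hρ : 0 ≤ degreeMass (qbar - q) := IsExcursion.degreeMass_nonneg (sub_nonneg.2 hqb)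
  set m₀ := 1 / 2 * degreeMass q
  set C := shift q b
  set X := optState q qbar C m₀ m with hX
  set M := m + 1 / 2 * degreeMass (qbar - q) with hMdef
  have hM : 0 < M := by linarith [hm.1]
  have hmC : 0 < m + C := by linarith [hm.1]
  have hR : HasSum (rate X) 1 := by
    have := hmass.div_const (2 * M)
    rw [div_self (by positivity), ← hr] at this
    exact this
  have hks := (summable_mul_slopeAt hp h0 hq hC hm₀ hm).hasSum
  have hes := (summable_entropySlope hp h0 hqb hb hC hm₀ hm).hasSum
  have key : HasSum (fun k => optIntensity q C m₀ m k * Real.log (optIntensity q C m₀ m k / rate X k))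
      (costSlope q qbar C m₀ m) := by
    rw [hasSum_nat_iff_pnat]
    have a1 := ((hsl.mul_right (Real.log M - Real.log (m + C))).add
      (hks.mul_right (1 / 2 * Real.log (m + C)))).add (hes.add hsl)
    have e0 : optIntensity q C m₀ m 0 * Real.log (optIntensity q C m₀ m 0 / rate X 0)
        = active C m₀ q m / (2 * (m + C)) * (Real.log M - Real.log (m + C)) := by
      rw [rate, hr, mass_zero, optIntensity, hX, optState, state_zero, state_zero, max_eq_left ha]
      rcases ha.eq_or_lt with h1 | h1
      · rw [← h1]; simp
      · congr 1
        rw [← Real.log_div hM.ne' hmC.ne']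
        congr 1
        field_simp
    have e : (1 - active C m₀ q m / (2 * (m + C))) * (Real.log M - Real.log (m + C))
        + (∑' k : ℕ+, (k : ℝ) * slopeAt C m₀ q k m) * (1 / 2 * Real.log (m + C))
        + (∑' k, entropySlope q qbar C m₀ k m + (1 - active C m₀ q m / (2 * (m + C))))
        = costSlope q qbar C m₀ m
          - optIntensity q C m₀ m 0 * Real.log (optIntensity q C m₀ m 0 / rate X 0) := by
      rw [e0, costSlope, hsl.tsum_eq, ← hMdef]
      ring
    rw [e] at a1
    refine a1.congr_fun fun k => ?_
    rw [rate, hr, mass_pnat, optIntensity, hX, optState, state_pnat, state_pnat]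
    rcases (h0 k).eq_or_lt with hk | hk
    · simp [entropySlope, slopeAt, coef_eq_zero hk.symm]
    · have b1 := coef_pos hC hm₀ hk
      have b2 := profile_pos hC hm₀ hqb hm.1 hk
      have b3 : 0 < √(m + C) := Real.sqrt_pos.2 hmC
      have b4 : (0 : ℝ) < k := by positivity
      have e1 : slopeAt C m₀ q k m / (k * profile (qbar - q) C m₀ q k m / (2 * M))
          = M / (m + C) * (coef C m₀ q k * √(m + C) ^ (k : ℕ) / profile (qbar - q) C m₀ q k m) := by
        rw [slopeAt]
        field_simp
      have e2 : Real.log (slopeAt C m₀ q k m / (k * profile (qbar - q) C m₀ q k m / (2 * M)))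
          = Real.log M - Real.log (m + C) + (Real.log (coef C m₀ q k)
            + k * (1 / 2 * Real.log (m + C)) - Real.log (profile (qbar - q) C m₀ q k m)) := by
        rw [e1, Real.log_mul (by positivity) (by positivity), Real.log_div hM.ne' hmC.ne',
          Real.log_div (by positivity) b2.ne', Real.log_mul b1.ne' (by positivity), Real.log_pow,
          Real.log_sqrt hmC.le]
        ring
      rw [e2, entropySlope]
      ring
  have hfin := (key.sub hint).add hR
  rw [sub_add_cancel] at hfin
  refine hfin.congr_fun fun k => mul_ell_div ?_
  by_cases hRk : rate X k = 0
  · right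
    rw [rate, hr, div_eq_zero_iff, or_iff_left (by positivity)] at hRk
    rcases Nat.eq_zero_or_pos k with rfl | hk
    · rw [mass_zero, hX, optState, state_zero, max_eq_left ha] at hRk
      rw [optIntensity, state_zero, hRk, zero_div]
    · lift k to ℕ+ using hk
      rw [mass_pnat, hX, optState, state_pnat, mul_eq_zero, or_iff_right (by positivity)] at hRk
      rw [optIntensity, state_pnat]
      rcases (h0 k).eq_or_lt with hk | hk
      · simp [slopeAt, coef_eq_zero hk.symm]
      · exact absurd hRk (profile_pos hC hm₀ hqb hm.1 hk).ne'
  · exact Or.inl hRk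

end Optimal

/-! ### Concatenation of a path with an excursion -/

theorem _root_.AbsolutelyContinuousOnInterval.congr {f g : ℝ → ℝ} {a b : ℝ}
    (hf : AbsolutelyContinuousOnInterval f a b) (h : EqOn g f (uIcc a b)) :
    AbsolutelyContinuousOnInterval g a b := by
  rw [absolutelyContinuousOnInterval_iff] at hf ⊢
  intro ε hε
  obtain ⟨δ, hδ, H⟩ := hf ε hε
  refine ⟨δ, hδ, fun E hE hE' => ?_⟩
  refine lt_of_eq_of_lt (Finset.sum_congr rfl fun i hi => ?_) (H E hE hE')
  rw [h (hE.1 i hi).1, h (hE.1 i hi).2]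

/-- On each piece the function is the primitive of its derivative, so on the union it is the
primitive of one integrable function. -/
theorem _root_.AbsolutelyContinuousOnInterval.trans {f : ℝ → ℝ} {a b c : ℝ} (hab : a ≤ b)
    (hbc : b ≤ c) (h1 : AbsolutelyContinuousOnInterval f a b)
    (h2 : AbsolutelyContinuousOnInterval f b c) : AbsolutelyContinuousOnInterval f a c := by
  have hI := h1.intervalIntegrable_deriv.trans h2.intervalIntegrable_deriv
  have h3 := hI.absolutelyContinuousOnInterval_intervalIntegral (c := a) left_mem_uIcc
  have h4 : AbsolutelyContinuousOnInterval (fun _ : ℝ => f a) a c :=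
    (LipschitzWith.const _).lipschitzOnWith.absolutelyContinuousOnInterval
  refine (h4.add h3).congr fun t ht => ?_
  rw [uIcc_of_le (hab.trans hbc)] at ht
  simp only [Pi.add_apply]
  rcases le_total t b with h | h
  · rw [(h1.mono (uIcc_subset_uIcc left_mem_uIcc
      (by rw [uIcc_of_le hab]; exact ⟨ht.1, h⟩))).integral_deriv_eq_sub]
    ring
  · have h5 := h2.mono (uIcc_subset_uIcc left_mem_uIcc
      (by rw [uIcc_of_le hbc]; exact ⟨h, ht.2⟩ : t ∈ uIcc b c))
    rw [← intervalIntegral.integral_add_adjacent_intervals h1.intervalIntegrable_deriv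
      h5.intervalIntegrable_deriv, h1.integral_deriv_eq_sub, h5.integral_deriv_eq_sub]
    ring

/-- The function that follows `f` up to time `t₁` and `g` afterwards. -/
def concat {α : Type*} (t₁ : ℝ) (f g : ℝ → α) (t : ℝ) : α := if t ≤ t₁ then f t else g t

theorem concat_left {α : Type*} {t₁ t : ℝ} (f g : ℝ → α) (h : t ≤ t₁) : concat t₁ f g t = f t :=
  if_pos h

theorem concat_right {α : Type*} {t₁ t : ℝ} {f g : ℝ → α} (hfg : f t₁ = g t₁) (h : t₁ ≤ t) :
    concat t₁ f g t = g t := by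
  rcases h.eq_or_lt with rfl | h
  · rw [concat_left _ _ le_rfl, hfg]
  · exact if_neg (not_le.2 h)

theorem _root_.AbsolutelyContinuousOnInterval.concat {f g : ℝ → ℝ} {a b c : ℝ} (hab : a ≤ b)
    (hbc : b ≤ c) (hf : AbsolutelyContinuousOnInterval f a b)
    (hg : AbsolutelyContinuousOnInterval g b c) (h : f b = g b) :
    AbsolutelyContinuousOnInterval (ConfigModel.concat b f g) a c := by
  refine AbsolutelyContinuousOnInterval.trans hab hbc (hf.congr fun t ht => ?_)
    (hg.congr fun t ht => ?_)
  · rw [uIcc_of_le hab] at ht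
    exact concat_left _ _ ht.2
  · rw [uIcc_of_le hbc] at ht
    exact concat_right h ht.1

/-- The control that follows `φ₀` up to time `t₁` and then drives with intensities `u` a path whose
rates are `R`. -/
def concatControl (t₁ : ℝ) (φ₀ : ℕ → ℝ × ℝ → ℝ≥0) (R u : ℕ → ℝ → ℝ) (k : ℕ) (z : ℝ × ℝ) : ℝ≥0 :=
  if z.1 ≤ t₁ then φ₀ k z else if z.2 < R k z.1 then (u k z.1 / R k z.1).toNNReal else 1

theorem measurable_concatControl {t₁ : ℝ} {φ₀ : ℕ → ℝ × ℝ → ℝ≥0} {R u : ℕ → ℝ → ℝ} {k : ℕ}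
    (hφ : Measurable (φ₀ k)) (hR : Measurable (R k)) (hu : Measurable (u k)) :
    Measurable (concatControl t₁ φ₀ R u k) := by
  unfold concatControl
  refine Measurable.ite (measurableSet_le measurable_fst measurable_const) hφ
    (Measurable.ite (measurableSet_lt measurable_snd (hR.comp measurable_fst)) ?_ measurable_const)
  exact ((hu.comp measurable_fst).div (hR.comp measurable_fst)).real_toNNReal

theorem Icc_inter_lt {R : ℝ} (hR1 : R ≤ 1) : Icc (0 : ℝ) 1 ∩ {y | y < R} = Ico 0 R := by
  ext y
  simp only [mem_inter_iff, mem_Icc, mem_ofPred_eq, mem_Ico]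
  constructor
  · rintro ⟨⟨a, b⟩, c⟩; exact ⟨a, c⟩
  · rintro ⟨a, b⟩; exact ⟨⟨a, by linarith⟩, b⟩

section Concat

variable {p q qbar : DegSeq} {t₁ t₂ : ℝ} {x : ℝ → State} {R u : ℕ → ℝ → ℝ}
  {γ : (ℝ → State) × (ℝ → ℝ)} {φ₀ : ℕ → ℝ × ℝ → ℝ≥0}

theorem IsExcursion.start_eq (h : IsExcursion qbar q t₁ t₂ x u) : x t₁ = state 0 qbar := by
  refine state_ext ?_ fun k => ?_
  · have := h.zero_eq t₁ ⟨le_rfl, h.le⟩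
    simp only [intervalIntegral.integral_same, mul_zero] at this
    rw [state_zero, this.unique hasSum_zero]
  · rw [h.pnat_eq k t₁ ⟨le_rfl, h.le⟩, intervalIntegral.integral_same, sub_zero, state_pnat]

theorem IsExcursion.antitoneOn (h : IsExcursion qbar q t₁ t₂ x u) (k : ℕ+) :
    AntitoneOn (fun t => x t k) (Icc t₁ t₂) := by
  intro a ha b hb hab
  have hi : ∀ {s}, s ∈ Icc t₁ t₂ → IntervalIntegrable (u k) volume t₁ s := fun hs =>
    (h.integrable k).mono_set (uIcc_subset_uIcc left_mem_uIcc (by rwa [uIcc_of_le h.le]))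
  have := intervalIntegral.integral_interval_sub_left (hi hb) (hi ha)
  have h2 := intervalIntegral.integral_nonneg (μ := volume) hab fun s _ => h.nonneg k s
  simp only [h.pnat_eq k a ha, h.pnat_eq k b hb]
  linarith

/-- The appended piece starts with zero active mass and keeps it nonnegative, so the driving
function stays above its value at `t₁` and no new reflection occurs. Nonnegativity of the other
coordinates follows from monotonicity and the terminal value `qbar - q ≥ 0`. -/
theorem isPath_concat (hp : IsDegreeLaw p) (h0 : 0 ≤ q) (hqb : q ≤ qbar) (hb : qbar ≤ p)
    (ht : 0 ≤ t₁) (hγ : γ ∈ J0 p 0 t₁ (state 0 p) (state 0 qbar))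
    (hx : IsExcursion qbar q t₁ t₂ x u) :
    IsPath p t₂ (concat t₁ γ.1 x) (concat t₁ γ.2 fun t => γ.2 t₁ + x t 0) := by
  obtain ⟨hpath, -, hend⟩ := hγ
  have hs : γ.1 t₁ = x t₁ := hend.trans hx.start_eq.symm
  have hs2 : γ.2 t₁ = γ.2 t₁ + x t₁ 0 := by rw [hx.start_eq, state_zero, add_zero]
  have hcoord : ∀ k : ℕ+, (fun t => concat t₁ γ.1 x t k)
      = concat t₁ (fun t => γ.1 t k) fun t => x t k := by
    intro k; funext t; unfold concat; split_ifs <;> rfl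
  have hψ : AbsolutelyContinuousOnInterval (concat t₁ γ.2 fun t => γ.2 t₁ + x t 0) 0 t₂ := by
    refine AbsolutelyContinuousOnInterval.concat ht hx.le hpath.psi_ac ?_ hs2
    have h4 : AbsolutelyContinuousOnInterval (fun _ : ℝ => γ.2 t₁) t₁ t₂ :=
      (LipschitzWith.const _).lipschitzOnWith.absolutelyContinuousOnInterval
    exact h4.add (hx.zero_ac hp h0 (hqb.trans hb))
  have hanti : ∀ k : ℕ+, AntitoneOn (fun t => concat t₁ γ.1 x t k) (Icc 0 t₂) := by
    intro k
    rw [← Icc_union_Icc_eq_Icc ht hx.le]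
    refine AntitoneOn.union_right (c := t₁) ?_ ?_ (isGreatest_Icc ht) (isLeast_Icc hx.le)
    · refine (hpath.zeta_anti k).congr fun t ht => ?_
      simp only [concat_left _ _ ht.2]
    · refine (hx.antitoneOn k).congr fun t ht => ?_
      simp only [concat_right hs ht.1]
  have hsk : ∀ t ≤ t₁, skorokhod (concat t₁ γ.2 fun t => γ.2 t₁ + x t 0) t = skorokhod γ.2 t := by
    intro t ht
    unfold skorokhod
    rw [concat_left _ _ ht]
    congr 3
    refine image_congr fun s hs => ?_
    exact concat_left _ _ (hs.2.trans ht)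
  refine ⟨?_, hψ, fun t htt => ?_, fun k => ?_, hanti, fun k => ?_, fun k t htt => ?_⟩
  · rw [concat_left _ _ ht, hpath.psi_zero]
  · rcases le_total t t₁ with h | h
    · rw [hsk t h, concat_left _ _ h, hpath.zeta_zero t ⟨htt.1, h⟩]
    · have hcont := hψ.continuousOn
      rw [uIcc_of_le (ht.trans hx.le)] at hcont
      rw [skorokhod_eq_sub ht h, concat_right hs h, concat_right hs2 h, concat_left _ _ le_rfl]
      · ring
      · exact (isCompact_Icc.image_of_continuousOn
          (hcont.mono (Icc_subset_Icc_right htt.2))).bddBelow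
      · rw [hsk t₁ le_rfl, ← hpath.zeta_zero t₁ ⟨ht, le_rfl⟩, hend, state_zero]
      · intro s hs'
        rw [concat_left _ _ le_rfl, concat_right hs2 hs'.1]
        linarith [hx.zero_nonneg s ⟨hs'.1, hs'.2.trans htt.2⟩]
  · rw [concat_left _ _ ht, hpath.zeta_init]
  · rw [hcoord]
    exact AbsolutelyContinuousOnInterval.concat ht hx.le (hpath.zeta_ac k) (hx.coord_ac k)
      (by rw [hs])
  · have h1 := hanti k htt ⟨ht.trans hx.le, le_rfl⟩ htt.2
    simp only [concat_right hs hx.le, hx.end_eq, state_pnat] at h1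
    exact (sub_nonneg.2 (hqb k)).trans h1

theorem thinned_concat_right {k : ℕ} {s y : ℝ} (hs : t₁ < s) (hR : rate (x s) k = R k s)
    (hR0 : 0 ≤ R k s) (hu : 0 ≤ u k s) :
    thinned (concat t₁ γ.1 x) (concatControl t₁ φ₀ R u) k (s, y)
      = indicator {y | y < R k s} (fun _ => u k s / R k s) y := by
  have h1 : concat t₁ γ.1 x s = x s := if_neg (not_le.2 hs)
  unfold thinned
  by_cases hy : y < R k s
  · rw [indicator_of_mem (by simpa [h1, hR] using hy), indicator_of_mem (by simpa using hy),
      concatControl, if_neg (not_le.2 hs), if_pos hy, Real.coe_toNNReal _ (div_nonneg hu hR0)]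
  · rw [indicator_of_notMem (by simpa [h1, hR] using hy), indicator_of_notMem (by simpa using hy)]

theorem integral_thinned_section {R u : ℝ} (hR0 : 0 ≤ R) (hR1 : R ≤ 1) (h : R = 0 → u = 0) :
    ∫ y in Icc (0 : ℝ) 1, indicator {y | y < R} (fun _ => u / R) y = u := by
  have hm : MeasurableSet {y : ℝ | y < R} := measurableSet_Iio
  rw [setIntegral_indicator hm, Icc_inter_lt hR1]
  simp only [integral_const, MeasurableSet.univ, measureReal_restrict_apply, univ_inter,
    Real.volume_real_Ico_of_le hR0, sub_zero, smul_eq_mul]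
  rcases eq_or_ne R 0 with h' | h'
  · rw [h h', h', zero_mul]
  · field_simp

/-- Outside the strip `y < R` the control is `1`, where `ell` vanishes. Inside, a constant height is
optimal by convexity, and the strip has width `R`. -/
theorem lintegral_ell_section {R u : ℝ} (hR0 : 0 ≤ R) (hR1 : R ≤ 1) (hu : 0 ≤ u) :
    ∫⁻ y in Icc (0 : ℝ) 1,
        ENNReal.ofReal (ell ((if y < R then (u / R).toNNReal else 1 : ℝ≥0) : ℝ))
      = ENNReal.ofReal (R * ell (u / R)) := by
  have e : ∀ y, ENNReal.ofReal (ell ((if y < R then (u / R).toNNReal else 1 : ℝ≥0) : ℝ))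
      = indicator {y | y < R} (fun _ => ENNReal.ofReal (ell (u / R))) y := by
    intro y
    by_cases hy : y < R
    · rw [indicator_of_mem (by simpa using hy), if_pos hy, Real.coe_toNNReal _ (div_nonneg hu hR0)]
    · rw [indicator_of_notMem (by simpa using hy), if_neg hy]
      simp [ell]
  simp_rw [e]
  have hm : MeasurableSet {y : ℝ | y < R} := measurableSet_Iio
  rw [setLIntegral_indicator hm, inter_comm, Icc_inter_lt hR1, setLIntegral_const,
    Real.volume_Ico, sub_zero, ENNReal.ofReal_mul hR0, mul_comm]

/-- On `(t₁, t₂)` the rates of `x` are `R`, and the intensities `u` vanish with the rates. -/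
structure IsAdmissible (t₁ t₂ : ℝ) (x : ℝ → State) (R u : ℕ → ℝ → ℝ) : Prop where
  measurable : ∀ k, Measurable (u k)
  measurable_rate : ∀ k, Measurable (R k)
  rate_eq : ∀ k, ∀ s ∈ Ioo t₁ t₂, rate (x s) k = R k s
  rate_nonneg : ∀ k, ∀ s ∈ Ioo t₁ t₂, 0 ≤ R k s
  rate_le_one : ∀ k, ∀ s ∈ Ioo t₁ t₂, R k s ≤ 1
  eq_zero : ∀ k, ∀ s ∈ Ioo t₁ t₂, R k s = 0 → u k s = 0

/-- Fubini for a control of height `u/R` on a strip of width `R`; sections with `R = 0` are harmless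
because `u` vanishes there. The endpoint is dropped as a null set, since the rates are prescribed
only on the open interval. -/
theorem IsAdmissible.thinned_concat (h : IsAdmissible t₁ t₂ x R u)
    (hx : IsExcursion qbar q t₁ t₂ x u) (k : ℕ) {t : ℝ} (ht : t ∈ Icc t₁ t₂) :
    IntegrableOn (thinned (concat t₁ γ.1 x) (concatControl t₁ φ₀ R u) k) (Ioc t₁ t ×ˢ Icc 0 1) ∧
    ∫ z in Ioc t₁ t ×ˢ Icc (0 : ℝ) 1, thinned (concat t₁ γ.1 x) (concatControl t₁ φ₀ R u) k z
      = ∫ s in t₁..t, u k s := by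
  set F : ℝ × ℝ → ℝ := indicator {z | z.2 < R k z.1} fun z => u k z.1 / R k z.1 with hF
  have hset : MeasurableSet {z : ℝ × ℝ | z.2 < R k z.1} :=
    measurableSet_lt measurable_snd ((h.measurable_rate k).comp measurable_fst)
  have hFm : Measurable F :=
    (((h.measurable k).comp measurable_fst).div
      ((h.measurable_rate k).comp measurable_fst)).indicator hset
  have hsub : Ioo t₁ t ⊆ Ioo t₁ t₂ := Ioo_subset_Ioo_right ht.2
  have hsec : ∀ s y, F (s, y) = indicator {y | y < R k s} (fun _ => u k s / R k s) y :=
    fun s y => rfl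
  have hint : ∀ s ∈ Ioo t₁ t, ∫ y in Icc (0 : ℝ) 1, F (s, y) = u k s := fun s hs => by
    simp_rw [hsec]
    exact integral_thinned_section (h.rate_nonneg k s (hsub hs)) (h.rate_le_one k s (hsub hs))
      (h.eq_zero k s (hsub hs))
  have hF0 : ∀ s ∈ Ioo t₁ t, ∀ y, 0 ≤ F (s, y) := fun s hs y =>
    indicator_nonneg (fun _ _ => div_nonneg (hx.nonneg k s) (h.rate_nonneg k s (hsub hs))) _
  have hui : IntegrableOn (u k) (Ioo t₁ t) := by
    have := ((intervalIntegrable_iff_integrableOn_Ioo_of_le hx.le).1 (hx.integrable k))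
    exact this.mono_set hsub
  have hI : IntegrableOn F (Ioo t₁ t ×ˢ Icc (0 : ℝ) 1) (volume.prod volume) := by
    rw [IntegrableOn, ← Measure.prod_restrict, integrable_prod_iff hFm.aestronglyMeasurable]
    constructor
    · refine ae_of_all _ fun s => ?_
      simp_rw [hsec]
      exact (integrable_const _).indicator measurableSet_Iio
    · refine hui.congr_fun (fun s hs => ?_) measurableSet_Ioo
      rw [← hint s hs]
      exact integral_congr_ae (ae_of_all _ fun y => (Real.norm_of_nonneg (hF0 s hs y)).symm)
  have hEq : EqOn F (thinned (concat t₁ γ.1 x) (concatControl t₁ φ₀ R u) k)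
      (Ioo t₁ t ×ˢ Icc (0 : ℝ) 1) := by
    rintro ⟨s, y⟩ ⟨hs, -⟩
    rw [hsec, thinned_concat_right hs.1 (h.rate_eq k s (hsub hs)) (h.rate_nonneg k s (hsub hs))
      (hx.nonneg k s)]
  have hmeas : MeasurableSet (Ioo t₁ t ×ˢ Icc (0 : ℝ) 1) := measurableSet_Ioo.prod measurableSet_Icc
  have hres : (volume : Measure (ℝ × ℝ)).restrict (Ioc t₁ t ×ˢ Icc (0 : ℝ) 1)
      = (volume.prod volume).restrict (Ioo t₁ t ×ˢ Icc (0 : ℝ) 1) := by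
    rw [Measure.volume_eq_prod, ← Measure.prod_restrict, ← Measure.prod_restrict,
      restrict_Ioo_eq_restrict_Ioc]
  constructor
  · rw [IntegrableOn, hres]
    exact hI.congr_fun hEq hmeas
  · rw [hres, ← setIntegral_congr_fun hmeas hEq, setIntegral_prod _ hI,
      setIntegral_congr_fun measurableSet_Ioo hint, intervalIntegral.integral_of_le ht.1,
      integral_Ioc_eq_integral_Ioo]

theorem thinned_concat_left {k : ℕ} {z : ℝ × ℝ} (hz : z.1 ≤ t₁) :
    thinned (concat t₁ γ.1 x) (concatControl t₁ φ₀ R u) k z = thinned γ.1 φ₀ k z := by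
  unfold thinned
  have h1 : concat t₁ γ.1 x z.1 = γ.1 z.1 := if_pos hz
  by_cases hy : z.2 < rate (γ.1 z.1) k
  · rw [indicator_of_mem (by simpa [h1] using hy), indicator_of_mem (by simpa using hy),
      concatControl, if_pos hz]
  · rw [indicator_of_notMem (by simpa [h1] using hy), indicator_of_notMem (by simpa using hy)]

theorem IsAdmissible.isControl_concat (h : IsAdmissible t₁ t₂ x R u)
    (hx : IsExcursion qbar q t₁ t₂ x u) (ht : 0 ≤ t₁) (hend : γ.1 t₁ = state 0 qbar)
    (hφ : IsControl p t₁ γ.1 γ.2 φ₀) :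
    IsControl p t₂ (concat t₁ γ.1 x) (concat t₁ γ.2 fun t => γ.2 t₁ + x t 0)
      (concatControl t₁ φ₀ R u) := by
  have hs : γ.1 t₁ = x t₁ := hend.trans hx.start_eq.symm
  have hs2 : γ.2 t₁ = γ.2 t₁ + x t₁ 0 := by rw [hx.start_eq, state_zero, add_zero]
  have hEq : ∀ k, ∀ t ≤ t₁, EqOn (thinned γ.1 φ₀ k)
      (thinned (concat t₁ γ.1 x) (concatControl t₁ φ₀ R u) k) (Icc 0 t ×ˢ Icc (0 : ℝ) 1) :=
    fun k t htt z hz => (thinned_concat_left (hz.1.2.trans htt)).symm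
  have hmeas : ∀ t : ℝ, MeasurableSet (Icc 0 t ×ˢ Icc (0 : ℝ) 1) := fun t =>
    measurableSet_Icc.prod measurableSet_Icc
  have hL : ∀ k, ∀ t ≤ t₁, ∫ z in Icc 0 t ×ˢ Icc (0 : ℝ) 1,
      thinned (concat t₁ γ.1 x) (concatControl t₁ φ₀ R u) k z
        = ∫ z in Icc 0 t ×ˢ Icc (0 : ℝ) 1, thinned γ.1 φ₀ k z := fun k t htt =>
    (setIntegral_congr_fun (hmeas t) (hEq k t htt)).symm
  have hLI : ∀ k, IntegrableOn (thinned (concat t₁ γ.1 x) (concatControl t₁ φ₀ R u) k)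
      (Icc 0 t₁ ×ˢ Icc (0 : ℝ) 1) := fun k =>
    (hφ.integrable k).congr_fun (hEq k t₁ le_rfl) (hmeas t₁)
  have hun : ∀ t, t₁ ≤ t → Icc 0 t ×ˢ Icc (0 : ℝ) 1
      = Icc 0 t₁ ×ˢ Icc (0 : ℝ) 1 ∪ Ioc t₁ t ×ˢ Icc (0 : ℝ) 1 := fun t htt => by
    rw [← union_prod, Icc_union_Ioc_eq_Icc ht htt]
  have hdis : ∀ t, Disjoint (Icc 0 t₁ ×ˢ Icc (0 : ℝ) 1) (Ioc t₁ t ×ˢ Icc (0 : ℝ) 1) := fun t =>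
    Disjoint.set_prod_left (disjoint_left.2 fun a ha hb => (hb.1.trans_le ha.2).false) _ _
  have hRt : ∀ k, ∀ t ∈ Icc t₁ t₂, ∫ z in Icc 0 t ×ˢ Icc (0 : ℝ) 1,
      thinned (concat t₁ γ.1 x) (concatControl t₁ φ₀ R u) k z
        = (∫ z in Icc 0 t₁ ×ˢ Icc (0 : ℝ) 1, thinned γ.1 φ₀ k z) + ∫ s in t₁..t, u k s := by
    intro k t htt
    have h1 := h.thinned_concat (γ := γ) (φ₀ := φ₀) hx k htt
    rw [hun t htt.1, setIntegral_union (hdis t) (measurableSet_Ioc.prod measurableSet_Icc)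
      (hLI k) h1.1, h1.2, hL k t₁ le_rfl]
  refine ⟨fun k => measurable_concatControl (hφ.measurable k) (h.measurable_rate k)
    (h.measurable k), fun k => ?_, fun t htt => ?_, fun k t htt => ?_⟩
  · rw [hun t₂ hx.le]
    exact (hLI k).union (h.thinned_concat hx k ⟨hx.le, le_rfl⟩).1
  · rcases le_total t t₁ with h' | h'
    · rw [concat_left _ _ h']
      simp_rw [hL _ t h']
      exact hφ.psi_eq t ⟨htt.1, h'⟩
    · rw [concat_right hs2 h']
      simp_rw [hRt _ t ⟨h', htt.2⟩, mul_add]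
      exact (hφ.psi_eq t₁ ⟨ht, le_rfl⟩).add (hx.zero_eq t ⟨h', htt.2⟩)
  · rcases le_total t t₁ with h' | h'
    · rw [concat_left _ _ h', hL _ t h']
      exact hφ.zeta_eq k t ⟨htt.1, h'⟩
    · rw [concat_right hs h', hRt _ t ⟨h', htt.2⟩, hx.pnat_eq k t ⟨h', htt.2⟩]
      have := hφ.zeta_eq k t₁ ⟨ht, le_rfl⟩
      rw [hend, state_pnat] at this
      rw [this]
      ring

theorem IsAdmissible.controlCost_concat (h : IsAdmissible t₁ t₂ x R u)
    (hx : IsExcursion qbar q t₁ t₂ x u) (hφ : ∀ k, Measurable (φ₀ k)) :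
    controlCost t₁ t₂ (concatControl t₁ φ₀ R u)
      = ∫⁻ s in Ioo t₁ t₂, ∑' k, ENNReal.ofReal (R k s * ell (u k s / R k s)) := by
  rw [controlCost_eq fun k => measurable_concatControl (hφ k) (h.measurable_rate k)
    (h.measurable k), ← restrict_Ioo_eq_restrict_Icc]
  refine setLIntegral_congr_fun measurableSet_Ioo fun s hs => ?_
  refine tsum_congr fun k => ?_
  rw [← lintegral_ell_section (h.rate_nonneg k s hs) (h.rate_le_one k s hs) (hx.nonneg k s)]
  simp only [concatControl, not_le.2 hs.1, if_false]

/-- Any admissible excursion of slope `-2` can be appended to a path of finite cost. -/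
theorem IsAdmissible.I2_le (h : IsAdmissible t₁ t₂ x R u) (hx : IsExcursion qbar q t₁ t₂ x u)
    (hp : IsDegreeLaw p) (h0 : 0 ≤ q) (hqb : q ≤ qbar) (hb : qbar ≤ p) (ht : 0 ≤ t₁)
    (hγ : ∃ γ ∈ J0 p 0 t₁ (state 0 p) (state 0 qbar), pathCost p 0 t₁ γ.1 γ.2 < ⊤)
    (hr : ∀ t ∈ Ioo t₁ t₂, HasDerivAt (fun s => r (x s)) (-2) t) :
    I2 p t₁ t₂ (state 0 qbar) (state 0 (qbar - q))
      ≤ ∫⁻ s in Ioo t₁ t₂, ∑' k, ENNReal.ofReal (R k s * ell (u k s / R k s)) := by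
  obtain ⟨γ, hγ, hfin⟩ := hγ
  obtain ⟨φ₀, hφ⟩ := iInf_lt_top.1 hfin
  obtain ⟨hφ, -⟩ := iInf_lt_top.1 hφ
  have hs : γ.1 t₁ = x t₁ := hγ.2.2.trans hx.start_eq.symm
  have hs2 : γ.2 t₁ = γ.2 t₁ + x t₁ 0 := by rw [hx.start_eq, state_zero, add_zero]
  have hJ : (concat t₁ γ.1 x, concat t₁ γ.2 fun t => γ.2 t₁ + x t 0)
      ∈ J2 p t₁ t₂ (state 0 qbar) (state 0 (qbar - q)) := by
    refine ⟨⟨⟨isPath_concat hp h0 hqb hb ht hγ hx, ?_, ?_⟩, fun t htt => ?_⟩, ?_⟩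
    · exact (concat_left _ _ le_rfl).trans hγ.2.2
    · exact (concat_right hs hx.le).trans hx.end_eq
    · have e : concat t₁ γ.2 (fun t => γ.2 t₁ + x t 0) t = γ.2 t₁ + x t 0 :=
        concat_right hs2 htt.1.le
      simp only [concat_left _ _ le_rfl, e, state_zero]
      linarith [hx.zero_nonneg t (Ioo_subset_Icc_self htt)]
    · rw [ae_restrict_iff' measurableSet_Ioo]
      refine ae_of_all _ fun t htt => (hr t htt).congr_of_eventuallyEq ?_
      filter_upwards [Ioo_mem_nhds htt.1 htt.2] with s hs'
      simp only [concat_right hs hs'.1.le]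
  refine (iInf₂_le _ hJ).trans ?_
  rw [← h.controlCost_concat hx hφ.measurable]
  exact iInf₂_le _ (h.isControl_concat hx ht hγ.2.2 hφ)

end Concat

/-! ### The optimal excursion -/

/-- The substitution `m = t₂ - s`. Integrability of `f'` comes from its sign and the continuity of
`f` on the closed interval, so no bound on the derivative near the endpoints is required. -/
theorem integral_reversed_deriv {f f' : ℝ → ℝ} {m₀ t₁ t₂ : ℝ} (h12 : t₁ ≤ t₂)
    (hm : t₂ = t₁ + m₀) (hc : ContinuousOn f (Icc 0 m₀))
    (hd : ∀ m ∈ Ioo 0 m₀, HasDerivAt f (f' m) m) (h0 : ∀ m ∈ Ioo 0 m₀, 0 ≤ f' m) :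
    IntervalIntegrable (indicator (Ioo t₁ t₂) fun s => f' (t₂ - s)) volume t₁ t₂ ∧
      ∀ t ∈ Icc t₁ t₂, ∫ s in t₁..t, indicator (Ioo t₁ t₂) (fun s => f' (t₂ - s)) s
        = f m₀ - f (t₂ - t) := by
  have hmem : ∀ s ∈ Ioo t₁ t₂, t₂ - s ∈ Ioo 0 m₀ := fun s hs =>
    ⟨by linarith [hs.2], by linarith [hs.1]⟩
  have hc' : ContinuousOn (fun s => -f (t₂ - s)) (Icc t₁ t₂) := by
    refine (hc.comp (by fun_prop) fun s hs => ?_).neg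
    exact ⟨by linarith [hs.2], by linarith [hs.1]⟩
  have hd' : ∀ s ∈ Ioo t₁ t₂, HasDerivAt (fun s => -f (t₂ - s))
      (indicator (Ioo t₁ t₂) (fun s => f' (t₂ - s)) s) s := fun s hs => by
    rw [indicator_of_mem hs]
    have h1 := ((hd _ (hmem s hs)).comp s ((hasDerivAt_id s).const_sub t₂)).neg
    refine h1.congr_deriv ?_
    ring
  have hI : IntervalIntegrable (indicator (Ioo t₁ t₂) fun s => f' (t₂ - s)) volume t₁ t₂ := by
    rw [intervalIntegrable_iff_integrableOn_Ioc_of_le h12]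
    refine intervalIntegral.integrableOn_deriv_of_nonneg hc' hd' fun s hs => ?_
    rw [indicator_of_mem hs]
    exact h0 _ (hmem s hs)
  refine ⟨hI, fun t ht => ?_⟩
  rw [intervalIntegral.integral_eq_sub_of_hasDerivAt_of_le ht.1
    (hc'.mono (Icc_subset_Icc_right ht.2)) (fun s hs => hd' s ⟨hs.1, hs.2.trans_le ht.2⟩)
    (hI.mono_set (uIcc_subset_uIcc left_mem_uIcc (by rwa [uIcc_of_le h12])))]
  have : t₂ - t₁ = m₀ := by linarith
  rw [this]
  ring

theorem _root_.ContinuousOn.measurable_indicator {f : ℝ → ℝ} {s : Set ℝ} (hf : ContinuousOn f s)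
    (hs : MeasurableSet s) : Measurable (indicator s f) := by
  classical
  rw [← piecewise_eq_indicator]
  exact hf.measurable_piecewise continuousOn_const hs

section Optimal

variable {p q qbar : DegSeq} {b : ℝ}

theorem IsBeta.optIntensity_nonneg (h : IsBeta q b) (hp : IsDegreeLaw p) (h0 : 0 ≤ q)
    (hq : q ≤ p) (hm₀ : 0 < 1 / 2 * degreeMass q) {m : ℝ}
    (hm : m ∈ Ioo 0 (1 / 2 * degreeMass q)) (k : ℕ) :
    0 ≤ optIntensity q (shift q b) (1 / 2 * degreeMass q) m k := by
  have hC := h.shift_nonneg hm₀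
  have hmC : 0 ≤ m + shift q b := by linarith [hm.1]
  rcases Nat.eq_zero_or_pos k with rfl | hk
  · rw [optIntensity, state_zero]
    exact div_nonneg (h.active_nonneg hp h0 hq hm₀ (Ioo_subset_Icc_self hm)) (by positivity)
  · lift k to ℕ+ using hk
    rw [optIntensity, state_pnat]
    exact slopeAt_nonneg hm₀.le hmC h0 k

theorem mass_optState_nonneg {C m₀ m : ℝ} (hm₀ : 0 < m₀) (h0 : 0 ≤ q) (hqb : q ≤ qbar)
    (hm : 0 ≤ m) (k : ℕ) : 0 ≤ mass (optState q qbar C m₀ m) k := by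
  rcases Nat.eq_zero_or_pos k with rfl | hk
  · rw [mass_zero]
    exact le_max_right _ _
  · lift k to ℕ+ using hk
    rw [mass_pnat, optState, state_pnat]
    exact mul_nonneg (by positivity) (profile_nonneg hm₀ h0 hqb hm k)

/-- The intensities of the optimal excursion on `(t₁, t₂)`. -/
def optDrive (q : DegSeq) (C m₀ t₁ t₂ : ℝ) (k : ℕ) : ℝ → ℝ :=
  indicator (Ioo t₁ t₂) fun s => optIntensity q C m₀ (t₂ - s) k

/-- The rates of the optimal excursion on `(t₁, t₂)`. -/
def optRate (q qbar : DegSeq) (C m₀ t₁ t₂ : ℝ) (k : ℕ) : ℝ → ℝ :=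
  indicator (Ioo t₁ t₂) fun s => rate (optState q qbar C m₀ (t₂ - s)) k

theorem IsBeta.isExcursion (h : IsBeta q b) (hp : IsDegreeLaw p) (h0 : 0 ≤ q)
    (hq : q ≤ p) (hm₀ : 0 < 1 / 2 * degreeMass q) {t₁ t₂ : ℝ}
    (ht : t₂ = t₁ + 1 / 2 * degreeMass q) :
    IsExcursion qbar q t₁ t₂
      (fun t => optState q qbar (shift q b) (1 / 2 * degreeMass q) (t₂ - t))
      (optDrive q (shift q b) (1 / 2 * degreeMass q) t₁ t₂) := by
  have hC := h.shift_nonneg hm₀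
  have h12 : t₁ ≤ t₂ := by linarith
  have hvm := (hp.summable_of_le h0 hq).hasSum
  have hdm := (hp.summable_mul_of_le h0 hq).hasSum
  have hdef : degreeMass q = 2 * (1 / 2 * degreeMass q) := by ring
  change HasSum _ (degreeMass q) at hdm
  rw [hdef] at hdm
  have hin := fun m (hm : m ∈ Ioo 0 (1 / 2 * degreeMass q)) k =>
    h.optIntensity_nonneg hp h0 hq hm₀ hm k
  have hact := fun m (hm : m ∈ Icc 0 (1 / 2 * degreeMass q)) => h.active_nonneg hp h0 hq hm₀ hm
  have hsl := fun m (hm : m ∈ Ioo 0 (1 / 2 * degreeMass q)) =>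
    h.hasSum_slopeAt hp h0 hq hm₀ (Ioo_subset_Ioc_self hm)
  set m₀ := 1 / 2 * degreeMass q
  set C := shift q b
  have hmem : ∀ s ∈ Ioo t₁ t₂, t₂ - s ∈ Ioo 0 m₀ := fun s hs =>
    ⟨by linarith [hs.2], by linarith [hs.1]⟩
  have hmem' : ∀ s ∈ Icc t₁ t₂, t₂ - s ∈ Icc 0 m₀ := fun s hs =>
    ⟨by linarith [hs.2], by linarith [hs.1]⟩
  have hpos : ∀ k : ℕ+, _ := fun k : ℕ+ => integral_reversed_deriv (m₀ := m₀) h12 ht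
    (f := fun m => coef C m₀ q k * gap C m k) (f' := fun m => optIntensity q C m₀ m k)
    ((continuous_gap C k).const_mul _).continuousOn
    (fun m hm => by
      rw [optIntensity, state_pnat]
      exact hasDerivAt_coef_gap (by linarith [hm.1]) k) (fun m hm => hin m hm k)
  -- The intensity of coordinate `0` is `1` minus the total slope, so `m - remaining` is a
  -- primitive.
  have hzero := integral_reversed_deriv (m₀ := m₀) h12 ht
    (f := fun m => m - remaining C m₀ q m) (f' := fun m => optIntensity q C m₀ m 0)
    (continuousOn_id.sub (continuousOn_remaining hp h0 hq hC hm₀))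
    (fun m hm => by
      refine ((hasDerivAt_id m).sub (hasDerivAt_remaining hp h0 hq hC hm₀ hm)).congr_deriv ?_
      rw [(hsl m hm).tsum_eq, optIntensity, state_zero]
      ring) (fun m hm => hin m hm 0)
  have hrem : remaining C m₀ q m₀ = ∑' k, q k := by
    unfold remaining
    simp_rw [coef_mul_gap hC hm₀]
  refine ⟨h12, fun k s => ?_, fun k => ?_, fun k t htt => ?_, fun t htt => ?_, fun t htt => ?_, ?_⟩
  · exact indicator_nonneg (fun s hs => hin _ (hmem s hs) k) s
  · rcases Nat.eq_zero_or_pos k with rfl | hk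
    · exact hzero.1
    · lift k to ℕ+ using hk
      exact (hpos k).1
  · have := (hpos k).2 t htt
    simp only [coef_mul_gap hC hm₀] at this
    simp only [optDrive, this, optState, state_pnat, profile, Pi.sub_apply]
    ring
  · rw [hasSum_nat_iff_pnat]
    have e : ∀ k : ℕ+, ∫ s in t₁..t, optDrive q C m₀ t₁ t₂ k s
        = q k - coef C m₀ q k * gap C (t₂ - t) k := fun k => by
      have := (hpos k).2 t htt
      simp only [coef_mul_gap hC hm₀] at this
      exact this
    have e0 : ∫ s in t₁..t, optDrive q C m₀ t₁ t₂ 0 s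
        = m₀ - ∑' k, q k - (t₂ - t - remaining C m₀ q (t₂ - t)) := by
      rw [← hrem]
      exact hzero.2 t htt
    simp_rw [e]
    rw [e0]
    have s1 := (summable_mul_coef_gap hp h0 hq hC hm₀ (hmem' t htt)).hasSum
    have s2 := (summable_coef_gap hp h0 hq hC hm₀ (hmem' t htt)).hasSum
    have s3 := (hdm.sub s1).sub ((hvm.sub s2).mul_left 2)
    have e3 : 2 * m₀ - ∑' k : ℕ+, (k : ℝ) * (coef C m₀ q k * gap C (t₂ - t) k)
        - 2 * (∑' k, q k - ∑' k, coef C m₀ q k * gap C (t₂ - t) k)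
        = optState q qbar C m₀ (t₂ - t) 0
          - ((0 : ℕ) - 2 : ℝ) * (m₀ - ∑' k, q k - (t₂ - t - remaining C m₀ q (t₂ - t))) := by
      rw [optState, state_zero, active, remaining]
      push_cast
      ring
    rw [e3] at s3
    refine s3.congr_fun fun k => ?_
    ring
  · simp only [optState, state_zero]
    exact hact _ (hmem' t htt)
  · refine state_ext ?_ fun k => ?_
    · simp only [optState, state_zero, sub_self, active_zero]
    · simp only [optState, state_pnat, sub_self, profile, gap_zero, mul_zero, add_zero]

theorem IsBeta.isAdmissible (h : IsBeta q b) (hp : IsDegreeLaw p) (h0 : 0 ≤ q)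
    (hqb : q ≤ qbar) (hb : qbar ≤ p) (hm₀ : 0 < 1 / 2 * degreeMass q) {t₁ t₂ : ℝ}
    (ht : t₂ = t₁ + 1 / 2 * degreeMass q) :
    IsAdmissible t₁ t₂
      (fun t => optState q qbar (shift q b) (1 / 2 * degreeMass q) (t₂ - t))
      (optRate q qbar (shift q b) (1 / 2 * degreeMass q) t₁ t₂)
      (optDrive q (shift q b) (1 / 2 * degreeMass q) t₁ t₂) := by
  have hq := hqb.trans hb
  have hC := h.shift_nonneg hm₀
  have hρ : 0 ≤ degreeMass (qbar - q) := IsExcursion.degreeMass_nonneg (sub_nonneg.2 hqb)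
  have hr := fun m (hm : m ∈ Ioo 0 (1 / 2 * degreeMass q)) =>
    h.r_optState hp h0 hqb hb hm₀ (Ioo_subset_Icc_self hm)
  have hmass := fun m (hm : m ∈ Ioo 0 (1 / 2 * degreeMass q)) =>
    h.hasSum_mass_optState hp h0 hqb hb hm₀ (Ioo_subset_Icc_self hm)
  have hact := fun m (hm : m ∈ Ioo 0 (1 / 2 * degreeMass q)) =>
    h.active_nonneg hp h0 hq hm₀ (Ioo_subset_Icc_self hm)
  have hcact := (continuousOn_active hp h0 hq hC hm₀).mono Ioo_subset_Icc_self
  set m₀ := 1 / 2 * degreeMass q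
  set C := shift q b
  have hmem : ∀ s ∈ Ioo t₁ t₂, t₂ - s ∈ Ioo 0 m₀ := fun s hs =>
    ⟨by linarith [hs.2], by linarith [hs.1]⟩
  have hM : ∀ m ∈ Ioo 0 m₀, 0 < 2 * (m + 1 / 2 * degreeMass (qbar - q)) := fun m hm => by
    linarith [hm.1]
  have hrev : ContinuousOn (fun s : ℝ => t₂ - s) (Ioo t₁ t₂) := by fun_prop
  have hmassc : ∀ k, ContinuousOn (fun m => mass (optState q qbar C m₀ m) k) (Ioo 0 m₀) := by
    intro k
    rcases Nat.eq_zero_or_pos k with rfl | hk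
    · simp only [mass_zero, optState, state_zero]
      exact hcact.sup continuousOn_const
    · lift k to ℕ+ using hk
      simp only [mass_pnat, optState, state_pnat, profile]
      exact (continuous_const.mul
        (continuous_const.add ((continuous_gap C k).const_mul _))).continuousOn
  -- The normalization `r` is an infinite series, but along this path it is affine in `m` by
  -- `IsBeta.r_optState`; this gives continuity and hence measurability of the rates.
  have hratec : ∀ k, ContinuousOn (fun m => rate (optState q qbar C m₀ m) k) (Ioo 0 m₀) := by
    intro k
    refine ((hmassc k).div (g := fun m => 2 * (m + 1 / 2 * degreeMass (qbar - q)))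
      (by fun_prop) fun m hm => (hM m hm).ne').congr fun m hm => ?_
    simp only [rate, hr m hm]
    rfl
  have hintc : ∀ k, ContinuousOn (fun m => optIntensity q C m₀ m k) (Ioo 0 m₀) := by
    have hne : ∀ m ∈ Ioo 0 m₀, 2 * (m + C) ≠ 0 := fun m hm => by
      have : 0 < m + C := by linarith [hm.1]
      positivity
    intro k
    rcases Nat.eq_zero_or_pos k with rfl | hk
    · simp only [optIntensity, state_zero]
      exact hcact.div (by fun_prop) hne
    · lift k to ℕ+ using hk
      simp only [optIntensity, state_pnat, slopeAt]
      exact continuousOn_const.mul (ContinuousOn.div (by fun_prop) (by fun_prop) hne)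
  refine ⟨fun k => ?_, fun k => ?_, fun k s hs => ?_, fun k s hs => ?_, fun k s hs => ?_,
    fun k s hs hz => ?_⟩
  · exact ((hintc k).comp hrev hmem).measurable_indicator measurableSet_Ioo
  · exact ((hratec k).comp hrev hmem).measurable_indicator measurableSet_Ioo
  · rw [optRate, indicator_of_mem hs]
  · rw [optRate, indicator_of_mem hs, rate, hr _ (hmem s hs)]
    exact div_nonneg (mass_optState_nonneg hm₀ h0 hqb (hmem s hs).1.le k) (hM _ (hmem s hs)).le
  · rw [optRate, indicator_of_mem hs, rate, hr _ (hmem s hs), div_le_one (hM _ (hmem s hs))]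
    exact le_hasSum (hmass _ (hmem s hs)) k fun j _ =>
      mass_optState_nonneg hm₀ h0 hqb (hmem s hs).1.le j
  · have hm := hmem s hs
    rw [optRate, indicator_of_mem hs, rate, hr _ hm, div_eq_zero_iff,
      or_iff_left (hM _ hm).ne'] at hz
    rw [optDrive, indicator_of_mem hs]
    rcases Nat.eq_zero_or_pos k with rfl | hk
    · rw [mass_zero, optState, state_zero, max_eq_left (hact _ hm)] at hz
      rw [optIntensity, state_zero, hz, zero_div]
    · lift k to ℕ+ using hk
      rw [mass_pnat, optState, state_pnat, mul_eq_zero, or_iff_right (by positivity)] at hz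
      rw [optIntensity, state_pnat]
      rcases (h0 k).eq_or_lt with hk | hk
      · simp [slopeAt, coef_eq_zero hk.symm]
      · exact absurd hz (profile_pos hC hm₀ hqb hm.1 hk).ne'

/-- The optimal excursion attains the value. -/
theorem IsBeta.I2_le (h : IsBeta q b) (hp : IsDegreeLaw p) (h0 : 0 ≤ q)
    (hqb : q ≤ qbar) (hb : qbar ≤ p) (hm₀ : 0 < 1 / 2 * degreeMass q) {t₁ : ℝ} (ht : 0 ≤ t₁)
    (hγ : ∃ γ ∈ J0 p 0 t₁ (state 0 p) (state 0 qbar), pathCost p 0 t₁ γ.1 γ.2 < ⊤) :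
    I2 p t₁ (t₁ + 1 / 2 * degreeMass q) (state 0 qbar) (state 0 (qbar - q))
      ≤ ENNReal.ofReal (H q + H (qbar - q) - H qbar + excess (shift q b) q) ∧
    0 ≤ H q + H (qbar - q) - H qbar + excess (shift q b) q := by
  have hq := hqb.trans hb
  have hadm := h.isAdmissible hp h0 hqb hb hm₀ (t₁ := t₁) rfl
  have hexc := h.isExcursion (qbar := qbar) hp h0 hq hm₀ (t₁ := t₁) rfl
  have hr := fun m (hm : m ∈ Icc 0 (1 / 2 * degreeMass q)) =>
    h.r_optState hp h0 hqb hb hm₀ hm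
  have hcs := fun m (hm : m ∈ Ioo 0 (1 / 2 * degreeMass q)) =>
    h.hasSum_costSlope hp h0 hqb hb hm₀ hm
  have hcd := fun m (hm : m ∈ Ioo 0 (1 / 2 * degreeMass q)) =>
    h.hasDerivAt_costToGo hp h0 hqb hb hm₀ hm
  have hcc := h.continuousOn_costToGo hp h0 hqb hb hm₀
  rw [← h.costToGo_sub hp h0 hqb hb hm₀]
  set m₀ := 1 / 2 * degreeMass q
  set C := shift q b
  set t₂ := t₁ + m₀ with ht₂
  have h12 : t₁ ≤ t₂ := by linarith
  have hmem : ∀ s ∈ Ioo t₁ t₂, t₂ - s ∈ Ioo 0 m₀ := fun s hs =>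
    ⟨by linarith [hs.2], by linarith [hs.1]⟩
  have hnn : ∀ s ∈ Ioo t₁ t₂, ∀ k, 0 ≤ optRate q qbar C m₀ t₁ t₂ k s
      * ell (optDrive q C m₀ t₁ t₂ k s / optRate q qbar C m₀ t₁ t₂ k s) := fun s hs k =>
    mul_nonneg (hadm.rate_nonneg k s hs)
      (ell_nonneg (div_nonneg (hexc.nonneg k s) (hadm.rate_nonneg k s hs)))
  have hsum : ∀ s ∈ Ioo t₁ t₂, HasSum (fun k => optRate q qbar C m₀ t₁ t₂ k s
      * ell (optDrive q C m₀ t₁ t₂ k s / optRate q qbar C m₀ t₁ t₂ k s))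
      (costSlope q qbar C m₀ (t₂ - s)) := fun s hs => by
    refine (hcs _ (hmem s hs)).congr_fun fun k => ?_
    simp only [optRate, optDrive, indicator_of_mem hs]
  -- The slope is a sum of nonnegative costs. This sign both gives integrability over the whole
  -- interval and shows that the value is nonnegative.
  have hs0 : ∀ s ∈ Ioo t₁ t₂, 0 ≤ costSlope q qbar C m₀ (t₂ - s) := fun s hs =>
    (hsum s hs).nonneg (hnn s hs)
  obtain ⟨hI, hval⟩ := integral_reversed_deriv h12 ht₂ hcc hcd fun m hm => by
    have := hs0 (t₂ - m) ⟨by linarith [hm.2], by linarith [hm.1]⟩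
    rwa [sub_sub_cancel] at this
  have hval2 := hval t₂ ⟨h12, le_rfl⟩
  rw [sub_self] at hval2
  have hw0 : ∀ s, 0 ≤ indicator (Ioo t₁ t₂) (fun s => costSlope q qbar C m₀ (t₂ - s)) s :=
    indicator_nonneg hs0
  constructor
  · refine (hadm.I2_le hexc hp h0 hqb hb ht hγ fun t htt => ?_).trans_eq ?_
    · have hd : HasDerivAt (fun s => 2 * (t₂ - s + 1 / 2 * degreeMass (qbar - q))) (-2) t := by
        have := (((hasDerivAt_id t).const_sub t₂).add_const
          (1 / 2 * degreeMass (qbar - q))).const_mul 2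
        refine this.congr_deriv ?_
        ring
      refine hd.congr_of_eventuallyEq ?_
      filter_upwards [Ioo_mem_nhds htt.1 htt.2] with s hs
      exact hr _ (Ioo_subset_Icc_self (hmem s hs))
    · rw [← hval2, intervalIntegral.integral_of_le h12, integral_Ioc_eq_integral_Ioo,
        ofReal_integral_eq_lintegral_ofReal
          ((intervalIntegrable_iff_integrableOn_Ioo_of_le h12).1 hI) (ae_of_all _ hw0)]
      refine setLIntegral_congr_fun measurableSet_Ioo fun s hs => ?_
      simp only [indicator_of_mem hs]
      rw [← (hsum s hs).tsum_eq, ENNReal.ofReal_tsum_of_nonneg (hnn s hs) (hsum s hs).summable]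
  · rw [← hval2]
    exact intervalIntegral.integral_nonneg h12 fun s _ => hw0 s

end Optimal

/-! ### The value of the optimization problem -/

theorem excess_zero (q : DegSeq) : excess 0 q = 0 := by
  simp [excess]

theorem J2_subset_J1 (p : DegSeq) (t₁ t₂ : ℝ) (x₁ x₂ : State) :
    J2 p t₁ t₂ x₁ x₂ ⊆ J1 p t₁ t₂ x₁ x₂ := fun _ h => h.1

theorem I1_le_I2 (p : DegSeq) (t₁ t₂ : ℝ) (x₁ x₂ : State) :
    I1 p t₁ t₂ x₁ x₂ ≤ I2 p t₁ t₂ x₁ x₂ :=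
  biInf_mono (J2_subset_J1 p t₁ t₂ x₁ x₂)

theorem volume_Icc_self_prod (t : ℝ) : volume (Icc t t ×ˢ Icc (0 : ℝ) 1) = 0 := by
  simp [Measure.volume_eq_prod]

theorem controlCost_self (t : ℝ) (φ : ℕ → ℝ × ℝ → ℝ≥0) : controlCost t t φ = 0 := by
  simp only [controlCost, Measure.restrict_eq_zero.2 (volume_Icc_self_prod t),
    lintegral_zero_measure, tsum_zero]

/-- The cost is an integral over a null set. The prior path of finite cost is needed only so that
the infimum is not over the empty set. -/
theorem I2_self {p q : DegSeq} {t : ℝ}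
    (hγ : ∃ γ ∈ J0 p 0 t (state 0 p) (state 0 q), pathCost p 0 t γ.1 γ.2 < ⊤) :
    I2 p t t (state 0 q) (state 0 q) = 0 := by
  obtain ⟨γ, hγ, hfin⟩ := hγ
  obtain ⟨φ, hφ⟩ := iInf_lt_top.1 hfin
  obtain ⟨hφ, -⟩ := iInf_lt_top.1 hφ
  have hJ : γ ∈ J2 p t t (state 0 q) (state 0 q) := by
    refine ⟨⟨⟨hγ.1, hγ.2.2, hγ.2.2⟩, fun s hs => ?_⟩, ?_⟩
    · simp at hs
    · simp
  refine le_antisymm ((iInf₂_le _ hJ).trans ((iInf₂_le _ hφ).trans ?_)) zero_le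
  rw [controlCost_self]

theorem exists_path_zero (p : DegSeq) (hp : 0 ≤ p) :
    ∃ γ ∈ J0 p 0 0 (state 0 p) (state 0 p), pathCost p 0 0 γ.1 γ.2 < ⊤ := by
  have hac : ∀ c : ℝ, AbsolutelyContinuousOnInterval (fun _ : ℝ => c) 0 0 := fun c =>
    (LipschitzWith.const _).lipschitzOnWith.absolutelyContinuousOnInterval
  refine ⟨(fun _ => state 0 p, fun _ => 0), ⟨⟨rfl, hac 0, fun t ht => ?_, fun k => ?_, fun k => ?_,
    fun k => hac _, fun k t _ => ?_⟩, rfl, rfl⟩, ?_⟩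
  · simp [skorokhod, nonempty_Icc.2 ht.1]
  · simp
  · exact antitoneOn_const
  · simpa using hp k
  · have hc : IsControl p 0 (fun _ => state 0 p) (fun _ => 0) (fun _ _ => 1) := by
      have hz : ∀ t ∈ Icc (0 : ℝ) 0, volume.restrict (Icc 0 t ×ˢ Icc (0 : ℝ) 1) = 0 := by
        intro t ht
        rw [le_antisymm ht.2 ht.1]
        exact Measure.restrict_eq_zero.2 (volume_Icc_self_prod 0)
      refine ⟨fun k => measurable_const, fun k => ?_, fun t ht => ?_, fun k t ht => ?_⟩
      · rw [IntegrableOn, hz 0 ⟨le_rfl, le_rfl⟩]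
        exact integrable_zero_measure
      · simp only [hz t ht, integral_zero_measure, mul_zero]
        exact hasSum_zero
      · simp only [hz t ht, integral_zero_measure, sub_zero, state_pnat]
    refine lt_of_le_of_lt (iInf₂_le _ hc) ?_
    rw [controlCost_self]
    exact ENNReal.zero_lt_top

theorem eq_zero_of_degreeMass_eq_zero {p q : DegSeq} (hp : IsDegreeLaw p) (h0 : 0 ≤ q)
    (hq : q ≤ p) (h : degreeMass q = 0) : q = 0 := by
  funext k
  have h1 := (hp.summable_mul_of_le h0 hq).hasSum
  rw [← degreeMass, h, hasSum_zero_iff_of_nonneg fun k => mul_nonneg (by positivity) (h0 k)] at h1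
  simpa using congrFun h1 k

theorem exists_isBeta_of_supercritical {p q : DegSeq} (hp : IsDegreeLaw p) (h0 : 0 ≤ q)
    (hq : q ≤ p)
    (h : 2 * vertexMass q < degreeMass q ∨ (degreeMass q = 2 * vertexMass q ∧ p 1 = 0)) :
    ∃ b, IsBeta q b := by
  rcases (h0 1).eq_or_lt with h1 | h1
  · exact ⟨0, Or.inl ⟨h1.symm, rfl⟩⟩
  · refine exists_isBeta hp h0 hq h1 (h.resolve_right fun h2 => ?_)
    -- In the critical case `p 1 = 0` forces `q 1 = 0`, so a positive `q 1` leaves only the strict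
    -- inequality.
    have : q 1 ≤ 0 := h2.2 ▸ hq 1
    exact absurd h1 (not_lt.2 this)

/-- Everything is squeezed: the infimum of `I1` is at most `I2` at duration `½∑kq_k`, the candidate
bounds `I2` by the value, and the calibration bounds every `I1` below by it. -/
theorem value_eq {p q qbar : DegSeq} (hp : IsDegreeLaw p) (h0 : 0 ≤ q) (hqb : q ≤ qbar)
    (hb : qbar ≤ p)
    (h : 2 * vertexMass q < degreeMass q ∨ (degreeMass q = 2 * vertexMass q ∧ p 1 = 0))
    {t₁ : ℝ} (ht : 0 ≤ t₁)
    (hγ : ∃ γ ∈ J0 p 0 t₁ (state 0 p) (state 0 qbar), pathCost p 0 t₁ γ.1 γ.2 < ⊤) :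
    (⨅ (t₂ : ℝ) (_ : t₁ ≤ t₂), I1 p t₁ t₂ (state 0 qbar) (state 0 (qbar - q)))
        = ENNReal.ofReal (H q + H (qbar - q) - H qbar + K q) ∧
      I2 p t₁ (t₁ + 1 / 2 * degreeMass q) (state 0 qbar) (state 0 (qbar - q))
        = ENNReal.ofReal (H q + H (qbar - q) - H qbar + K q) ∧
      0 ≤ H q + H (qbar - q) - H qbar + K q := by
  have hq := hqb.trans hb
  have hd : 0 ≤ 1 / 2 * degreeMass q :=
    mul_nonneg (by norm_num) (IsExcursion.degreeMass_nonneg h0)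
  have hle : (⨅ (t₂ : ℝ) (_ : t₁ ≤ t₂), I1 p t₁ t₂ (state 0 qbar) (state 0 (qbar - q)))
      ≤ I2 p t₁ (t₁ + 1 / 2 * degreeMass q) (state 0 qbar) (state 0 (qbar - q)) :=
    (iInf₂_le _ (le_add_of_nonneg_right hd)).trans (I1_le_I2 _ _ _ _ _)
  suffices hs : I2 p t₁ (t₁ + 1 / 2 * degreeMass q) (state 0 qbar) (state 0 (qbar - q))
      ≤ ENNReal.ofReal (H q + H (qbar - q) - H qbar + K q) ∧
      ENNReal.ofReal (H q + H (qbar - q) - H qbar + K q)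
        ≤ (⨅ (t₂ : ℝ) (_ : t₁ ≤ t₂), I1 p t₁ t₂ (state 0 qbar) (state 0 (qbar - q))) ∧
      0 ≤ H q + H (qbar - q) - H qbar + K q by
    exact ⟨le_antisymm (hle.trans hs.1) hs.2.1, le_antisymm hs.1 (hs.2.1.trans hle), hs.2.2⟩
  -- At zero degree mass `q = 0` and both times coincide; the profile would divide by `gap C 0 k =
  -- 0`.
  rcases hd.eq_or_lt with hm₀ | hm₀
  · have hz : q = 0 := eq_zero_of_degreeMass_eq_zero hp h0 hq (by linarith)
    subst hz
    have hv : H (0 : DegSeq) + H (qbar - 0) - H qbar + K 0 = 0 := by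
      simp [H, K, degreeMass]
    rw [hv, ← hm₀, add_zero, sub_zero, I2_self hγ]
    simp
  · have hβ := isBeta_betaOf (exists_isBeta_of_supercritical hp h0 hq h)
    rw [← excess_shift_betaOf ⟨_, hβ⟩ hm₀]
    obtain ⟨h1, h2⟩ := hβ.I2_le hp h0 hqb hb hm₀ ht hγ
    refine ⟨h1, le_iInf₂ fun t₂ h12 => ?_, h2⟩
    rcases (hβ.shift_nonneg hm₀).eq_or_lt with hC | hC
    · rw [← hC, excess_zero, add_zero]
      exact le_I1_of_zero hp h0 hqb hb hm₀ ht h12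
    · exact le_I1_of_pos hp h0 hqb hb hm₀ ht h12 hC

theorem half_degreeMass_eq_varsigma {p q qbar : DegSeq} (hp : IsDegreeLaw p) (h0 : 0 ≤ q)
    (hqb : q ≤ qbar) (hb : qbar ≤ p) :
    1 / 2 * degreeMass q = varsigma (state 0 qbar) (state 0 (qbar - q)) := by
  have s1 := hp.summable_mul_of_le (h0.trans hqb) hb
  have s2 := hp.summable_mul_of_le h0 (hqb.trans hb)
  have s3 := hp.summable_mul_of_le (sub_nonneg.2 hqb) ((sub_le_self _ h0).trans hb)
  rw [varsigma, r_state_zero s1, r_state_zero s3, degreeMass_sub s1 s2]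
  ring

/-- The middle term `H (p - qbar)` cancels between the two legs, and what remains is symmetric in
`q` and `qbar`. -/
theorem I2_add_I2 {p q qbar : DegSeq} (hp : IsDegreeLaw p) (h1 : p 1 = 0) (h0 : 0 ≤ q)
    (hb0 : 0 ≤ qbar) (hle : q + qbar ≤ p) (hq : 2 * vertexMass q ≤ degreeMass q)
    (hqbar : 2 * vertexMass qbar ≤ degreeMass qbar) :
    I2 p 0 (1 / 2 * degreeMass qbar) (state 0 p) (state 0 (p - qbar))
      + I2 p (1 / 2 * degreeMass qbar) (1 / 2 * degreeMass qbar + 1 / 2 * degreeMass q)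
          (state 0 (p - qbar)) (state 0 (p - qbar - q))
      = ENNReal.ofReal (H q + H qbar + H (p - q - qbar) - H p + K q + K qbar) := by
  have hcrit : ∀ {x : DegSeq}, 2 * vertexMass x ≤ degreeMass x →
      2 * vertexMass x < degreeMass x ∨ (degreeMass x = 2 * vertexMass x ∧ p 1 = 0) := fun h =>
    h.lt_or_eq.imp id fun e => ⟨e.symm, h1⟩
  have hqp : qbar ≤ p := (le_add_of_nonneg_left h0).trans hle
  obtain ⟨-, e1, n1⟩ := value_eq hp hb0 hqp le_rfl (hcrit hqbar) le_rfl
    (exists_path_zero p hp.nonneg)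
  rw [zero_add] at e1
  -- The second leg must be appended to a path of finite cost, and finiteness of the first value
  -- supplies one.
  have hfin : ∃ γ ∈ J0 p 0 (1 / 2 * degreeMass qbar) (state 0 p) (state 0 (p - qbar)),
      pathCost p 0 (1 / 2 * degreeMass qbar) γ.1 γ.2 < ⊤ := by
    have h2 : I2 p 0 (1 / 2 * degreeMass qbar) (state 0 p) (state 0 (p - qbar)) < ⊤ := by
      rw [e1]
      exact ENNReal.ofReal_lt_top
    obtain ⟨γ, hγ⟩ := iInf_lt_top.1 h2
    obtain ⟨hJ, hγ⟩ := iInf_lt_top.1 hγ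
    exact ⟨γ, hJ.1.1, hγ⟩
  obtain ⟨-, e2, n2⟩ := value_eq hp h0 (le_sub_iff_add_le.2 hle) (sub_le_self _ hb0) (hcrit hq)
    (mul_nonneg (by norm_num) (IsExcursion.degreeMass_nonneg hb0)) hfin
  rw [e1, e2, ← ENNReal.ofReal_add n1 n2, sub_right_comm]
  congr 1
  ring

end ConfigModel

end

theorem mainTheorem9 (p : ConfigModel.DegSeq) (hp : ConfigModel.IsDegreeLaw p) :
    (∀ q qbar : ConfigModel.DegSeq, 0 ≤ q → q ≤ qbar → qbar ≤ p →
      (2 * ConfigModel.vertexMass q < ConfigModel.degreeMass q ∨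
        (ConfigModel.degreeMass q = 2 * ConfigModel.vertexMass q ∧ p 1 = 0)) →
      ∀ t₁ : ℝ, 0 ≤ t₁ →
      (∃ γ ∈ ConfigModel.J0 p 0 t₁ (ConfigModel.state 0 p) (ConfigModel.state 0 qbar),
        ConfigModel.pathCost p 0 t₁ γ.1 γ.2 < ⊤) →
      ∀ τ : ℝ, τ = 1 / 2 * ConfigModel.degreeMass q →
        τ = ConfigModel.varsigma (ConfigModel.state 0 qbar) (ConfigModel.state 0 (qbar - q)) ∧
        (⨅ (t₂ : ℝ) (_ : t₁ ≤ t₂),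
            ConfigModel.I1 p t₁ t₂ (ConfigModel.state 0 qbar) (ConfigModel.state 0 (qbar - q)))
          = ConfigModel.I2 p t₁ (t₁ + τ)
              (ConfigModel.state 0 qbar) (ConfigModel.state 0 (qbar - q)) ∧
        ((ConfigModel.I2 p t₁ (t₁ + τ)
              (ConfigModel.state 0 qbar) (ConfigModel.state 0 (qbar - q)) : ENNReal) : EReal)
          = ((ConfigModel.H q + ConfigModel.H (qbar - q) - ConfigModel.H qbar
                + ConfigModel.K q : ℝ) : EReal)) ∧
    (p 1 = 0 →
      ∀ q qbar : ConfigModel.DegSeq, 0 ≤ q → 0 ≤ qbar → q + qbar ≤ p →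
      2 * ConfigModel.vertexMass q ≤ ConfigModel.degreeMass q →
      2 * ConfigModel.vertexMass qbar ≤ ConfigModel.degreeMass qbar →
      ∀ τ τbar : ℝ, τ = 1 / 2 * ConfigModel.degreeMass q →
        τbar = 1 / 2 * ConfigModel.degreeMass qbar →
        τ = ConfigModel.varsigma (ConfigModel.state 0 p) (ConfigModel.state 0 (p - q)) ∧
        ConfigModel.I2 p 0 τbar (ConfigModel.state 0 p) (ConfigModel.state 0 (p - qbar))
          + ConfigModel.I2 p τbar (τbar + τ)
              (ConfigModel.state 0 (p - qbar)) (ConfigModel.state 0 (p - qbar - q))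
        = ConfigModel.I2 p 0 τ (ConfigModel.state 0 p) (ConfigModel.state 0 (p - q))
          + ConfigModel.I2 p τ (τ + τbar)
              (ConfigModel.state 0 (p - q)) (ConfigModel.state 0 (p - q - qbar))) := by
  refine ⟨?_, ?_⟩
  · rintro q qbar h0 hqb hb h t₁ ht hγ τ rfl
    obtain ⟨h1, h2, h3⟩ := ConfigModel.value_eq hp h0 hqb hb h ht hγ
    refine ⟨ConfigModel.half_degreeMass_eq_varsigma hp h0 hqb hb, h1.trans h2.symm, ?_⟩
    -- `ENNReal.ofReal` truncates at `0`; nonnegativity of the value makes the equality one of real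
    -- numbers.
    rw [h2, EReal.coe_ennreal_ofReal, max_eq_left h3]
  · rintro h1 q qbar h0 hb0 hle hq hqbar τ τbar rfl rfl
    refine ⟨ConfigModel.half_degreeMass_eq_varsigma hp h0
      ((le_add_of_nonneg_right hb0).trans hle) le_rfl, ?_⟩
    rw [ConfigModel.I2_add_I2 hp h1 h0 hb0 hle hq hqbar,
      ConfigModel.I2_add_I2 hp h1 hb0 h0 (by rwa [add_comm]) hqbar hq, sub_right_comm]
    congr 1
    ring
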